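/- Let $(K3)_{16}$ be the $4$-dimensional simplicial complex with vertices $1,\dots,16$ whose $4$-simplices are the images of $\{1,2,3,8,12\}$ and of $\{1,2,5,8,14\}$ under the permutation group generated by $$(1,3,8,4,9,16,15,2,14,12,6,7,13,5,10)\quad\text{and}\quad(1,11,16)(2,10,14)(3,12,13)(4,9,15)(5,7,8),$$ and let $M$ be its geometric realization. A function $f:M\to\mathbb{R}$ is called regular simplexwise linear (rsl) if it takes distinct values at distinct vertices and is linear on every simplex. For $x\in M$ put $M_x=\{y\in M\mid f(y)\le f(x)\}$. For a field $F$, a vertex $v$ is critical of index $i$ and multiplicity $m$ if $\dim_F H_i(M_v,M_v\setminus\{v\};F)=m>0$ (relative singular homology), and the number of critical points of index $i$ is $\mu_i(f,F)=\sum_v\dim_F H_i(M_v,M_v\setminus\{v\};F)$, the sum ranging over all $16$ vertices. Let $f$ be any rsl-function on $(K3)_{16}$. Then for every field $F$: 1. some vertex is critical of index $2$ with multiplicity higher than $2$; 2. only the $10$ middle vertices (those with at least three vertices strictly below and at least three vertices strictly above them with respect to $f$) can be critical of index $2$, and together they carry all critical points of index $2$ and build up the second Betti number: $$\sum_{v\text{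 middle}}\dim_F H_2(M_v,M_v\setminus\{v\};F)=\mu_2(f,F)=\dim_F H_2(M;F)=22 .$$ Moreover, every slicing of $f$, that is, every non-empty level set $f^{-1}(\alpha)$ with $\alpha\neq f(v)$ for all vertices $v$, is a connected (PL) $3$-manifold without boundary. -/

import Mathlib

universe u

noncomputable section

open CategoryTheory

/-! ### Singular homology of pairs, with coefficients in a field -/

/-- The singular chain complex of a topological space with coefficients in the field `F`. -/
def singularChains (F : Type u) [Field F] (X : TopCat.{0}) : ChainComplex (ModuleCat.{u} F) ℕ :=
  ((AlgebraicTopology.singularChainComplexFunctor (ModuleCat.{u} F)).obj (ModuleCat.of F F)).obj X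

/-- The chain map `C(A; F) ⟶ C(X; F)` induced by the inclusion of a subspace `A` of `X`. -/
def singularChainsIncl (F : Type u) [Field F] (X : Type) [TopologicalSpace X] (A : Set X) :
    singularChains F (TopCat.of A) ⟶ singularChains F (TopCat.of X) :=
  ((AlgebraicTopology.singularChainComplexFunctor (ModuleCat.{u} F)).obj (ModuleCat.of F F)).map
    (TopCat.ofHom ⟨Subtype.val, continuous_subtype_val⟩)

/-- Relative singular homology `H_i(X, A; F)`: the homology of the quotient complex
`C(X; F) / C(A; F)`. -/
def relativeHomology (F : Type u) [Field F] (X : Type) [TopologicalSpace X] (A : Set X) (i : ℕ) :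
    ModuleCat.{u} F :=
  (Limits.cokernel (singularChainsIncl F X A)).homology i

/-- The Betti number `b_i(X; F) = dim H_i(X; F)`, as a cardinal (so that infinite dimension is not
confused with dimension `0`). -/
def bettiNumber (F : Type u) [Field F] (X : Type) [TopologicalSpace X] (i : ℕ) : Cardinal.{u} :=
  Module.rank F ((singularChains F (TopCat.of X)).homology i)

/-! ### Simplicial complexes and regular simplexwise linear functions -/

namespace AbstractSimplicialComplex

variable {ι : Type} [Fintype ι] [DecidableEq ι]

/-- The geometric realization of a finite simplicial complex, in barycentric coordinates. -/
def realization (K : AbstractSimplicialComplex ι) : Set (ι → ℝ) :=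
  {x | x ∈ stdSimplex ℝ ι ∧ ∃ σ ∈ K.faces, ∀ i, i ∉ σ → x i = 0}

/-- A vertex, as a point of the geometric realization. -/
def vertex (K : AbstractSimplicialComplex ι) (v : ι) : K.realization :=
  ⟨Pi.single v 1, single_mem_stdSimplex ℝ v, {v}, K.singleton_mem v, fun i hi =>
    Pi.single_eq_of_ne (by simpa using hi) 1⟩

/-- Regular simplexwise linear functions: pairwise distinct values at the vertices, and linear
on every simplex. -/
structure IsRSL (K : AbstractSimplicialComplex ι) (f : K.realization → ℝ) : Prop where
  injective_vertex : Function.Injective fun v => f (K.vertex v)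
  linear_on_simplex : ∀ σ ∈ K.faces, ∀ x : K.realization, (∀ i, i ∉ σ → x.1 i = 0) →
    f x = ∑ i ∈ σ, x.1 i * f (K.vertex i)

variable {K : AbstractSimplicialComplex ι}

/-- The sublevel space `M_x = {y | f y ≤ f x}`. -/
def sublevel (f : K.realization → ℝ) (x : K.realization) : Set K.realization :=
  {y | f y ≤ f x}

/-- `dim H_i(M_x, M_x \ {x}; F)`. -/
def multiplicity (F : Type u) [Field F] (f : K.realization → ℝ) (x : K.realization) (i : ℕ) :
    Cardinal.{u} :=
  Module.rank F (relativeHomology F (sublevel f x) {y | y.1 ≠ x} i)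

/-- `x` is critical of index `i` and multiplicity `m` (over `F`): `dim H_i(M_x, M_x \ {x}; F) = m`
and `m > 0`. -/
def IsCritical (F : Type u) [Field F] (f : K.realization → ℝ) (x : K.realization) (i m : ℕ) :
    Prop :=
  multiplicity F f x i = m ∧ 0 < m

/-- The number `μ_i(f; F)` of critical points of index `i`, counted with multiplicity. -/
def criticalCount (F : Type u) [Field F] (f : K.realization → ℝ) (i : ℕ) : Cardinal.{u} :=
  ∑ v : ι, multiplicity F f (K.vertex v) i

/-- The middle vertices of `f`: all but the three lowest and the three highest vertices. -/
def middleVertices (f : K.realization → ℝ) : Finset ι :=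
  {v | 3 ≤ (Finset.univ.filter fun w => f (K.vertex w) < f (K.vertex v)).card ∧
    3 ≤ (Finset.univ.filter fun w => f (K.vertex v) < f (K.vertex w)).card}

/-- The level `f⁻¹(α)`, as a subset of the ambient coordinate space. It is called a slicing
if `α` is not the value of `f` at a vertex. -/
def level (f : K.realization → ℝ) (α : ℝ) : Set (ι → ℝ) :=
  Subtype.val '' (f ⁻¹' {α})

end AbstractSimplicialComplex

/-! ### PL manifolds -/

/-- A subset `X` of a Euclidean space is a PL `d`-manifold (without boundary) if each of its points
lies in an open subset of `X` that is mapped homeomorphically and piecewise linearly onto an open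
subset of `ℝ^d`. Piecewise linear means that every point of the domain has a neighbourhood in `X`
that is a finite union of polytopes contained in the domain, on each of which the map is the
restriction of an affine map. -/
def IsPLManifold {ι : Type} [Fintype ι] (d : ℕ) (X : Set (ι → ℝ)) : Prop :=
  ∀ y : X, ∃ e : OpenPartialHomeomorph X (EuclideanSpace ℝ (Fin d)), y ∈ e.source ∧
    ∀ z ∈ e.source, ∃ P : Finset (Finset (ι → ℝ)),
      (⋃ s ∈ P, convexHull ℝ (s : Set (ι → ℝ))) ⊆ Subtype.val '' e.source ∧
      (⋃ s ∈ P, convexHull ℝ (s : Set (ι → ℝ))) ∈ nhdsWithin z.1 X ∧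
      ∀ s ∈ P, ∃ A : (ι → ℝ) →ᵃ[ℝ] EuclideanSpace ℝ (Fin d),
        ∀ w : X, w.1 ∈ convexHull ℝ (s : Set (ι → ℝ)) → e w = A w.1

end

/-! ### The 16-vertex triangulation of the K3 surface

The vertices `1, …, 16` are labelled `0, …, 15` here. -/

namespace K3

/-- `(1,3,8,4,9,16,15,2,14,12,6,7,13,5,10)` in the labels `1, …, 16`. -/
def genA : Equiv.Perm (Fin 16) := c[0, 2, 7, 3, 8, 15, 14, 1, 13, 11, 5, 6, 12, 4, 9]

/-- `(1,11,16)(2,10,14)(3,12,13)(4,9,15)(5,7,8)` in the labels `1, …, 16`. -/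
def genB : Equiv.Perm (Fin 16) :=
  c[0, 10, 15] * c[1, 9, 13] * c[2, 11, 12] * c[3, 8, 14] * c[4, 6, 7]

/-- The group generated by the two permutations. -/
def symmetryGroup : Subgroup (Equiv.Perm (Fin 16)) := Subgroup.closure {genA, genB}

/-- The 4-simplices: the orbits of `{1,2,3,8,12}` and `{1,2,5,8,14}` (labels `1, …, 16`). -/
def facets : Set (Finset (Fin 16)) :=
  {σ | ∃ g ∈ symmetryGroup, σ = ({0, 1, 2, 7, 11} : Finset (Fin 16)).image g ∨
    σ = ({0, 1, 4, 7, 13} : Finset (Fin 16)).image g}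

theorem exists_facet (v : Fin 16) : ∃ σ ∈ facets, v ∈ σ := by
  have hA : genA ∈ symmetryGroup := Subgroup.subset_closure (by simp)
  have hB : genB ∈ symmetryGroup := Subgroup.subset_closure (by simp)
  have h : ∀ v : Fin 16, (∃ k : Fin 15, v ∈ ({0, 1, 2, 7, 11} : Finset (Fin 16)).image (genA ^ k.1)) ∨
      v ∈ ({0, 1, 2, 7, 11} : Finset (Fin 16)).image genB := by
    decide +kernel
  rcases h v with ⟨k, hk⟩ | hv
  · exact ⟨_, ⟨genA ^ k.1, pow_mem hA _, Or.inl rfl⟩, hk⟩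
  · exact ⟨_, ⟨genB, hB, Or.inl rfl⟩, hv⟩

/-- The simplicial complex `(K3)₁₆`: all nonempty subsets of the 4-simplices. -/
def complex : AbstractSimplicialComplex (Fin 16) where
  faces := {τ | τ.Nonempty ∧ ∃ σ ∈ facets, τ ⊆ σ}
  isRelLowerSet_faces := fun _ h =>
    ⟨h.1, fun _ hb hne => ⟨hne, h.2.imp fun _ hσ => ⟨hσ.1, hb.trans hσ.2⟩⟩⟩
  singleton_mem v := ⟨Finset.singleton_nonempty v,
    (exists_facet v).imp fun _ h => ⟨h.1, Finset.singleton_subset_iff.2 h.2⟩⟩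

end K3

/-!
The critical points of an rsl-function `f` are found from a version of the exact homology sequence
that adds one vertex at a time. If `v` is a vertex of a finite simplicial complex and `M_v` the
sublevel set up to `v`, then `M_v` is covered by `M_v \ {v}`, which retracts to the full subcomplex
on the vertices below `v`, and by the open star of `v`, which is contractible and meets `M_v \ {v}`
in a set that retracts to the part of the link of `v` below `v`. Excision for singular homology
therefore identifies `H_i(M_v, M_v \ {v})` with the reduced homology in degree `i - 1` of this part
of the link. Mathlib has no excision theorem, so it is derived here from barycentric subdivision:
a chain whose boundary is small with respect to an open cover is homologous to a small chain
(`SingularChain.exists_sub_d_mem_small`, `SingularChain.rank_relativeHomology_eq`). All that is used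
about homology afterwards is the numerical form of the resulting exact sequences
(`SingularChain.exists_ranks_of_cover`, `SimplexFamily.exists_ranks_lowerPart`,
`SimplexFamily.exists_ranks_rb`). In particular, no simplicial homology is needed: Betti numbers of
complexes are computed by removing vertices one after the other. They are encoded in the sequence
`SimplexFamily.rb` of reduced Betti numbers, shifted so that `rb F P j` belongs to degree `j - 1`.

For `(K3)₁₆` the following facts enter. Its symmetry group is doubly transitive, and any three
vertices span a triangle. The links of vertices and of edges are homology spheres of dimensions `3`
and `2`, and they become acyclic if a vertex is removed; after one vertex is removed this is
witnessed by a list of vertices certifying nonevasiveness, which is checked by computation for a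
single vertex and a single edge. As a consequence, all induced subcomplexes of the link of a vertex
are connected, none of them has homology in degree `2`, and those on at most two or on at least
thirteen of the fifteen vertices have no homology in degree `1`. Hence vertices that are not middle
vertices are not critical of index `2`, and since the exact sequences split into short ones, the
multiplicities of index `2` add up to the second Betti number (`K3.sum_rb_restrict_link`), which is
`22` since the Euler characteristic is `24` (`K3.rb_faces_three`). As there are ten middle vertices
and `22 > 2 * 10`, one of the multiplicities is greater than `2`.

A slicing is connected since any two vertices on one side and a vertex on the other side span a
triangle, so that the points where it meets the edges can be joined to each other. It is a
PL 3-manifold since near a point with positive coordinates at two vertices `a` and `b` on different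
sides, a point of the slicing is determined by its other coordinates, and these range over an open
part of the abstract cone over the link of `{a, b}`. This link is the boundary complex of a convex
polytope in three-space with the origin in its interior (again it suffices to know this for one
edge), and the cones over the facets of such a polytope form a complete fan. So the linear map that
sends the vertices of the link to the vertices of the polytope is a chart (`K3.exists_chart`).
-/

/-! ### Barycentric subdivision of affine chains -/

namespace AffineChain

variable (F : Type*) [Field F] {Y Z : Type*}

/-- Formal linear combinations of `m`-tuples of points of `Y`. A tuple stands for the affine
simplex with these vertices; the empty tuple is allowed, so that `boundary` on `1`-tuples is the
augmentation. -/
abbrev Tuples (Y : Type*) (m : ℕ) := (Fin m → Y) →₀ F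

/-- The simplicial boundary operator on tuples. -/
noncomputable def boundary (m : ℕ) : Tuples F Y (m + 1) →ₗ[F] Tuples F Y m :=
  Finsupp.linearCombination F fun w =>
    ∑ i : Fin (m + 1), (-1 : F) ^ (i : ℕ) • Finsupp.single (w ∘ i.succAbove) 1

/-- The join of a chain with a point `b`, which becomes the first vertex. -/
noncomputable def cone (b : Y) (m : ℕ) : Tuples F Y m →ₗ[F] Tuples F Y (m + 1) :=
  Finsupp.lmapDomain F F fun w => (Fin.cons b w : Fin (m + 1) → Y)

/-- The chain map induced by a map of vertices. -/
noncomputable def map (f : Y → Z) (m : ℕ) : Tuples F Y m →ₗ[F] Tuples F Z m :=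
  Finsupp.lmapDomain F F fun w => f ∘ w

variable {F}

@[simp] lemma boundary_single (m : ℕ) (w : Fin (m + 1) → Y) :
    boundary F m (Finsupp.single w 1) =
      ∑ i : Fin (m + 1), (-1 : F) ^ (i : ℕ) • Finsupp.single (w ∘ i.succAbove) 1 := by
  simp [boundary]

@[simp] lemma cone_single (b : Y) (m : ℕ) (w : Fin m → Y) (a : F) :
    cone F b m (Finsupp.single w a) = Finsupp.single (Fin.cons b w : Fin (m + 1) → Y) a := by
  simp [cone]

@[simp] lemma map_single (f : Y → Z) (m : ℕ) (w : Fin m → Y) (a : F) :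
    map F f m (Finsupp.single w a) = Finsupp.single (f ∘ w) a := by
  simp [map]

lemma hom_ext {m : ℕ} {M : Type*} [AddCommGroup M] [Module F M] {f g : Tuples F Y m →ₗ[F] M}
    (h : ∀ w, f (Finsupp.single w 1) = g (Finsupp.single w 1)) : f = g := by
  ext w
  simpa using h w

lemma cons_comp_succAbove_succ (b : Y) (m : ℕ) (w : Fin (m + 1) → Y) (i : Fin (m + 1)) :
    (Fin.cons b w : Fin (m + 2) → Y) ∘ i.succ.succAbove = Fin.cons b (w ∘ i.succAbove) := by
  funext j
  refine Fin.cases ?_ (fun j => ?_) j <;> simp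

lemma boundary_cone_zero (b : Y) (c : Tuples F Y 0) : boundary F 0 (cone F b 0 c) = c := by
  suffices h : boundary F 0 ∘ₗ cone F b 0 = LinearMap.id from LinearMap.congr_fun h c
  refine hom_ext fun w => ?_
  simp only [LinearMap.comp_apply, cone_single, boundary_single, LinearMap.id_apply]
  simp

lemma boundary_cone (b : Y) (m : ℕ) (c : Tuples F Y (m + 1)) :
    boundary F (m + 1) (cone F b (m + 1) c) = c - cone F b m (boundary F m c) := by
  suffices h : boundary F (m + 1) ∘ₗ cone F b (m + 1) = LinearMap.id - cone F b m ∘ₗ boundary F m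
    from LinearMap.congr_fun h c
  refine hom_ext fun w => ?_
  simp only [LinearMap.comp_apply, cone_single, boundary_single, LinearMap.sub_apply,
    LinearMap.id_apply, map_sum, map_smul]
  rw [Fin.sum_univ_succ, sub_eq_add_neg, ← Finset.sum_neg_distrib]
  congr 1
  · simp
  · refine Finset.sum_congr rfl fun i _ => ?_
    rw [cons_comp_succAbove_succ, Fin.val_succ, pow_succ, mul_neg_one, neg_smul]

lemma single_eq_cone (m : ℕ) (w : Fin (m + 1) → Y) :
    (Finsupp.single w 1 : Tuples F Y (m + 1)) =
      cone F (w 0) m (Finsupp.single (fun i => w i.succ) 1) := by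
  rw [cone_single]
  congr 1
  exact (Fin.cons_self_tail w).symm

/-- Every tuple is a cone over its tail, which gives `∂∂ = 0` by induction. -/
lemma boundary_boundary (m : ℕ) (c : Tuples F Y (m + 2)) :
    boundary F m (boundary F (m + 1) c) = 0 := by
  suffices h : boundary F m ∘ₗ boundary F (m + 1) = 0 from LinearMap.congr_fun h c
  clear c
  induction m with
  | zero =>
    refine hom_ext fun w => ?_
    rw [LinearMap.comp_apply, single_eq_cone, boundary_cone, map_sub, boundary_cone_zero, sub_self,
      LinearMap.zero_apply]
  | succ m ih =>
    refine hom_ext fun w => ?_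
    rw [LinearMap.comp_apply, single_eq_cone, boundary_cone, map_sub, boundary_cone,
      ← LinearMap.comp_apply (boundary F m), sub_sub_cancel]
    exact (congrArg _ (LinearMap.congr_fun ih _)).trans (map_zero _)

variable (F)

/-- Barycentric subdivision of affine chains: the cone from the barycenter `β w` over the
subdivided boundary. Only the function `β` is used of the geometry. -/
noncomputable def subdivision (β : ∀ m, (Fin (m + 1) → Y) → Y) :
    ∀ m, Tuples F Y m →ₗ[F] Tuples F Y m
  | 0 => LinearMap.id
  | m + 1 => Finsupp.linearCombination F fun w =>
      cone F (β m w) m (subdivision β m (boundary F m (Finsupp.single w 1)))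

/-- The chain homotopy between the identity and barycentric subdivision. -/
noncomputable def homotopy (β : ∀ m, (Fin (m + 1) → Y) → Y) :
    ∀ m, Tuples F Y m →ₗ[F] Tuples F Y (m + 1)
  | 0 => 0
  | m + 1 => Finsupp.linearCombination F fun w =>
      cone F (β m w) (m + 1) (Finsupp.single w 1 - homotopy β m (boundary F m (Finsupp.single w 1)))

variable {F} (β : ∀ m, (Fin (m + 1) → Y) → Y)

lemma subdivision_single (m : ℕ) (w : Fin (m + 1) → Y) :
    subdivision F β (m + 1) (Finsupp.single w 1) =
      cone F (β m w) m (subdivision F β m (boundary F m (Finsupp.single w 1))) := by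
  rw [subdivision, Finsupp.linearCombination_single, one_smul]

lemma homotopy_single (m : ℕ) (w : Fin (m + 1) → Y) :
    homotopy F β (m + 1) (Finsupp.single w 1) = cone F (β m w) (m + 1)
      (Finsupp.single w 1 - homotopy F β m (boundary F m (Finsupp.single w 1))) := by
  rw [homotopy, Finsupp.linearCombination_single, one_smul]

lemma boundary_subdivision (m : ℕ) (c : Tuples F Y (m + 1)) :
    boundary F m (subdivision F β (m + 1) c) = subdivision F β m (boundary F m c) := by
  suffices h : boundary F m ∘ₗ subdivision F β (m + 1) = subdivision F β m ∘ₗ boundary F m from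
    LinearMap.congr_fun h c
  clear c
  induction m with
  | zero =>
    refine hom_ext fun w => ?_
    rw [LinearMap.comp_apply, subdivision_single, boundary_cone_zero, LinearMap.comp_apply]
  | succ m ih =>
    refine hom_ext fun w => ?_
    rw [LinearMap.comp_apply, subdivision_single, boundary_cone, LinearMap.comp_apply,
      show boundary F m (subdivision F β (m + 1) _) = _ from LinearMap.congr_fun ih _,
      LinearMap.comp_apply, boundary_boundary, map_zero, map_zero, sub_zero]

lemma boundary_homotopy (m : ℕ) (c : Tuples F Y (m + 1)) :
    boundary F (m + 1) (homotopy F β (m + 1) c) =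
      c - subdivision F β (m + 1) c - homotopy F β m (boundary F m c) := by
  suffices h : boundary F (m + 1) ∘ₗ homotopy F β (m + 1) =
      LinearMap.id - subdivision F β (m + 1) - homotopy F β m ∘ₗ boundary F m from
    LinearMap.congr_fun h c
  clear c
  induction m with
  | zero =>
    refine hom_ext fun w => ?_
    simp only [LinearMap.comp_apply, LinearMap.sub_apply, LinearMap.id_apply]
    rw [homotopy_single, boundary_cone, subdivision_single, map_sub]
    simp only [homotopy, subdivision, LinearMap.zero_apply, map_zero, LinearMap.id_apply, sub_zero]
  | succ m ih =>
    refine hom_ext fun w => ?_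
    simp only [LinearMap.comp_apply, LinearMap.sub_apply, LinearMap.id_apply]
    rw [homotopy_single, boundary_cone, subdivision_single, map_sub (boundary F _),
      show boundary F (m + 1) (homotopy F β (m + 1) _) = _ from LinearMap.congr_fun ih _]
    simp only [LinearMap.comp_apply, LinearMap.sub_apply, LinearMap.id_apply, boundary_boundary,
      map_zero, sub_zero, sub_sub_cancel]
    abel

section naturality

variable (f : Y → Z)

lemma map_boundary (m : ℕ) (c : Tuples F Y (m + 1)) :
    map F f m (boundary F m c) = boundary F m (map F f (m + 1) c) := by
  suffices h : map F f m ∘ₗ boundary F m = boundary F m ∘ₗ map F f (m + 1) from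
    LinearMap.congr_fun h c
  refine hom_ext fun w => ?_
  simp [Function.comp_assoc]

lemma map_cone (b : Y) (m : ℕ) (c : Tuples F Y m) :
    map F f (m + 1) (cone F b m c) = cone F (f b) m (map F f m c) := by
  suffices h : map F f (m + 1) ∘ₗ cone F b m = cone F (f b) m ∘ₗ map F f m from
    LinearMap.congr_fun h c
  refine hom_ext fun w => ?_
  simp only [LinearMap.comp_apply, cone_single, map_single]
  rw [Fin.comp_cons]

variable {β} {β' : ∀ m, (Fin (m + 1) → Z) → Z} (hf : ∀ m w, f (β m w) = β' m (f ∘ w))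
include hf

lemma map_subdivision (m : ℕ) (c : Tuples F Y m) :
    map F f m (subdivision F β m c) = subdivision F β' m (map F f m c) := by
  suffices h : map F f m ∘ₗ subdivision F β m = subdivision F β' m ∘ₗ map F f m from
    LinearMap.congr_fun h c
  clear c
  induction m with
  | zero => rfl
  | succ m ih =>
    refine hom_ext fun w => ?_
    rw [LinearMap.comp_apply, subdivision_single, map_cone,
      show map F f m (subdivision F β m _) = _ from LinearMap.congr_fun ih _,
      LinearMap.comp_apply, LinearMap.comp_apply, map_single, subdivision_single, map_boundary,
      map_single, hf]

lemma map_homotopy (m : ℕ) (c : Tuples F Y m) :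
    map F f (m + 1) (homotopy F β m c) = homotopy F β' m (map F f m c) := by
  suffices h : map F f (m + 1) ∘ₗ homotopy F β m = homotopy F β' m ∘ₗ map F f m from
    LinearMap.congr_fun h c
  clear c
  induction m with
  | zero => ext; simp [homotopy]
  | succ m ih =>
    refine hom_ext fun w => ?_
    rw [LinearMap.comp_apply, homotopy_single, map_cone, map_sub,
      show map F f (m + 1) (homotopy F β m _) = _ from LinearMap.congr_fun ih _,
      LinearMap.comp_apply, LinearMap.comp_apply, map_single, homotopy_single, map_boundary,
      map_single, hf]

end naturality

end AffineChain

/-! ### Subdivision of singular chains and small chains -/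

namespace SingularChain

open AffineChain

/-- The standard topological simplex of dimension `n`. -/
abbrev Simplex (n : ℕ) := stdSimplex ℝ (Fin (n + 1))

/-- The affine map between standard simplices with prescribed images of the vertices. -/
noncomputable def affine {n m : ℕ} (w : Fin (m + 1) → Simplex n) : C(Simplex m, Simplex n) where
  toFun t := ⟨∑ i, t.1 i • (w i).1,
    (convex_stdSimplex ℝ _).sum_mem (fun i _ => t.2.1 i) t.2.2 fun i _ => (w i).2⟩
  continuous_toFun := by
    refine Continuous.subtype_mk (continuous_finsetSum _ fun i _ => ?_) _
    exact ((continuous_apply i).comp continuous_subtype_val).smul continuous_const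

lemma affine_coe {n m : ℕ} (w : Fin (m + 1) → Simplex n) (t : Simplex m) :
    (affine w t).1 = ∑ i, t.1 i • (w i).1 := rfl

/-- The tuple of all vertices of the standard simplex. -/
noncomputable def vertices (n : ℕ) : Fin (n + 1) → Simplex n := fun i => stdSimplex.vertex i

lemma affine_vertices (n : ℕ) : affine (vertices n) = ContinuousMap.id _ := by
  ext t j
  change (affine (vertices n) t).1 j = t.1 j
  simp [affine_coe, vertices, Finset.sum_apply, Pi.single_apply]

lemma affine_apply_vertices {n m : ℕ} (w : Fin (m + 1) → Simplex n) :
    affine w ∘ vertices m = w := by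
  funext i
  apply Subtype.ext
  simp [affine_coe, vertices, Pi.single_apply, ite_smul]

lemma affine_comp {n m l : ℕ} (w : Fin (m + 1) → Simplex n) (u : Fin (l + 1) → Simplex m) :
    (affine w).comp (affine u) = affine (affine w ∘ u) := by
  ext t j
  change (affine w (affine u t)).1 j = (affine (affine w ∘ u) t).1 j
  simp only [affine_coe, Finset.sum_apply, Pi.smul_apply, smul_eq_mul, Function.comp_apply,
    Finset.sum_mul, Finset.mul_sum]
  rw [Finset.sum_comm]
  simp only [mul_assoc]

/-- The barycenter of a tuple of points of a simplex. -/
noncomputable def bary {n : ℕ} (m : ℕ) (w : Fin (m + 1) → Simplex n) : Simplex n :=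
  affine w stdSimplex.barycenter

lemma affine_bary {n m : ℕ} (w : Fin (m + 1) → Simplex n) (l : ℕ) (u : Fin (l + 1) → Simplex m) :
    affine w (bary l u) = bary l (affine w ∘ u) :=
  congrArg (fun f => f stdSimplex.barycenter) (affine_comp w u)

/-- The `i`-th face inclusion. -/
noncomputable def face {n : ℕ} (i : Fin (n + 2)) : C(Simplex n, Simplex (n + 1)) :=
  affine (vertices (n + 1) ∘ i.succAbove)

lemma affine_comp_face {n m : ℕ} (w : Fin (m + 2) → Simplex n) (i : Fin (m + 2)) :
    (affine w).comp (face i) = affine (w ∘ i.succAbove) := by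
  rw [face, affine_comp, ← Function.comp_assoc, affine_apply_vertices]

lemma face_apply {n : ℕ} (i : Fin (n + 2)) (t : Simplex n) :
    face i t = stdSimplex.map i.succAbove t := by
  apply Subtype.ext
  change (face i t).1 = FunOnFinite.linearMap ℝ ℝ i.succAbove t.1
  funext j
  simp [face, affine_coe, vertices, FunOnFinite.linearMap_apply_apply, Pi.single_apply,
    Finset.sum_filter, eq_comm]

/-- Closed balls are convex, so they contain an affine simplex if they contain its vertices. -/
lemma dist_affine_le {n m : ℕ} (w : Fin (m + 1) → Simplex n) (t : Simplex m) (p : Simplex n)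
    {ρ : ℝ} (h : ∀ i, dist (w i) p ≤ ρ) : dist (affine w t) p ≤ ρ := by
  have := (convex_closedBall p.1 ρ).sum_mem (t := Finset.univ) (fun i _ => t.2.1 i) t.2.2
    (z := fun i => (w i).1) fun i _ => by simpa [Subtype.dist_eq] using h i
  simpa [Subtype.dist_eq, affine_coe] using this

/-- The barycenter of `m + 1` points with mutual distances at most `d` has distance at most
`m / (m + 1) * d` from each of them. -/
lemma dist_bary_le {n m : ℕ} (w : Fin (m + 1) → Simplex n) {d r : ℝ} (hd : 0 ≤ d)
    (hr : (m : ℝ) ≤ r * (m + 1)) (h : ∀ i j, dist (w i) (w j) ≤ d) (k : Fin (m + 1)) :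
    dist (bary m w) (w k) ≤ r * d := by
  have hm : (0 : ℝ) < m + 1 := by positivity
  have e : (bary m w).1 - (w k).1 = ((m : ℝ) + 1)⁻¹ • ∑ i, ((w i).1 - (w k).1) := by
    rw [Finset.sum_sub_distrib, smul_sub, Finset.sum_const, Finset.card_univ, Fintype.card_fin,
      bary, affine_coe, Finset.smul_sum, ← Nat.cast_smul_eq_nsmul ℝ, smul_smul]
    push_cast
    rw [inv_mul_cancel₀ hm.ne', one_smul]
    simp
  rw [Subtype.dist_eq, dist_eq_norm, e, norm_smul, norm_inv, Real.norm_of_nonneg hm.le,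
    inv_mul_le_iff₀ hm]
  calc ‖∑ i, ((w i).1 - (w k).1)‖ ≤ ∑ i, ‖(w i).1 - (w k).1‖ := norm_sum_le _ _
    _ = ∑ i ∈ Finset.univ.erase k, ‖(w i).1 - (w k).1‖ := by
        rw [← Finset.add_sum_erase _ _ (Finset.mem_univ k)]
        simp
    _ ≤ ∑ i ∈ Finset.univ.erase k, d := Finset.sum_le_sum fun i _ => by
        simpa [Subtype.dist_eq, dist_eq_norm] using h i k
    _ = m * d := by simp [Finset.card_erase_of_mem]
    _ ≤ (r * (m + 1)) * d := by gcongr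
    _ = (m + 1) * (r * d) := by ring

lemma _root_.Finsupp.map_mem_of_mem_supported {R α M : Type*} [Semiring R] [AddCommMonoid M]
    [Module R M] (g : (α →₀ R) →ₗ[R] M) {s : Set α} {N : Submodule R M}
    (h : ∀ a ∈ s, g (Finsupp.single a 1) ∈ N) {c : α →₀ R} (hc : c ∈ Finsupp.supported R R s) :
    g c ∈ N := by
  rw [Finsupp.supported_eq_span_single, ← Submodule.mem_comap] at *
  refine Submodule.span_le.2 ?_ hc
  rintro _ ⟨a, ha, rfl⟩
  exact h a ha

variable {F : Type u} [Field F]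

/-- The tuples of points that have mutual distances at most `d` and lie in every ball that
contains `w`. -/
def finer {n m l : ℕ} (w : Fin m → Simplex n) (d : ℝ) : Set (Fin l → Simplex n) :=
  {u | (∀ i j, dist (u i) (u j) ≤ d) ∧
    ∀ p : Simplex n, ∀ ρ : ℝ, (∀ i, dist (w i) p ≤ ρ) → ∀ i, dist (u i) p ≤ ρ}

/-- Subdivision contracts the mesh by the factor `r = n / (n + 1)`. The induction needs the
stronger property of `finer`: a new simplex is the join of a barycenter with a simplex of the
subdivided boundary, whose distance to the barycenter is controlled by the balls around it. -/
lemma subdivision_mem_finer {n m : ℕ} (w : Fin m → Simplex n) {d r : ℝ} (hd : 0 ≤ d)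
    (hr : ∀ l : ℕ, l + 1 ≤ m → (l : ℝ) ≤ r * (l + 1)) (h : ∀ i j, dist (w i) (w j) ≤ d) :
    subdivision F bary m (Finsupp.single w 1) ∈ Finsupp.supported F F (finer w (r * d)) := by
  induction m with
  | zero =>
    refine Finsupp.single_mem_supported F _ ?_
    exact ⟨fun i => i.elim0, fun _ _ _ i => i.elim0⟩
  | succ m ih =>
    rw [subdivision_single, boundary_single, map_sum, map_sum]
    refine Submodule.sum_mem _ fun k _ => ?_
    rw [map_smul, map_smul]
    refine Submodule.smul_mem _ _ ?_
    have hk := ih (w ∘ k.succAbove) (fun l hl => hr l (by omega)) fun i j => h _ _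
    have hb : ∀ i, dist (bary m w) (w i) ≤ r * d := dist_bary_le w hd (hr m le_rfl) h
    have hball : ∀ (p : Simplex n) (ρ : ℝ), (∀ i, dist (w i) p ≤ ρ) → dist (bary m w) p ≤ ρ :=
      fun p ρ hp => dist_affine_le w _ p hp
    refine Finsupp.map_mem_of_mem_supported _ (fun u hu => ?_) hk
    rw [cone_single]
    refine Finsupp.single_mem_supported F _ ⟨fun i j => ?_, fun p ρ hp i => ?_⟩
    · have hbu : ∀ j, dist (u j) (bary m w) ≤ r * d := fun j =>
        hu.2 _ _ (fun i => by rw [dist_comm]; exact hb _) j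
      refine Fin.cases ?_ (fun i => ?_) i <;> refine Fin.cases ?_ (fun j => ?_) j
      · simpa using (dist_nonneg).trans (hb 0)
      · simpa [dist_comm] using hbu j
      · simpa using hbu i
      · simpa using hu.1 i j
    · refine Fin.cases ?_ (fun i => ?_) i
      · simpa using hball p ρ hp
      · simpa using hu.2 p ρ (fun i => hp _) i

/-- Repeated subdivision makes the simplices of the standard simplex arbitrarily small. -/
lemma exists_iterate_subdivision_mem (n : ℕ) {δ : ℝ} (hδ : 0 < δ) :
    ∃ k : ℕ, (subdivision F bary (n + 1))^[k] (Finsupp.single (vertices n) 1) ∈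
      Finsupp.supported F F {u : Fin (n + 1) → Simplex n | ∀ i j, dist (u i) (u j) < δ} := by
  obtain ⟨D, hD⟩ := Metric.isBounded_iff.1 (Set.finite_range (vertices n)).isBounded
  have hD' : ∀ i j, dist (vertices n i) (vertices n j) ≤ D := fun i j => hD ⟨i, rfl⟩ ⟨j, rfl⟩
  have hD0 : 0 ≤ D := dist_nonneg.trans (hD' 0 0)
  set r : ℝ := n / (n + 1) with hr
  have hn : (0 : ℝ) < n + 1 := by positivity
  have hr0 : 0 ≤ r := by positivity
  have hr1 : r < 1 := by rw [hr, div_lt_one hn]; linarith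
  have key : ∀ k : ℕ, (subdivision F bary (n + 1))^[k] (Finsupp.single (vertices n) 1) ∈
      Finsupp.supported F F {u : Fin (n + 1) → Simplex n | ∀ i j, dist (u i) (u j) ≤ r ^ k * D} := by
    intro k
    induction k with
    | zero => exact Finsupp.single_mem_supported F _ (by simpa using hD')
    | succ k ih =>
      rw [Function.iterate_succ_apply']
      refine Finsupp.map_mem_of_mem_supported _ (fun w hw => ?_) ih
      refine Finsupp.supported_mono (fun u hu => ?_)
        (subdivision_mem_finer (r := r) w (by positivity) (fun l hl => ?_) hw)
      · rw [pow_succ', mul_assoc]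
        exact hu.1
      · have hl' : (l : ℝ) ≤ n := by exact_mod_cast (by omega : l ≤ n)
        rw [hr, div_mul_eq_mul_div, le_div_iff₀ hn]
        nlinarith
  obtain ⟨k, hk⟩ := ((tendsto_pow_atTop_nhds_zero_of_lt_one hr0 hr1).mul_const D).eventually
    (gt_mem_nhds (show 0 * D < δ by simpa using hδ)) |>.exists
  exact ⟨k, Finsupp.supported_mono (fun u hu i j => (hu i j).trans_lt hk) (key k)⟩

variable (F) (X : Type) [TopologicalSpace X]

/-- Singular chains of a space, as finitely supported functions on singular simplices. -/
abbrev Chains (n : ℕ) := C(Simplex n, X) →₀ F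

/-- The boundary operator on singular chains. -/
noncomputable def d (n : ℕ) : Chains F X (n + 1) →ₗ[F] Chains F X n :=
  Finsupp.linearCombination F fun σ =>
    ∑ i : Fin (n + 2), (-1 : F) ^ (i : ℕ) • Finsupp.single (σ.comp (face i)) 1

variable {X}

/-- The chain map from affine chains of the standard simplex induced by a singular simplex. -/
noncomputable def push {n : ℕ} (σ : C(Simplex n, X)) (m : ℕ) :
    Tuples F (Simplex n) (m + 1) →ₗ[F] Chains F X m :=
  Finsupp.lmapDomain F F fun w => σ.comp (affine w)

variable {F}

@[simp] lemma push_single {n : ℕ} (σ : C(Simplex n, X)) (m : ℕ) (w : Fin (m + 1) → Simplex n)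
    (a : F) : push F σ m (Finsupp.single w a) = Finsupp.single (σ.comp (affine w)) a := by
  simp [push]

lemma d_single (n : ℕ) (σ : C(Simplex (n + 1), X)) : d F X n (Finsupp.single σ 1) =
    ∑ i : Fin (n + 2), (-1 : F) ^ (i : ℕ) • Finsupp.single (σ.comp (face i)) 1 := by
  simp [d]

lemma push_vertices {n : ℕ} (σ : C(Simplex n, X)) (a : F) :
    push F σ n (Finsupp.single (vertices n) a) = Finsupp.single σ a := by
  rw [push_single, affine_vertices, ContinuousMap.comp_id]

lemma push_map {n l : ℕ} (σ : C(Simplex n, X)) (w : Fin (l + 1) → Simplex n) (m : ℕ)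
    (c : Tuples F (Simplex l) (m + 1)) :
    push F σ m (map F (affine w) (m + 1) c) = push F (σ.comp (affine w)) m c := by
  suffices h : push F σ m ∘ₗ map F (affine w) (m + 1) = push F (σ.comp (affine w)) m from
    LinearMap.congr_fun h c
  refine hom_ext fun u => ?_
  rw [LinearMap.comp_apply, map_single, push_single, push_single, ContinuousMap.comp_assoc,
    affine_comp]

lemma d_push {n : ℕ} (σ : C(Simplex n, X)) (m : ℕ) (c : Tuples F (Simplex n) (m + 2)) :
    d F X m (push F σ (m + 1) c) = push F σ m (boundary F (m + 1) c) := by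
  suffices h : d F X m ∘ₗ push F σ (m + 1) = push F σ m ∘ₗ boundary F (m + 1) from
    LinearMap.congr_fun h c
  refine hom_ext fun u => ?_
  rw [LinearMap.comp_apply, push_single, d_single, LinearMap.comp_apply, boundary_single, map_sum]
  simp only [map_smul, push_single, ContinuousMap.comp_assoc, affine_comp_face]

variable (F X)

/-- Barycentric subdivision of singular chains. -/
noncomputable def sd (n : ℕ) : Chains F X n →ₗ[F] Chains F X n :=
  Finsupp.linearCombination F fun σ =>
    push F σ n (subdivision F bary (n + 1) (Finsupp.single (vertices n) 1))

/-- The chain homotopy between the identity and barycentric subdivision of singular chains. -/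
noncomputable def sdHomotopy (n : ℕ) : Chains F X n →ₗ[F] Chains F X (n + 1) :=
  Finsupp.linearCombination F fun σ =>
    push F σ (n + 1) (homotopy F bary (n + 1) (Finsupp.single (vertices n) 1))

variable {F X}

lemma sd_push {n : ℕ} (σ : C(Simplex n, X)) (m : ℕ) (c : Tuples F (Simplex n) (m + 1)) :
    sd F X m (push F σ m c) = push F σ m (subdivision F bary (m + 1) c) := by
  suffices h : sd F X m ∘ₗ push F σ m = push F σ m ∘ₗ subdivision F bary (m + 1) from
    LinearMap.congr_fun h c
  refine hom_ext fun w => ?_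
  rw [LinearMap.comp_apply, push_single, sd, Finsupp.linearCombination_single, one_smul, ← push_map,
    map_subdivision (β' := bary) _ (fun _ _ => affine_bary _ _ _), map_single,
    affine_apply_vertices, LinearMap.comp_apply]

lemma sdHomotopy_push {n : ℕ} (σ : C(Simplex n, X)) (m : ℕ) (c : Tuples F (Simplex n) (m + 1)) :
    sdHomotopy F X m (push F σ m c) = push F σ (m + 1) (homotopy F bary (m + 1) c) := by
  suffices h : sdHomotopy F X m ∘ₗ push F σ m = push F σ (m + 1) ∘ₗ homotopy F bary (m + 1) from
    LinearMap.congr_fun h c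
  refine hom_ext fun w => ?_
  rw [LinearMap.comp_apply, push_single, sdHomotopy, Finsupp.linearCombination_single, one_smul,
    ← push_map, map_homotopy (β' := bary) _ (fun _ _ => affine_bary _ _ _), map_single,
    affine_apply_vertices, LinearMap.comp_apply]

lemma d_sd (n : ℕ) (c : Chains F X (n + 1)) : d F X n (sd F X (n + 1) c) = sd F X n (d F X n c) := by
  suffices h : d F X n ∘ₗ sd F X (n + 1) = sd F X n ∘ₗ d F X n from LinearMap.congr_fun h c
  refine Finsupp.lhom_ext' fun σ => LinearMap.ext_ring ?_
  simp only [LinearMap.comp_apply, Finsupp.lsingle_apply]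
  rw [← push_vertices σ, sd_push, d_push, d_push, sd_push, boundary_subdivision]

lemma d_sdHomotopy (n : ℕ) (c : Chains F X (n + 1)) :
    d F X (n + 1) (sdHomotopy F X (n + 1) c) =
      c - sd F X (n + 1) c - sdHomotopy F X n (d F X n c) := by
  suffices h : d F X (n + 1) ∘ₗ sdHomotopy F X (n + 1) =
      LinearMap.id - sd F X (n + 1) - sdHomotopy F X n ∘ₗ d F X n from LinearMap.congr_fun h c
  refine Finsupp.lhom_ext' fun σ => LinearMap.ext_ring ?_
  simp only [LinearMap.comp_apply, Finsupp.lsingle_apply, LinearMap.sub_apply, LinearMap.id_apply]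
  rw [← push_vertices σ, sdHomotopy_push, d_push, sd_push, d_push, sdHomotopy_push,
    boundary_homotopy, map_sub, map_sub]

variable (F)

/-- Chains whose simplices are contained in the subset `A`. -/
def chainsIn (A : Set X) (n : ℕ) : Submodule F (Chains F X n) :=
  Finsupp.supported F F {σ | Set.range σ ⊆ A}

/-- Chains whose simplices are contained in `U` or in `V`. -/
def smallChains (U V : Set X) (n : ℕ) : Submodule F (Chains F X n) :=
  Finsupp.supported F F ({σ | Set.range σ ⊆ U} ∪ {σ | Set.range σ ⊆ V})

variable {F}

lemma push_mem {n m : ℕ} {σ : C(Simplex n, X)} {A : Set X} (h : Set.range σ ⊆ A)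
    (c : Tuples F (Simplex n) (m + 1)) : push F σ m c ∈ chainsIn F A m := by
  refine Finsupp.map_mem_of_mem_supported (push F σ m) (s := Set.univ) (fun w _ => ?_) (by simp)
  rw [push_single]
  refine Finsupp.single_mem_supported F _ ?_
  rintro _ ⟨t, rfl⟩
  exact h ⟨_, rfl⟩

lemma smallChains_eq (U V : Set X) (n : ℕ) :
    smallChains F U V n = chainsIn F U n ⊔ chainsIn F V n :=
  Finsupp.supported_union _ _

lemma push_mem_small {n m : ℕ} {σ : C(Simplex n, X)} {U V : Set X}
    (h : σ ∈ {σ : C(Simplex n, X) | Set.range σ ⊆ U} ∪ {σ | Set.range σ ⊆ V})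
    (c : Tuples F (Simplex n) (m + 1)) : push F σ m c ∈ smallChains F U V m := by
  rw [smallChains_eq]
  exact h.elim (fun h => Submodule.mem_sup_left (push_mem h c))
    fun h => Submodule.mem_sup_right (push_mem h c)

lemma sd_mem_small {U V : Set X} {n : ℕ} {c : Chains F X n} (hc : c ∈ smallChains F U V n) :
    sd F X n c ∈ smallChains F U V n := by
  refine Finsupp.map_mem_of_mem_supported _ (fun σ hσ => ?_) hc
  rw [← push_vertices σ, sd_push]
  exact push_mem_small hσ _

lemma sdHomotopy_mem_small {U V : Set X} {n : ℕ} {c : Chains F X n}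
    (hc : c ∈ smallChains F U V n) : sdHomotopy F X n c ∈ smallChains F U V (n + 1) := by
  refine Finsupp.map_mem_of_mem_supported _ (fun σ hσ => ?_) hc
  rw [← push_vertices σ, sdHomotopy_push]
  exact push_mem_small hσ _

lemma iterate_sd_push {n : ℕ} (σ : C(Simplex n, X)) (m k : ℕ) (c : Tuples F (Simplex n) (m + 1)) :
    (sd F X m)^[k] (push F σ m c) = push F σ m ((subdivision F bary (m + 1))^[k] c) := by
  induction k generalizing c with
  | zero => rfl
  | succ k ih => rw [Function.iterate_succ_apply, sd_push, ih, Function.iterate_succ_apply]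

lemma iterate_sd_mem_small {U V : Set X} {n k l : ℕ} {c : Chains F X n} (hkl : k ≤ l)
    (hc : (sd F X n)^[k] c ∈ smallChains F U V n) : (sd F X n)^[l] c ∈ smallChains F U V n := by
  induction l, hkl using Nat.le_induction with
  | base => exact hc
  | succ l _ ih =>
    rw [Function.iterate_succ_apply']
    exact sd_mem_small ih

/-- By the Lebesgue number lemma, some iterated subdivision of a chain is small. -/
lemma exists_iterate_sd_mem_small {U V : Set X} (hU : IsOpen U) (hV : IsOpen V)
    (hUV : U ∪ V = Set.univ) {n : ℕ} (c : Chains F X n) :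
    ∃ k, (sd F X n)^[k] c ∈ smallChains F U V n := by
  induction c using Finsupp.induction_linear with
  | zero => exact ⟨0, Submodule.zero_mem _⟩
  | add c c' h h' =>
    obtain ⟨k, hk⟩ := h
    obtain ⟨k', hk'⟩ := h'
    refine ⟨max k k', ?_⟩
    rw [← Module.End.pow_apply, map_add, Module.End.pow_apply, Module.End.pow_apply]
    exact Submodule.add_mem _ (iterate_sd_mem_small (le_max_left _ _) hk)
      (iterate_sd_mem_small (le_max_right _ _) hk')
  | single σ a =>
    obtain ⟨δ, hδ, hball⟩ := lebesgue_number_lemma_of_metric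
      (s := (Set.univ : Set (Simplex n))) (c := fun b : Bool => σ ⁻¹' (bif b then U else V))
      isCompact_univ
      (fun b => (by cases b; exacts [hV, hU] : IsOpen (bif b then U else V)).preimage σ.continuous)
      (fun t _ => by
        rcases (hUV ▸ Set.mem_univ (σ t) : σ t ∈ U ∪ V) with h | h
        · exact Set.mem_iUnion.2 ⟨true, h⟩
        · exact Set.mem_iUnion.2 ⟨false, h⟩)
    obtain ⟨k, hk⟩ := exists_iterate_subdivision_mem (F := F) n hδ
    refine ⟨k, ?_⟩
    rw [← push_vertices, iterate_sd_push, ← mul_one a, ← smul_eq_mul, ← Finsupp.smul_single,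
      ← Module.End.pow_apply, map_smul, map_smul, Module.End.pow_apply]
    refine Submodule.smul_mem _ _ (Finsupp.map_mem_of_mem_supported _ (fun u hu => ?_) hk)
    rw [push_single]
    refine Finsupp.single_mem_supported F _ ?_
    obtain ⟨b, hb⟩ := hball (u 0) (Set.mem_univ _)
    -- a small affine simplex lies in the Lebesgue ball around its first vertex
    have hsub : Set.range (σ.comp (affine u)) ⊆ bif b then U else V := by
      rintro _ ⟨t, rfl⟩
      refine hb ?_
      have hfin : ∃ ρ < δ, ∀ i, dist (u i) (u 0) ≤ ρ := by
        obtain ⟨i, hi⟩ := Finite.exists_max fun i => dist (u i) (u 0)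
        exact ⟨_, hu i 0, hi⟩
      obtain ⟨ρ, hρ, hu'⟩ := hfin
      exact (dist_affine_le u t (u 0) hu').trans_lt hρ
    cases b
    · exact Or.inr hsub
    · exact Or.inl hsub

/-- A chain whose boundary is small is homologous to a small chain. -/
theorem exists_sub_d_mem_small {U V : Set X} (hU : IsOpen U) (hV : IsOpen V)
    (hUV : U ∪ V = Set.univ) {n : ℕ} (c : Chains F X (n + 1))
    (hc : d F X n c ∈ smallChains F U V n) :
    ∃ e : Chains F X (n + 2), c - d F X (n + 1) e ∈ smallChains F U V (n + 1) := by
  obtain ⟨k, hk⟩ := exists_iterate_sd_mem_small hU hV hUV c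
  induction k generalizing c with
  | zero => exact ⟨0, by simpa using hk⟩
  | succ k ih =>
    obtain ⟨e, he⟩ := ih (sd F X (n + 1) c) (by rw [d_sd]; exact sd_mem_small hc) hk
    refine ⟨sdHomotopy F X (n + 1) c + e, ?_⟩
    rw [map_add, d_sdHomotopy]
    convert Submodule.add_mem _ he (sdHomotopy_mem_small hc) using 1
    abel

/-- A singular simplex of dimension `0` is a point, hence small. -/
lemma mem_small_zero {U V : Set X} (hUV : U ∪ V = Set.univ) (c : Chains F X 0) :
    c ∈ smallChains F U V 0 := by
  refine Finsupp.map_mem_of_mem_supported LinearMap.id (s := Set.univ) (fun σ _ => ?_) (by simp)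
  refine Finsupp.single_mem_supported F _ ?_
  have : ∀ t, t = (default : Simplex 0) := fun t => Subsingleton.elim _ _
  rcases (hUV ▸ Set.mem_univ (σ default) : σ default ∈ U ∪ V) with h | h
  · exact Or.inl (by rintro _ ⟨t, rfl⟩; rwa [this t])
  · exact Or.inr (by rintro _ ⟨t, rfl⟩; rwa [this t])

end SingularChain

/-! ### Comparison with the singular chain complex of Mathlib -/

namespace SingularChain

open CategoryTheory

open Simplicial Limits

variable (F : Type u) [Field F]

/-- Mathlib's singular simplices are continuous maps from the standard simplex. -/
noncomputable def simplexEquiv (X : TopCat.{0}) (n : ℕ) :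
    (TopCat.toSSet.obj X) _⦋n⦌ ≃ C(Simplex n, X) :=
  X.toSSetObjEquiv (.op ⦋n⦌)

lemma simplexEquiv_δ (X : TopCat.{0}) (n : ℕ) (i : Fin (n + 2))
    (x : (TopCat.toSSet.obj X) _⦋n + 1⦌) :
    simplexEquiv X n ((TopCat.toSSet.obj X).δ i x) = (simplexEquiv X (n + 1) x).comp (face i) := by
  ext t
  rw [ContinuousMap.comp_apply, face_apply]
  rfl

lemma simplexEquiv_map {X Y : TopCat.{0}} (f : X ⟶ Y) (n : ℕ) (x : (TopCat.toSSet.obj X) _⦋n⦌) :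
    simplexEquiv Y n ((TopCat.toSSet.map f).app _ x) = f.hom.comp (simplexEquiv X n x) := rfl

/-- The generator of Mathlib's singular chains given by a continuous map. -/
noncomputable def generator {X : TopCat.{0}} {n : ℕ} (σ : C(Simplex n, X)) :
    (singularChains F X).X n :=
  ((TopCat.toSSet.obj X).ιChainComplex (R := ModuleCat.of F F)
    ((simplexEquiv X n).symm σ)).hom (1 : F)

/-- The comparison of concrete singular chains with Mathlib's singular chain complex. -/
noncomputable def toSingular (X : TopCat.{0}) (n : ℕ) :
    Chains F X n →ₗ[F] (singularChains F X).X n :=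
  Finsupp.linearCombination F fun σ => generator F σ

/-- The inverse of `toSingular`. -/
noncomputable def ofSingular (X : TopCat.{0}) (n : ℕ) :
    (singularChains F X).X n ⟶ ModuleCat.of F (Chains F X n) :=
  ((TopCat.toSSet.obj X).isColimitChainComplexXCofan (ModuleCat.of F F) n).desc
    (Cofan.mk _ fun x => ModuleCat.ofHom (Finsupp.lsingle (simplexEquiv X n x)))

lemma ι_ofSingular (X : TopCat.{0}) (n : ℕ) (x : (TopCat.toSSet.obj X) _⦋n⦌) :
    (TopCat.toSSet.obj X).ιChainComplex (R := ModuleCat.of F F) x ≫ ofSingular F X n =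
      ModuleCat.ofHom (Finsupp.lsingle (simplexEquiv X n x)) :=
  ((TopCat.toSSet.obj X).isColimitChainComplexXCofan (ModuleCat.of F F) n).fac _ ⟨x⟩

lemma ofSingular_generator (X : TopCat.{0}) (n : ℕ) (σ : C(Simplex n, X)) :
    (ofSingular F X n).hom (generator F σ) = Finsupp.single σ 1 := by
  have := congrArg (fun f => f.hom (1 : F)) (ι_ofSingular F X n ((simplexEquiv X n).symm σ))
  refine this.trans ?_
  change Finsupp.single (simplexEquiv X n ((simplexEquiv X n).symm σ)) (1 : F) = _
  rw [Equiv.apply_symm_apply]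

lemma toSingular_single (X : TopCat.{0}) (n : ℕ) (σ : C(Simplex n, X)) :
    toSingular F X n (Finsupp.single σ 1) = generator F σ := by
  simp [toSingular]

lemma ofSingular_toSingular (X : TopCat.{0}) (n : ℕ) (c : Chains F X n) :
    (ofSingular F X n).hom (toSingular F X n c) = c := by
  suffices h : (ofSingular F X n).hom ∘ₗ toSingular F X n = LinearMap.id from
    LinearMap.congr_fun h c
  refine Finsupp.lhom_ext' fun σ => LinearMap.ext_ring ?_
  simp only [LinearMap.comp_apply, Finsupp.lsingle_apply, toSingular_single, LinearMap.id_apply]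
  exact ofSingular_generator F X n σ

lemma toSingular_ofSingular (X : TopCat.{0}) (n : ℕ) (c : (singularChains F X).X n) :
    toSingular F X n ((ofSingular F X n).hom c) = c := by
  suffices h : ofSingular F X n ≫ ModuleCat.ofHom (toSingular F X n) = 𝟙 _ from
    congrArg (fun f => f.hom c) h
  refine SSet.chainComplex_hom_ext fun x => ?_
  refine ModuleCat.hom_ext (LinearMap.ext_ring ?_)
  have hx : ((TopCat.toSSet.obj X).ιChainComplex (R := ModuleCat.of F F) x).hom (1 : F) =
      generator F (simplexEquiv X n x) := by
    rw [generator, Equiv.symm_apply_apply]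
  refine Eq.trans ?_ hx.symm
  refine (congrArg (fun y => toSingular F X n ((ofSingular F X n).hom y)) hx).trans ?_
  exact (congrArg (toSingular F X n) (ofSingular_generator F X n _)).trans
    (toSingular_single F X n _)

/-- Concrete singular chains are isomorphic to Mathlib's singular chains. -/
noncomputable def chainsEquiv (X : TopCat.{0}) (n : ℕ) :
    Chains F X n ≃ₗ[F] (singularChains F X).X n :=
  { toSingular F X n with
    invFun := (ofSingular F X n).hom
    left_inv := ofSingular_toSingular F X n
    right_inv := toSingular_ofSingular F X n }

lemma chainsEquiv_single (X : TopCat.{0}) (n : ℕ) (σ : C(Simplex n, X)) :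
    chainsEquiv F X n (Finsupp.single σ 1) = generator F σ := toSingular_single F X n σ

lemma d_chainsEquiv (X : TopCat.{0}) (n : ℕ) (c : Chains F X (n + 1)) :
    ((singularChains F X).d (n + 1) n).hom (chainsEquiv F X (n + 1) c) =
      chainsEquiv F X n (d F X n c) := by
  suffices h : ((singularChains F X).d (n + 1) n).hom ∘ₗ (chainsEquiv F X (n + 1)).toLinearMap =
      (chainsEquiv F X n).toLinearMap ∘ₗ d F X n from LinearMap.congr_fun h c
  refine Finsupp.lhom_ext' fun σ => LinearMap.ext_ring ?_
  simp only [LinearMap.comp_apply, Finsupp.lsingle_apply, LinearEquiv.coe_coe, chainsEquiv_single,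
    d_single, map_sum, map_smul]
  have := congrArg (fun f => f.hom (1 : F)) ((TopCat.toSSet.obj X).ιChainComplex_d
    (ModuleCat.of F F) ((simplexEquiv X (n + 1)).symm σ))
  refine this.trans ?_
  rw [ModuleCat.hom_sum, LinearMap.sum_apply]
  refine Finset.sum_congr rfl fun i _ => ?_
  have hi : (TopCat.toSSet.obj X).δ i ((simplexEquiv X (n + 1)).symm σ) =
      (simplexEquiv X n).symm (σ.comp (face i)) := by
    rw [Equiv.eq_symm_apply, simplexEquiv_δ, Equiv.apply_symm_apply]
  rw [hi, generator]
  rcases Nat.even_or_odd (i : ℕ) with h | h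
  · simp only [h.neg_one_pow, one_smul]
    exact (one_smul F _).symm
  · simp only [h.neg_one_pow, neg_smul, one_smul]
    exact (neg_one_smul F _).symm

variable {F} in
/-- The chain map induced by a continuous map. -/
noncomputable def singularMap {X Y : TopCat.{0}} (f : X ⟶ Y) :
    singularChains F X ⟶ singularChains F Y :=
  ((AlgebraicTopology.singularChainComplexFunctor (ModuleCat.{u} F)).obj (ModuleCat.of F F)).map f

lemma singularMap_comp {X Y Z : TopCat.{0}} (f : X ⟶ Y) (g : Y ⟶ Z) :
    singularMap (F := F) (f ≫ g) = singularMap f ≫ singularMap g :=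
  ((AlgebraicTopology.singularChainComplexFunctor (ModuleCat.{u} F)).obj
    (ModuleCat.of F F)).map_comp f g

lemma singularMap_id (X : TopCat.{0}) : singularMap (F := F) (𝟙 X) = 𝟙 _ :=
  ((AlgebraicTopology.singularChainComplexFunctor (ModuleCat.{u} F)).obj
    (ModuleCat.of F F)).map_id X

lemma singularMap_chainsEquiv {X Y : TopCat.{0}} (f : X ⟶ Y) (n : ℕ) (c : Chains F X n) :
    ((singularMap f).f n).hom (chainsEquiv F X n c) =
      chainsEquiv F Y n (Finsupp.lmapDomain F F (fun σ => f.hom.comp σ) c) := by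
  suffices h : ((singularMap f).f n).hom ∘ₗ (chainsEquiv F X n).toLinearMap =
      (chainsEquiv F Y n).toLinearMap ∘ₗ Finsupp.lmapDomain F F (fun σ => f.hom.comp σ) from
    LinearMap.congr_fun h c
  refine Finsupp.lhom_ext' fun σ => LinearMap.ext_ring ?_
  simp only [LinearMap.comp_apply, Finsupp.lsingle_apply, LinearEquiv.coe_coe, chainsEquiv_single,
    Finsupp.lmapDomain_apply, Finsupp.mapDomain_single]
  have := congrArg (fun f => f.hom (1 : F)) (SSet.ι_chainComplexMap_f _ _ (TopCat.toSSet.map f)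
    (ModuleCat.of F F) ((simplexEquiv X n).symm σ))
  refine this.trans ?_
  rw [generator, show (TopCat.toSSet.map f).app _ ((simplexEquiv X n).symm σ) =
      (simplexEquiv Y n).symm (f.hom.comp σ) by
    rw [Equiv.eq_symm_apply, simplexEquiv_map, Equiv.apply_symm_apply]]

end SingularChain

/-! ### Ranks in the long exact homology sequence -/

namespace SingularChain

open CategoryTheory

open Limits

variable {F : Type u} [Field F]

lemma rank_eq_of_exact {M N P : ModuleCat.{u} F} (f : M ⟶ N) (g : N ⟶ P) (w : f ≫ g = 0)
    (h : (ShortComplex.mk f g w).Exact) :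
    Module.rank F N = Module.rank F (LinearMap.range f.hom) +
      Module.rank F (LinearMap.range g.hom) := by
  have := h.moduleCat_range_eq_ker
  dsimp only at this
  rw [this, add_comm]
  exact (LinearMap.rank_range_add_rank_ker g.hom).symm

lemma epi_homologyMap_zero {K L : ChainComplex (ModuleCat.{u} F) ℕ} (g : K ⟶ L) [Epi g] :
    Epi (HomologicalComplex.homologyMap g 0) := by
  have h0 : ∀ M : ChainComplex (ModuleCat.{u} F) ℕ, IsIso (M.homologyι 0) := fun M =>
    M.isIso_homologyι 0 _ rfl (by simp)
  have := h0 K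
  have := h0 L
  have h1 : Epi (K.pOpcycles 0 ≫ HomologicalComplex.opcyclesMap g 0) := by
    rw [HomologicalComplex.p_opcyclesMap]
    infer_instance
  have h2 : Epi (HomologicalComplex.opcyclesMap g 0) := epi_of_epi (K.pOpcycles 0) _
  have h3 : HomologicalComplex.homologyMap g 0 =
      K.homologyι 0 ≫ HomologicalComplex.opcyclesMap g 0 ≫ inv (L.homologyι 0) := by
    simp [← Category.assoc]
  rw [h3]
  infer_instance

/-- The ranks `α`, `β`, `γ` of the maps in the long exact homology sequence of a short exact
sequence of chain complexes. -/
theorem exists_ranks_of_shortExact {S : ShortComplex (ChainComplex (ModuleCat.{u} F) ℕ)}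
    (hS : S.ShortExact) : ∃ α β γ : ℕ → Cardinal.{u}, γ 0 = 0 ∧
      α 0 = Module.rank F (LinearMap.range (HomologicalComplex.homologyMap S.f 0).hom) ∧
      ∀ i, Module.rank F (S.X₁.homology i) = α i + γ (i + 1) ∧
        Module.rank F (S.X₂.homology i) = α i + β i ∧
        Module.rank F (S.X₃.homology i) = β i + γ i := by
  refine ⟨fun i => Module.rank F (LinearMap.range (HomologicalComplex.homologyMap S.f i).hom),
    fun i => Module.rank F (LinearMap.range (HomologicalComplex.homologyMap S.g i).hom),
    fun i => match i with
      | 0 => 0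
      | i + 1 => Module.rank F (LinearMap.range (hS.δ (i + 1) i rfl).hom),
    rfl, rfl, fun i => ⟨?_, ?_, ?_⟩⟩
  · rw [add_comm]
    exact rank_eq_of_exact _ _ _ (hS.homology_exact₁ (i + 1) i rfl)
  · exact rank_eq_of_exact _ _ _ (hS.homology_exact₂ i)
  · cases i with
    | zero =>
      have := hS.epi_g
      have h := epi_homologyMap_zero S.g
      rw [ModuleCat.epi_iff_range_eq_top] at h
      exact ((rank_top F _).symm.trans
        (congrArg (fun p : Submodule F _ => Module.rank F p) h.symm)).trans (add_zero _).symm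
    | succ i => exact rank_eq_of_exact _ _ _ (hS.homology_exact₃ (i + 1) i rfl)

/-! ### Excision -/

section cokernel

variable {K L : ChainComplex (ModuleCat.{u} F) ℕ} (f : K ⟶ L)

lemma cokernel_π_surjective (n : ℕ) : Function.Surjective ((cokernel.π f).f n).hom :=
  (ModuleCat.epi_iff_surjective _).1 inferInstance

lemma cokernel_π_eq_zero_iff (n : ℕ) (x : L.X n) :
    ((cokernel.π f).f n).hom x = 0 ↔ ∃ y, (f.f n).hom y = x := by
  have h := (ShortComplex.exact_cokernel f).map (HomologicalComplex.eval _ _ n)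
  rw [ShortComplex.moduleCat_exact_iff] at h
  refine ⟨fun hx => h x hx, ?_⟩
  rintro ⟨y, rfl⟩
  exact congrArg (fun g => (g.f n).hom y) (cokernel.condition f)

/-- A monomorphism of complexes with acyclic cokernel is a quasi-isomorphism. -/
lemma homology_iso_of_mono_of_acyclic [Mono f] (h : (cokernel f).Acyclic) (i : ℕ) :
    IsIso (HomologicalComplex.homologyMap f i) := by
  have hS : (ShortComplex.mk f (cokernel.π f) (cokernel.condition f)).ShortExact :=
    { exact := ShortComplex.exact_cokernel f }
  have h0 : ∀ i, IsZero ((cokernel f).homology i) := fun i =>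
    (HomologicalComplex.exactAt_iff_isZero_homology _ _).1 (h i)
  have h1 : Epi (HomologicalComplex.homologyMap f i) :=
    (hS.homology_exact₂ i).epi_f ((h0 i).eq_of_tgt _ _)
  have h2 : Mono (HomologicalComplex.homologyMap f i) :=
    (hS.homology_exact₁ (i + 1) i rfl).mono_g ((h0 (i + 1)).eq_of_src _ _)
  exact isIso_of_mono_of_epi _

end cokernel

section pair

variable {X : Type} [TopologicalSpace X]

/-- A singular simplex of a subspace as a simplex of the whole space. -/
def valComp (A : Set X) (n : ℕ) (σ : C(Simplex n, A)) : C(Simplex n, X) :=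
  (⟨Subtype.val, continuous_subtype_val⟩ : C(A, X)).comp σ

lemma valComp_injective (A : Set X) (n : ℕ) : Function.Injective (valComp A n) := by
  intro σ τ h
  ext t
  exact congrArg (fun f => f t) h

/-- The inclusion of a subspace. -/
def inclusion (A : Set X) : TopCat.of A ⟶ TopCat.of X :=
  TopCat.ofHom ⟨Subtype.val, continuous_subtype_val⟩

variable (F) in
lemma incl_chainsEquiv (A : Set X) (n : ℕ) (a : Chains F A n) :
    ((singularChainsIncl F X A).f n).hom (chainsEquiv F (TopCat.of A) n a) =
      chainsEquiv F (TopCat.of X) n (Finsupp.lmapDomain F F (valComp A n) a) :=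
  singularMap_chainsEquiv F (inclusion A) n a

lemma mapDomain_valComp_mem (A : Set X) (n : ℕ) (a : Chains F A n) :
    Finsupp.lmapDomain F F (valComp A n) a ∈ chainsIn F A n := by
  refine Finsupp.map_mem_of_mem_supported _ (s := Set.univ) (fun σ _ => ?_) (by simp)
  rw [Finsupp.lmapDomain_apply, Finsupp.mapDomain_single]
  refine Finsupp.single_mem_supported F _ ?_
  rintro _ ⟨t, rfl⟩
  exact (σ t).2

lemma exists_mapDomain_valComp (A : Set X) (n : ℕ) {c : Chains F X n} (hc : c ∈ chainsIn F A n) :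
    ∃ a, Finsupp.lmapDomain F F (valComp A n) a = c := by
  suffices h : c ∈ LinearMap.range (Finsupp.lmapDomain F F (valComp A n)) from h
  refine Finsupp.map_mem_of_mem_supported LinearMap.id (fun σ hσ => ?_) hc
  refine ⟨Finsupp.single ⟨fun t => ⟨σ t, hσ ⟨t, rfl⟩⟩, by fun_prop⟩ 1, ?_⟩
  rw [Finsupp.lmapDomain_apply, Finsupp.mapDomain_single]
  rfl

variable (F) in
/-- The chains of `X` that come from the subspace `A` are those supported in `A`. -/
lemma exists_incl_eq_iff (A : Set X) (n : ℕ) (c : Chains F X n) :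
    (∃ y, ((singularChainsIncl F X A).f n).hom y = chainsEquiv F (TopCat.of X) n c) ↔
      c ∈ chainsIn F A n := by
  constructor
  · rintro ⟨y, hy⟩
    obtain ⟨a, rfl⟩ := (chainsEquiv F (TopCat.of A) n).surjective y
    rw [incl_chainsEquiv] at hy
    rw [← (chainsEquiv F (TopCat.of X) n).injective hy]
    exact mapDomain_valComp_mem A n a
  · intro hc
    obtain ⟨a, rfl⟩ := exists_mapDomain_valComp A n hc
    exact ⟨_, incl_chainsEquiv F A n a⟩

instance mono_singularChainsIncl (A : Set X) : Mono (singularChainsIncl F X A) := by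
  have : ∀ n, Mono ((singularChainsIncl F X A).f n) := by
    intro n
    rw [ModuleCat.mono_iff_injective]
    intro y z h
    obtain ⟨a, rfl⟩ := (chainsEquiv F (TopCat.of A) n).surjective y
    obtain ⟨b, rfl⟩ := (chainsEquiv F (TopCat.of A) n).surjective z
    have h' := (incl_chainsEquiv F A n a).symm.trans (h.trans (incl_chainsEquiv F A n b))
    exact congrArg _ (Finsupp.mapDomain_injective (valComp_injective A n)
      ((chainsEquiv F (TopCat.of X) n).injective h'))
  exact HomologicalComplex.mono_of_mono_f _ this

/-- The ranks in the long exact sequence of a pair of spaces. -/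
theorem exists_ranks_of_pair (F : Type u) [Field F] (A : Set X) :
    ∃ α β γ : ℕ → Cardinal.{u}, γ 0 = 0 ∧
      α 0 = Module.rank F
        (LinearMap.range (HomologicalComplex.homologyMap (singularChainsIncl F X A) 0).hom) ∧
      ∀ i, bettiNumber F A i = α i + γ (i + 1) ∧ bettiNumber F X i = α i + β i ∧
        Module.rank F (relativeHomology F X A i) = β i + γ i :=
  exists_ranks_of_shortExact (S := ShortComplex.mk _ _ (cokernel.condition
    (singularChainsIncl F X A))) { exact := ShortComplex.exact_cokernel _ }

variable (F) (U V : Set X)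

lemma incl_comp_incl : singularChainsIncl F V {y | y.1 ∈ U} ≫ singularChainsIncl F X V =
    singularMap (X := TopCat.of {y : V | y.1 ∈ U}) (Y := TopCat.of U)
      (TopCat.ofHom ⟨fun y => ⟨y.1.1, y.2⟩, by fun_prop⟩) ≫ singularChainsIncl F X U := by
  change singularMap (inclusion {y : V | y.1 ∈ U}) ≫ singularMap (inclusion V) =
    _ ≫ singularMap (inclusion U)
  rw [← singularMap_comp, ← singularMap_comp]
  rfl

/-- The map of relative chains `C(V) / C(U ∩ V) ⟶ C(X) / C(U)`. -/
noncomputable def excisionMap :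
    cokernel (singularChainsIncl F V {y | y.1 ∈ U}) ⟶ cokernel (singularChainsIncl F X U) :=
  cokernel.desc _ (singularChainsIncl F X V ≫ cokernel.π (singularChainsIncl F X U)) (by
    rw [← Category.assoc, incl_comp_incl, Category.assoc, cokernel.condition, comp_zero])

lemma excisionMap_π (n : ℕ) (x : (singularChains F (TopCat.of V)).X n) :
    ((excisionMap F U V).f n).hom (((cokernel.π (singularChainsIncl F V {y | y.1 ∈ U})).f n).hom x) =
      ((cokernel.π (singularChainsIncl F X U)).f n).hom (((singularChainsIncl F X V).f n).hom x) :=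
  congrArg (fun g : singularChains F (TopCat.of V) ⟶ cokernel (singularChainsIncl F X U) =>
    (g.f n).hom x) (cokernel.π_desc _ _ _)

instance mono_excisionMap : Mono (excisionMap F U V) := by
  have : ∀ n, Mono ((excisionMap F U V).f n) := by
    intro n
    rw [ModuleCat.mono_iff_injective]
    refine (injective_iff_map_eq_zero _).2 fun x hx => ?_
    obtain ⟨y, rfl⟩ := cokernel_π_surjective (singularChainsIncl F V {y | y.1 ∈ U}) n x
    obtain ⟨a, rfl⟩ := (chainsEquiv F (TopCat.of V) n).surjective y
    replace hx := (excisionMap_π F U V n _).symm.trans hx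
    rw [cokernel_π_eq_zero_iff, incl_chainsEquiv, exists_incl_eq_iff] at hx
    rw [cokernel_π_eq_zero_iff, exists_incl_eq_iff]
    refine (Finsupp.mem_supported F _).2 fun σ hσ => ?_
    rintro _ ⟨t, rfl⟩
    have hσ' : valComp V n σ ∈ (Finsupp.lmapDomain F F (valComp V n) a).support := by
      classical
      rw [Finsupp.lmapDomain_apply, Finsupp.mapDomain_support_of_injective (valComp_injective V n)]
      exact Finset.mem_image_of_mem _ hσ
    exact (Finsupp.mem_supported F _).1 hx hσ' ⟨t, rfl⟩
  exact HomologicalComplex.mono_of_mono_f _ this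

/-- The quotient map from chains of `X` to the cokernel of `excisionMap`. -/
noncomputable def toQuotient (n : ℕ) :
    Chains F X n →ₗ[F] (cokernel (excisionMap F U V)).X n :=
  ((cokernel.π (excisionMap F U V)).f n).hom ∘ₗ
    ((cokernel.π (singularChainsIncl F X U)).f n).hom ∘ₗ
      (chainsEquiv F (TopCat.of X) n).toLinearMap

lemma toQuotient_surjective (n : ℕ) : Function.Surjective (toQuotient F U V n) :=
  (cokernel_π_surjective _ n).comp ((cokernel_π_surjective _ n).comp (LinearEquiv.surjective _))

lemma d_toQuotient (n : ℕ) (c : Chains F X (n + 1)) :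
    ((cokernel (excisionMap F U V)).d (n + 1) n).hom (toQuotient F U V (n + 1) c) =
      toQuotient F U V n (d F X n c) := by
  have h1 := congrArg (fun g => g.hom (((cokernel.π (singularChainsIncl F X U)).f (n + 1)).hom
    (chainsEquiv F (TopCat.of X) (n + 1) c))) ((cokernel.π (excisionMap F U V)).comm (n + 1) n)
  have h2 := congrArg (fun g => g.hom (chainsEquiv F (TopCat.of X) (n + 1) c))
    ((cokernel.π (singularChainsIncl F X U)).comm (n + 1) n)
  refine h1.trans ?_
  refine (congrArg (((cokernel.π (excisionMap F U V)).f n).hom) h2).trans ?_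
  exact congrArg (fun y => ((cokernel.π (excisionMap F U V)).f n).hom
    (((cokernel.π (singularChainsIncl F X U)).f n).hom y)) (d_chainsEquiv F (TopCat.of X) n c)

/-- The cokernel of the excision map is the quotient of the chains of `X` by the small chains. -/
lemma toQuotient_eq_zero_iff (n : ℕ) (c : Chains F X n) :
    toQuotient F U V n c = 0 ↔ c ∈ smallChains F U V n := by
  rw [smallChains_eq, Submodule.mem_sup]
  have key : toQuotient F U V n c = 0 ↔ ∃ a : Chains F V n,
      c - Finsupp.lmapDomain F F (valComp V n) a ∈ chainsIn F U n := by
    refine (cokernel_π_eq_zero_iff _ n _).trans ?_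
    have aux : ∀ a : Chains F V n, ((excisionMap F U V).f n).hom
        (((cokernel.π (singularChainsIncl F V {y | y.1 ∈ U})).f n).hom
          (chainsEquiv F (TopCat.of V) n a)) = ((cokernel.π (singularChainsIncl F X U)).f n).hom
            (chainsEquiv F (TopCat.of X) n c) ↔
        c - Finsupp.lmapDomain F F (valComp V n) a ∈ chainsIn F U n := by
      intro a
      rw [excisionMap_π, incl_chainsEquiv, eq_comm, ← sub_eq_zero, ← map_sub, ← map_sub,
        cokernel_π_eq_zero_iff, exists_incl_eq_iff]
    constructor
    · rintro ⟨x, hx⟩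
      obtain ⟨y, rfl⟩ := cokernel_π_surjective (singularChainsIncl F V {y | y.1 ∈ U}) n x
      obtain ⟨a, rfl⟩ := (chainsEquiv F (TopCat.of V) n).surjective y
      exact ⟨a, (aux a).1 hx⟩
    · rintro ⟨a, ha⟩
      exact ⟨_, (aux a).2 ha⟩
  rw [key]
  constructor
  · rintro ⟨a, ha⟩
    exact ⟨_, ha, _, mapDomain_valComp_mem V n a, sub_add_cancel _ _⟩
  · rintro ⟨x, hx, y, hy, rfl⟩
    obtain ⟨a, rfl⟩ := exists_mapDomain_valComp V n hy
    exact ⟨a, by simpa using hx⟩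

variable {U V}

/-- The cokernel of the excision map is acyclic since a chain with small boundary is homologous to
a small chain. -/
lemma acyclic_cokernel_excisionMap (hU : IsOpen U) (hV : IsOpen V) (hUV : U ∪ V = Set.univ) :
    (cokernel (excisionMap F U V)).Acyclic := by
  intro n
  cases n with
  | zero =>
    have hz : Limits.IsZero ((cokernel (excisionMap F U V)).X 0) := by
      have : Subsingleton ((cokernel (excisionMap F U V)).X 0) := by
        refine subsingleton_of_forall_eq 0 fun x => ?_
        obtain ⟨c, rfl⟩ := toQuotient_surjective F U V 0 x
        exact (toQuotient_eq_zero_iff F U V 0 c).2 (mem_small_zero hUV c)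
      exact ModuleCat.isZero_of_subsingleton _
    exact ShortComplex.exact_of_isZero_X₂ _ hz
  | succ n =>
    rw [HomologicalComplex.exactAt_iff' _ (n + 2) (n + 1) n (by simp) (by simp),
      ShortComplex.moduleCat_exact_iff]
    intro x hx
    obtain ⟨c, rfl⟩ := toQuotient_surjective F U V (n + 1) x
    replace hx := (d_toQuotient F U V n c).symm.trans hx
    replace hx := (toQuotient_eq_zero_iff F U V n _).1 hx
    obtain ⟨e, he⟩ := exists_sub_d_mem_small hU hV hUV c hx
    refine ⟨toQuotient F U V (n + 2) e, (d_toQuotient F U V (n + 1) e).trans ?_⟩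
    rw [← toQuotient_eq_zero_iff, map_sub, sub_eq_zero] at he
    exact he.symm

/-- Excision for an open cover `U ∪ V` of `X`. -/
theorem rank_relativeHomology_eq (hU : IsOpen U) (hV : IsOpen V) (hUV : U ∪ V = Set.univ) (i : ℕ) :
    Module.rank F (relativeHomology F X U i) =
      Module.rank F (relativeHomology F V {y | y.1 ∈ U} i) := by
  have := homology_iso_of_mono_of_acyclic (excisionMap F U V)
    (acyclic_cokernel_excisionMap F hU hV hUV) i
  exact (asIso (HomologicalComplex.homologyMap (excisionMap F U V) i)).toLinearEquiv.rank_eq.symm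

end pair

end SingularChain

/-! ### Betti numbers of spaces and of attached cones -/

namespace SingularChain

open CategoryTheory

open Limits

variable (F : Type u) [Field F]

section homotopy

variable {X Y : Type} [TopologicalSpace X] [TopologicalSpace Y]

/-- The map in homology induced by a continuous map. -/
noncomputable def homologyMap (f : C(X, Y)) (i : ℕ) :
    (singularChains F (TopCat.of X)).homology i ⟶ (singularChains F (TopCat.of Y)).homology i :=
  HomologicalComplex.homologyMap (singularMap (TopCat.ofHom f)) i

lemma homologyMap_id (i : ℕ) : homologyMap F (ContinuousMap.id X) i = 𝟙 _ := by
  refine Eq.trans ?_ (HomologicalComplex.homologyMap_id _ i)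
  exact congrArg (fun f => HomologicalComplex.homologyMap f i) (singularMap_id F (TopCat.of X))

lemma homologyMap_comp {Z : Type} [TopologicalSpace Z] (g : C(Y, Z)) (f : C(X, Y)) (i : ℕ) :
    homologyMap F (g.comp f) i = homologyMap F f i ≫ homologyMap F g i := by
  refine Eq.trans ?_ (HomologicalComplex.homologyMap_comp _ _ i)
  exact congrArg (fun f => HomologicalComplex.homologyMap f i)
    (singularMap_comp F (TopCat.ofHom f) (TopCat.ofHom g))

lemma homologyMap_eq_of_homotopic {f g : C(X, Y)} (h : f.Homotopic g) (i : ℕ) :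
    homologyMap F f i = homologyMap F g i :=
  h.elim fun H => TopCat.Homotopy.congr_homologyMap_singularChainComplexFunctor
    (f := TopCat.ofHom f) (g := TopCat.ofHom g) H (ModuleCat.of F F) i

variable {F} in
lemma bettiNumber_congr (e : ContinuousMap.HomotopyEquiv X Y) (i : ℕ) :
    bettiNumber F X i = bettiNumber F Y i :=
  (Iso.toLinearEquiv
    { hom := homologyMap F e.toFun i
      inv := homologyMap F e.invFun i
      hom_inv_id := by
        rw [← homologyMap_comp, homologyMap_eq_of_homotopic F e.left_inv, homologyMap_id]
      inv_hom_id := by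
        rw [← homologyMap_comp, homologyMap_eq_of_homotopic F e.right_inv,
          homologyMap_id] }).rank_eq

lemma bettiNumber_of_isEmpty [IsEmpty X] (i : ℕ) : bettiNumber F X i = 0 := by
  have : IsEmpty C(Simplex i, X) := ⟨fun σ => isEmptyElim (σ stdSimplex.barycenter)⟩
  have : Subsingleton ((singularChains F (TopCat.of X)).X i) :=
    (chainsEquiv F (TopCat.of X) i).symm.toEquiv.subsingleton
  have hz : IsZero ((singularChains F (TopCat.of X)).X i) := ModuleCat.isZero_of_subsingleton _
  have hz' : IsZero ((singularChains F (TopCat.of X)).homology i) :=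
    (HomologicalComplex.exactAt_iff_isZero_homology _ _).1 (ShortComplex.exact_of_isZero_X₂ _ hz)
  have := ModuleCat.subsingleton_of_isZero hz'
  exact rank_subsingleton' F _

lemma bettiNumber_point_succ (i : ℕ) : bettiNumber F Unit (i + 1) = 0 := by
  have hz := AlgebraicTopology.isZero_singularHomologyFunctor_of_totallyDisconnectedSpace
    (ModuleCat.{u} F) (i + 1) (ModuleCat.of F F) (TopCat.of Unit) (by simp)
  have : Subsingleton ((singularChains F (TopCat.of Unit)).homology (i + 1)) :=
    ModuleCat.subsingleton_of_isZero hz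
  exact rank_subsingleton' F _

lemma bettiNumber_point_zero : bettiNumber F Unit 0 = 1 := by
  have : PathConnectedSpace (TopCat.of Unit) := inferInstanceAs (PathConnectedSpace Unit)
  exact (asIso ((TopCat.of Unit).singularHomology₀ε (ModuleCat.of F F))).toLinearEquiv.rank_eq.trans
    (Module.rank_self F)

lemma bettiNumber_contractible_succ [ContractibleSpace X] (i : ℕ) :
    bettiNumber F X (i + 1) = 0 :=
  (bettiNumber_congr (ContractibleSpace.hequiv X Unit).some _).trans (bettiNumber_point_succ F i)

lemma bettiNumber_contractible_zero [ContractibleSpace X] : bettiNumber F X 0 = 1 :=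
  (bettiNumber_congr (ContractibleSpace.hequiv X Unit).some _).trans (bettiNumber_point_zero F)

/-- A nonempty subspace has a nonzero image in the homology of degree `0`, since a point of it is
a retract of the whole space. -/
lemma one_le_rank_range_homologyMap_zero (A : Set X) [Nonempty A] : 1 ≤ Module.rank F
    (LinearMap.range (HomologicalComplex.homologyMap (singularChainsIncl F X A) 0).hom) := by
  obtain ⟨a⟩ := ‹Nonempty A›
  rw [Cardinal.one_le_iff_ne_zero]
  intro h
  rw [rank_zero_iff, Submodule.subsingleton_iff_eq_bot, LinearMap.range_eq_bot] at h
  have h0 : homologyMap F (⟨Subtype.val, continuous_subtype_val⟩ : C(A, X)) 0 = 0 :=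
    ModuleCat.hom_ext h
  have h1 : 𝟙 ((singularChains F (TopCat.of Unit)).homology 0) = 0 := by
    rw [← homologyMap_id, show ContinuousMap.id Unit = (ContinuousMap.const X ()).comp
      ((⟨Subtype.val, continuous_subtype_val⟩ : C(A, X)).comp (ContinuousMap.const Unit a)) from rfl,
      homologyMap_comp, homologyMap_comp, h0, comp_zero, zero_comp]
  have hz := ModuleCat.subsingleton_of_isZero ((IsZero.iff_id_eq_zero _).2 h1)
  have := (rank_subsingleton' F ((singularChains F (TopCat.of Unit)).homology 0)).symm.trans
    (bettiNumber_point_zero F)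
  exact zero_ne_one this

end homotopy

open Classical in
/-- The sequence `b` consists of the reduced Betti numbers of `X`, shifted by one: `b 0` is `1` for
the empty space and `0` otherwise, `b 1` is the dimension of the reduced homology in degree `0`,
and `b (i + 1)` is the dimension of the homology in degree `i` if `i > 0`. -/
structure HasReducedBetti (X : Type) [TopologicalSpace X] (b : ℕ → ℕ) : Prop where
  zero : b 0 = if IsEmpty X then 1 else 0
  one : bettiNumber F X 0 + b 0 = b 1 + 1
  succ : ∀ i, bettiNumber F X (i + 1) = b (i + 2)

variable {F}

section reduced

variable {X Y : Type} [TopologicalSpace X] [TopologicalSpace Y]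

open Classical in
lemma HasReducedBetti.congr {b : ℕ → ℕ} (h : HasReducedBetti F X b)
    (e : ContinuousMap.HomotopyEquiv X Y) : HasReducedBetti F Y b where
  zero := by
    have : IsEmpty X ↔ IsEmpty Y :=
      ⟨fun _ => ⟨fun y => isEmptyElim (e.invFun y)⟩, fun _ => ⟨fun x => isEmptyElim (e x)⟩⟩
    rw [h.zero]
    exact if_congr this rfl rfl
  one := by rw [← bettiNumber_congr e, h.one]
  succ i := by rw [← bettiNumber_congr e, h.succ]

lemma HasReducedBetti.of_isEmpty [IsEmpty X] : HasReducedBetti F X (fun j => if j = 0 then 1 else 0)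
    where
  zero := by simp [‹IsEmpty X›]
  one := by simp [bettiNumber_of_isEmpty]
  succ i := by simp [bettiNumber_of_isEmpty]

lemma HasReducedBetti.of_contractible [ContractibleSpace X] : HasReducedBetti F X 0 where
  zero := by simp
  one := by simp [bettiNumber_contractible_zero]
  succ i := by simp [bettiNumber_contractible_succ]

lemma HasReducedBetti.unique {b b' : ℕ → ℕ} (h : HasReducedBetti F X b)
    (h' : HasReducedBetti F X b') : b = b' := by
  have h0 : b 0 = b' 0 := h.zero.trans h'.zero.symm
  funext j
  match j with
  | 0 => exact h0
  | 1 =>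
    have := h.one.symm.trans ((congrArg (fun n : ℕ => bettiNumber F X 0 + n) h0).trans h'.one)
    exact_mod_cast add_right_cancel (show b 1 + 1 = b' 1 + 1 by exact_mod_cast this)
  | i + 2 => exact_mod_cast (h.succ i).symm.trans (h'.succ i)

lemma _root_.Cardinal.exists_nat_of_add_eq {a b : Cardinal.{u}} {n : ℕ} (h : (n : Cardinal) = a + b) :
    ∃ k l : ℕ, a = k ∧ b = l := by
  have hlt : a + b < Cardinal.aleph0 := h ▸ Cardinal.natCast_lt_aleph0
  obtain ⟨ha, hb⟩ := Cardinal.add_lt_aleph0_iff.1 hlt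
  obtain ⟨k, rfl⟩ := Cardinal.lt_aleph0.1 ha
  obtain ⟨l, rfl⟩ := Cardinal.lt_aleph0.1 hb
  exact ⟨k, l, rfl, rfl⟩

lemma HasReducedBetti.exists_betti {b : ℕ → ℕ} (h : HasReducedBetti F X b) :
    ∃ c : ℕ → ℕ, (∀ i, bettiNumber F X i = c i) ∧ c 0 + b 0 = b 1 + 1 ∧
      ∀ i, c (i + 1) = b (i + 2) := by
  obtain ⟨k, l, hk, -⟩ := Cardinal.exists_nat_of_add_eq (n := b 1 + 1) (by exact_mod_cast h.one.symm)
  refine ⟨fun i => if i = 0 then k else b (i + 1), fun i => ?_, ?_, fun i => by simp⟩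
  · cases i with
    | zero => simpa using hk
    | succ i => simpa using h.succ i
  · have := h.one
    rw [hk] at this
    simpa using (by exact_mod_cast this : k + b 0 = b 1 + 1)

/-- The homology of a contractible space relative to a subspace `W` is the reduced homology of `W`
shifted by one degree. -/
lemma rank_relativeHomology_of_contractible [ContractibleSpace X] (W : Set X) {w : ℕ → ℕ}
    (hw : HasReducedBetti F W w) (i : ℕ) : Module.rank F (relativeHomology F X W i) = w i := by
  obtain ⟨α, β, γ, hγ, hα, h⟩ := exists_ranks_of_pair F W
  have hX : ∀ i, α (i + 1) = 0 ∧ β (i + 1) = 0 := fun i => by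
    have := (h (i + 1)).2.1
    rw [bettiNumber_contractible_succ] at this
    simpa using this.symm
  obtain ⟨c, hc, hc0, hcs⟩ := hw.exists_betti
  have h0 : (1 : Cardinal) = α 0 + β 0 := by
    rw [← (h 0).2.1, bettiNumber_contractible_zero]
  obtain ⟨a, b, ha, hb⟩ := Cardinal.exists_nat_of_add_eq (n := 1) (by exact_mod_cast h0)
  have hab : 1 = a + b := by rw [ha, hb] at h0; exact_mod_cast h0
  have hc1 := (h 0).1
  rw [hc 0] at hc1
  obtain ⟨_, g, -, hg⟩ := Cardinal.exists_nat_of_add_eq hc1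
  have hc1' : c 0 = a + g := by rw [ha, hg] at hc1; exact_mod_cast hc1
  have ha' : a = 1 - w 0 := by
    have hw0 := hw.zero
    by_cases hW : IsEmpty W
    · have : c 0 = 0 := by
        have := hc 0
        rw [bettiNumber_of_isEmpty] at this
        exact_mod_cast this.symm
      rw [if_pos hW] at hw0
      omega
    · have : Nonempty W := not_isEmpty_iff.1 hW
      have := one_le_rank_range_homologyMap_zero F W
      rw [← hα, ha] at this
      have : 1 ≤ a := by exact_mod_cast this
      rw [if_neg hW] at hw0
      omega
  have hw01 : w 0 ≤ 1 := by rw [hw.zero]; split_ifs <;> simp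
  rw [(h i).2.2]
  match i with
  | 0 =>
    rw [hγ, hb, add_zero]
    exact_mod_cast (by omega : b = w 0)
  | 1 =>
    rw [(hX 0).2, hg, zero_add]
    exact_mod_cast (by omega : g = w 1)
  | i + 2 =>
    have := (h (i + 1)).1
    rw [(hX i).1, zero_add, hc, hcs] at this
    rw [(hX (i + 1)).2, zero_add, ← this]

/-- The exact sequence for a space that is covered by an open subspace `U` and a contractible open
subspace `V`, in terms of ranks: `α`, `β` and `γ` are the ranks of the maps induced by the
inclusion of `U`, of the maps to the relative homology and of the connecting maps, all in reduced
homology and indexed as in `HasReducedBetti`. By excision the homology of `X` relative to `U` is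
that of `V` relative to `U ∩ V`, which is the shifted reduced homology of `U ∩ V`. -/
theorem exists_ranks_of_cover {U V : Set X} (hU : IsOpen U) (hV : IsOpen V)
    (hUV : U ∪ V = Set.univ) [ContractibleSpace V] {a w : ℕ → ℕ} (ha : HasReducedBetti F U a)
    (hw : HasReducedBetti F {y : V | y.1 ∈ U} w) :
    (∀ i, Module.rank F (relativeHomology F X U i) = w i) ∧
    ∃ x α β γ : ℕ → ℕ, HasReducedBetti F X x ∧ β 0 = 0 ∧
      ∀ j, a j = α j + γ j ∧ x j = α j + β j ∧ w j = β (j + 1) + γ j := by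
  have hr : ∀ i, Module.rank F (relativeHomology F X U i) = w i := fun i =>
    (rank_relativeHomology_eq F hU hV hUV i).trans (rank_relativeHomology_of_contractible _ hw i)
  refine ⟨hr, ?_⟩
  obtain ⟨α, β, γ, hγ, hα, h⟩ := exists_ranks_of_pair F U
  obtain ⟨c, hc, hc0, hcs⟩ := ha.exists_betti
  have hαγ : ∀ i, ∃ k l : ℕ, α i = k ∧ γ (i + 1) = l := fun i =>
    Cardinal.exists_nat_of_add_eq ((hc i).symm.trans (h i).1)
  have hβγ : ∀ i, ∃ k l : ℕ, β i = k ∧ γ i = l := fun i =>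
    Cardinal.exists_nat_of_add_eq ((hr i).symm.trans (h i).2.2)
  choose α' _ hα' _ using hαγ
  choose β' γ' hβ' hγ' using hβγ
  have h1 : ∀ i, c i = α' i + γ' (i + 1) := fun i => by
    have := (hc i).symm.trans (h i).1
    rw [hα', hγ'] at this
    exact_mod_cast this
  have h2 : ∀ i, bettiNumber F X i = (α' i + β' i : ℕ) := fun i => by
    rw [(h i).2.1, hα', hβ', Nat.cast_add]
  have h3 : ∀ i, w i = β' i + γ' i := fun i => by
    have := (hr i).symm.trans (h i).2.2
    rw [hβ', hγ'] at this
    exact_mod_cast this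
  have hγ0 : γ' 0 = 0 := by rw [hγ'] at hγ; exact_mod_cast hγ
  by_cases hUe : IsEmpty U
  · -- for empty `U` the space is contractible, and the only nonzero rank is that of the connecting
    -- map from degree `0` to the reduced homology of the empty space in degree `-1`
    obtain rfl := ha.unique HasReducedBetti.of_isEmpty
    have hWe : IsEmpty {y : V | y.1 ∈ U} := ⟨fun y => hUe.elim ⟨y.1.1, y.2⟩⟩
    obtain rfl := hw.unique HasReducedBetti.of_isEmpty
    have hc' : ∀ i, c i = 0 := fun i => by
      have := hc i
      rw [bettiNumber_of_isEmpty] at this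
      exact_mod_cast this.symm
    have hV' : V = Set.univ := by
      rw [← hUV, Set.eq_empty_of_isEmpty U, Set.empty_union]
    refine ⟨0, 0, 0, fun j => if j = 0 then 1 else 0, ?_, rfl, by simp⟩
    have : ContractibleSpace X := by
      have e : V ≃ₜ X := (Homeomorph.setCongr hV').trans (Homeomorph.Set.univ X)
      exact e.symm.toHomotopyEquiv.contractibleSpace
    exact HasReducedBetti.of_contractible
  · have hUne : Nonempty U := not_isEmpty_iff.1 hUe
    have hα1 : 1 ≤ α' 0 := by
      have := one_le_rank_range_homologyMap_zero F U
      rw [← hα, hα'] at this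
      exact_mod_cast this
    have ha0 : a 0 = 0 := by rw [ha.zero, if_neg hUe]
    refine ⟨fun j => match j with
      | 0 => 0
      | 1 => α' 0 - 1 + β' 0
      | i + 2 => α' (i + 1) + β' (i + 1), fun j => match j with
      | 0 => 0
      | 1 => α' 0 - 1
      | i + 2 => α' (i + 1), fun j => match j with
      | 0 => 0
      | j + 1 => β' j, γ', ⟨?_, ?_, fun i => h2 _⟩, rfl, fun j => ⟨?_, ?_, ?_⟩⟩
    · have : ¬ IsEmpty X := not_isEmpty_iff.2 ⟨hUne.some.1⟩
      rw [if_neg this]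
    · rw [h2 0]
      exact_mod_cast (by omega : α' 0 + β' 0 + 0 = α' 0 - 1 + β' 0 + 1)
    · match j with
      | 0 => simpa [hγ0] using ha0
      | 1 => have : c 0 = α' 0 + γ' 1 := h1 0; simp only; omega
      | i + 2 => rw [← hcs, h1]
    · match j with
      | 0 => rfl
      | 1 => rfl
      | i + 2 => rfl
    · exact h3 j

end reduced

end SingularChain

/-! ### Geometric realizations and sublevel sets -/

/-- Two subspaces of a topological vector space are homotopy equivalent if there are maps between
them for which the segments from every point to its image under the composition stay inside. -/
noncomputable def homotopyEquivOfSegments {E : Type*} [AddCommGroup E] [Module ℝ E]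
    [TopologicalSpace E] [IsTopologicalAddGroup E] [ContinuousSMul ℝ E]
    {A B : Type*} [TopologicalSpace A] [TopologicalSpace B] {p : A → E} {q : B → E}
    (hp : Topology.IsEmbedding p) (hq : Topology.IsEmbedding q) (f : C(A, B)) (g : C(B, A))
    (h₁ : ∀ a, segment ℝ (p (g (f a))) (p a) ⊆ Set.range p)
    (h₂ : ∀ b, segment ℝ (q (f (g b))) (q b) ⊆ Set.range q) :
    ContinuousMap.HomotopyEquiv A B where
  toFun := f
  invFun := g
  left_inv := ⟨{
    toFun := fun x => hp.toHomeomorph.symm ⟨AffineMap.lineMap (p (g (f x.2))) (p x.2) x.1.1,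
      h₁ x.2 (by rw [segment_eq_image_lineMap]; exact ⟨_, x.1.2, rfl⟩)⟩
    continuous_toFun := by
      refine hp.toHomeomorph.symm.continuous.comp (Continuous.subtype_mk ?_ _)
      simp only [AffineMap.lineMap_apply_module]
      have := hp.continuous
      fun_prop
    map_zero_left := fun a => by
      rw [Homeomorph.symm_apply_eq]
      exact Subtype.ext (AffineMap.lineMap_apply_zero _ _)
    map_one_left := fun a => by
      rw [Homeomorph.symm_apply_eq]
      exact Subtype.ext (AffineMap.lineMap_apply_one _ _) }⟩
  right_inv := ⟨{
    toFun := fun x => hq.toHomeomorph.symm ⟨AffineMap.lineMap (q (f (g x.2))) (q x.2) x.1.1,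
      h₂ x.2 (by rw [segment_eq_image_lineMap]; exact ⟨_, x.1.2, rfl⟩)⟩
    continuous_toFun := by
      refine hq.toHomeomorph.symm.continuous.comp (Continuous.subtype_mk ?_ _)
      simp only [AffineMap.lineMap_apply_module]
      have := hq.continuous
      fun_prop
    map_zero_left := fun a => by
      rw [Homeomorph.symm_apply_eq]
      exact Subtype.ext (AffineMap.lineMap_apply_zero _ _)
    map_one_left := fun a => by
      rw [Homeomorph.symm_apply_eq]
      exact Subtype.ext (AffineMap.lineMap_apply_one _ _) }⟩

namespace SimplexFamily

set_option linter.unusedSectionVars false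

variable {ι : Type} [Fintype ι] [DecidableEq ι]

/-- The geometric realization of a family of finite sets, in barycentric coordinates. -/
def geo (P : Set (Finset ι)) : Set (ι → ℝ) :=
  {x | x ∈ stdSimplex ℝ ι ∧ ∃ σ ∈ P, ∀ i, i ∉ σ → x i = 0}

/-- The link of a vertex. -/
def link (P : Set (Finset ι)) (v : ι) : Set (Finset ι) := {σ | v ∉ σ ∧ insert v σ ∈ P}

/-- The members of a family that are contained in a set of vertices. -/
def restrict (P : Set (Finset ι)) (S : Set ι) : Set (Finset ι) := {σ ∈ P | ∀ i ∈ σ, i ∈ S}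

/-- The part of the realization where the linear function with vertex values `g` is at most its
value at the vertex `v`. -/
def lowerPart (P : Set (Finset ι)) (g : ι → ℝ) (v : ι) : Set (ι → ℝ) :=
  {x ∈ geo P | ∑ i, x i * g i ≤ g v}

lemma isLowerSet_link {P : Set (Finset ι)} (hP : IsLowerSet P) (v : ι) : IsLowerSet (link P v) :=
  fun _ _ h hσ => ⟨fun hv => hσ.1 (h hv), hP (Finset.insert_subset_insert v h) hσ.2⟩

lemma isLowerSet_restrict {P : Set (Finset ι)} (hP : IsLowerSet P) (S : Set ι) :
    IsLowerSet (restrict P S) :=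
  fun _ _ h hσ => ⟨hP h hσ.1, fun i hi => hσ.2 i (h hi)⟩

lemma link_restrict (P : Set (Finset ι)) {S : Set ι} {v : ι} (hv : v ∈ S) :
    link (restrict P S) v = restrict (link P v) S := by
  ext σ
  simp only [link, restrict, Set.mem_ofPred_eq, Finset.mem_insert, forall_eq_or_imp]
  tauto

section retraction

variable {P : Set (Finset ι)} (g : ι → ℝ) (v : ι)

/-- The mass of a point on the vertices below `v`. -/
noncomputable def lowerMass (x : ι → ℝ) : ℝ := ∑ i, if g i < g v then x i else 0

/-- The projection to the face spanned by the vertices below `v`. -/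
noncomputable def toLower (x : ι → ℝ) : ι → ℝ :=
  fun i => if g i < g v then x i / lowerMass g v x else 0

variable {g v}

lemma lowerMass_nonneg {x : ι → ℝ} (hx : x ∈ stdSimplex ℝ ι) : 0 ≤ lowerMass g v x :=
  Finset.sum_nonneg fun i _ => by split_ifs; exacts [hx.1 i, le_rfl]

lemma lowerMass_lineMap (x y : ι → ℝ) (t : ℝ) : lowerMass g v ((1 - t) • x + t • y) =
    (1 - t) * lowerMass g v x + t * lowerMass g v y := by
  simp only [lowerMass, Finset.mul_sum, ← Finset.sum_add_distrib]
  refine Finset.sum_congr rfl fun i _ => ?_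
  split_ifs <;> simp

lemma lowerMass_vertex : lowerMass g v (Pi.single v 1) = 0 := by
  refine Finset.sum_eq_zero fun i _ => ?_
  split_ifs with h
  · exact Pi.single_eq_of_ne (fun e => by simp [e] at h) 1
  · rfl

lemma continuous_lowerMass : Continuous (lowerMass g v) :=
  continuous_finsetSum _ fun i _ => by split_ifs <;> fun_prop

/-- A point of the lower part other than `v` has mass below `v`: otherwise its value would be
greater than that of `v`. -/
lemma lowerMass_pos (hg : ∀ i, i ≠ v → g i ≠ g v) {x : ι → ℝ} (hx : x ∈ lowerPart P g v)
    (hxv : x ≠ Pi.single v 1) : 0 < lowerMass g v x := by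
  refine (lowerMass_nonneg hx.1.1).lt_of_ne fun h0 => hxv ?_
  have h1 : ∀ i, g i < g v → x i = 0 := by
    intro i hi
    have := (Finset.sum_eq_zero_iff_of_nonneg (fun i _ => by
      split_ifs; exacts [hx.1.1.1 i, le_rfl])).1 h0.symm i (Finset.mem_univ i)
    simpa [hi] using this
  have h2 : ∑ i, x i * (g i - g v) ≤ 0 := by
    simp only [mul_sub, Finset.sum_sub_distrib, ← Finset.sum_mul, hx.1.1.2]
    linarith [hx.2]
  have h3 : ∀ i, 0 ≤ x i * (g i - g v) := by
    intro i
    rcases lt_or_ge (g i) (g v) with h | h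
    · simp [h1 i h]
    · exact mul_nonneg (hx.1.1.1 i) (sub_nonneg.2 h)
  have h4 : ∀ i, i ≠ v → x i = 0 := by
    intro i hi
    have := (Finset.sum_eq_zero_iff_of_nonneg fun i _ => h3 i).1
      (h2.antisymm (Finset.sum_nonneg fun i _ => h3 i)) i (Finset.mem_univ i)
    exact (mul_eq_zero.1 this).resolve_right (sub_ne_zero.2 (hg i hi))
  have h5 : x v = 1 := by
    rw [← hx.1.1.2]
    exact (Finset.sum_eq_single v (fun i _ hi => h4 i hi) (by simp)).symm
  funext i
  by_cases hi : i = v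
  · subst hi; simp [h5]
  · rw [h4 i hi, Pi.single_eq_of_ne hi]

lemma toLower_mem_stdSimplex {x : ι → ℝ} (hx : x ∈ stdSimplex ℝ ι) (h : 0 < lowerMass g v x) :
    toLower g v x ∈ stdSimplex ℝ ι := by
  refine ⟨fun i => ?_, ?_⟩
  · simp only [toLower]
    split_ifs
    exacts [div_nonneg (hx.1 i) h.le, le_rfl]
  · have : ∀ i, toLower g v x i = (if g i < g v then x i else 0) / lowerMass g v x := fun i => by
      simp only [toLower]; split_ifs <;> simp
    simp only [this, ← Finset.sum_div]
    exact div_self h.ne'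

lemma toLower_eq_zero {x : ι → ℝ} {i : ι} (h : x i = 0) : toLower g v x i = 0 := by
  simp [toLower, h]

lemma toLower_eq_zero_of_le {x : ι → ℝ} {i : ι} (h : ¬ g i < g v) : toLower g v x i = 0 := by
  simp [toLower, h]

lemma value_le_of_below {x : ι → ℝ} (hx : x ∈ stdSimplex ℝ ι) (h : ∀ i, ¬ g i < g v → x i = 0) :
    ∑ i, x i * g i ≤ g v := by
  calc ∑ i, x i * g i ≤ ∑ i, x i * g v := Finset.sum_le_sum fun i _ => by
        by_cases hi : g i < g v
        · exact mul_le_mul_of_nonneg_left hi.le (hx.1 i)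
        · simp [h i hi]
    _ = g v := by rw [← Finset.sum_mul, hx.2, one_mul]

lemma lowerMass_of_below {x : ι → ℝ} (hx : x ∈ stdSimplex ℝ ι) (h : ∀ i, ¬ g i < g v → x i = 0) :
    lowerMass g v x = 1 := by
  rw [← hx.2]
  refine Finset.sum_congr rfl fun i _ => ?_
  split_ifs with hi
  · rfl
  · exact (h i hi).symm

lemma toLower_of_below {x : ι → ℝ} (hx : x ∈ stdSimplex ℝ ι) (h : ∀ i, ¬ g i < g v → x i = 0) :
    toLower g v x = x := by
  funext i
  simp only [toLower, lowerMass_of_below hx h, div_one]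
  split_ifs with hi
  · rfl
  · exact (h i hi).symm

lemma continuousOn_toLower : ContinuousOn (toLower g v) {x | 0 < lowerMass g v x} := by
  refine continuousOn_pi.2 fun i => ?_
  simp only [toLower]
  split_ifs
  · exact (continuous_apply i).continuousOn.div continuous_lowerMass.continuousOn fun x hx => hx.ne'
  · exact continuousOn_const

/-- Each closed cell of the lower part is convex. -/
lemma convex_cell (σ : Finset ι) (c : ℝ) :
    Convex ℝ {x : ι → ℝ | x ∈ stdSimplex ℝ ι ∧ (∀ i, i ∉ σ → x i = 0) ∧ ∑ i, x i * g i ≤ c} := by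
  refine (convex_stdSimplex ℝ ι).inter (Convex.inter ?_ ?_)
  · intro x hx y hy a b _ _ _ i hi
    simp [hx i hi, hy i hi]
  · refine convex_halfSpace_le ?_ c
    exact ⟨fun x y => by simp [add_mul, Finset.sum_add_distrib], fun a x => by
      simp [mul_assoc, Finset.mul_sum]⟩

lemma segment_subset_lowerPart {σ : Finset ι} (hσ : σ ∈ P) {x y : ι → ℝ} (hx : x ∈ stdSimplex ℝ ι)
    (hy : y ∈ stdSimplex ℝ ι) (hxσ : ∀ i, i ∉ σ → x i = 0) (hyσ : ∀ i, i ∉ σ → y i = 0)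
    (hxg : ∑ i, x i * g i ≤ g v) (hyg : ∑ i, y i * g i ≤ g v) :
    segment ℝ x y ⊆ lowerPart P g v := fun _ hz =>
  have := (convex_cell σ (g v)).segment_subset ⟨hx, hxσ, hxg⟩ ⟨hy, hyσ, hyg⟩ hz
  ⟨⟨this.1, σ, hσ, this.2.1⟩, this.2.2⟩

end retraction

section cover

variable {P : Set (Finset ι)} {g : ι → ℝ} {v : ι} {X : Type} [TopologicalSpace X] {p : X → ι → ℝ}

lemma vertex_mem_lowerPart (hv : {v} ∈ P) : Pi.single v 1 ∈ lowerPart P g v :=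
  ⟨⟨single_mem_stdSimplex ℝ v, {v}, hv, fun i hi => Pi.single_eq_of_ne (by simpa using hi) 1⟩, by
    simp [Pi.single_apply]⟩

/-- The part of the lower part in the open star of `v` is star-shaped with center `v`. -/
lemma contractible_star (hp : Topology.IsEmbedding p) (hX : Set.range p = lowerPart P g v)
    (hv : {v} ∈ P) : ContractibleSpace {x | 0 < p x v} := by
  obtain ⟨x₀, hx₀⟩ : Pi.single v 1 ∈ Set.range p := hX ▸ vertex_mem_lowerPart hv
  have hpV : Topology.IsEmbedding fun x : {x | 0 < p x v} => p x.1 := hp.comp .subtypeVal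
  have hq : Topology.IsEmbedding fun _ : Unit => (0 : ι → ℝ) := .of_subsingleton _
  refine (homotopyEquivOfSegments hpV hq (ContinuousMap.const _ ())
    (ContinuousMap.const _ ⟨x₀, by simp [hx₀]⟩) (fun x => ?_) (fun _ => ?_)).contractibleSpace
  · intro z hz
    have hx : p x.1 ∈ lowerPart P g v := hX ▸ ⟨_, rfl⟩
    obtain ⟨σ, hσ, hσx⟩ := hx.1.2
    have hvσ : v ∈ σ := by_contra fun h => (x.2 : 0 < p x.1 v).ne' (hσx v h)
    simp only [ContinuousMap.const_apply, hx₀] at hz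
    have hz1 : z ∈ lowerPart P g v := segment_subset_lowerPart hσ (single_mem_stdSimplex ℝ v) hx.1.1
      (fun i hi => Pi.single_eq_of_ne (by rintro rfl; exact hi hvσ) 1) hσx
      (vertex_mem_lowerPart hv).2 hx.2 hz
    obtain ⟨y, rfl⟩ := hX ▸ hz1
    refine ⟨⟨y, ?_⟩, rfl⟩
    obtain ⟨a, b, ha, hb, hab, h⟩ := hz
    have := congrFun h v
    simp only [Pi.add_apply, Pi.smul_apply, smul_eq_mul, Pi.single_eq_same, mul_one] at this
    have hxv : 0 < p x.1 v := x.2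
    change 0 < p y v
    rw [← this]
    rcases ha.eq_or_lt with rfl | ha
    · rw [zero_add] at hab
      simpa [hab] using hxv
    · positivity
  · simp

lemma segment_lowerMass_pos {x y z : ι → ℝ} (hx : 0 < lowerMass g v x) (hy : 0 < lowerMass g v y)
    (hz : z ∈ segment ℝ x y) : 0 < lowerMass g v z := by
  rw [segment_eq_image] at hz
  obtain ⟨t, ⟨ht0, ht1⟩, rfl⟩ := hz
  simp only [lowerMass_lineMap]
  rcases ht0.eq_or_lt with rfl | ht
  · simpa using hx
  · have : 0 ≤ (1 - t) * lowerMass g v x := mul_nonneg (by linarith) hx.le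
    positivity

lemma ne_vertex_of_lowerMass_pos {x : ι → ℝ} (h : 0 < lowerMass g v x) : x ≠ Pi.single v 1 := by
  rintro rfl
  exact h.ne' lowerMass_vertex

/-- The lower part without the vertex `v` retracts to the subcomplex below `v`, by the
normalized projection `toLower`. -/
noncomputable def lowerPartEquiv (hP : IsLowerSet P) (hg : ∀ i, i ≠ v → g i ≠ g v)
    (hp : Topology.IsEmbedding p) (hX : Set.range p = lowerPart P g v) :
    ContinuousMap.HomotopyEquiv {x | p x ≠ Pi.single v 1} (geo (restrict P {i | g i < g v})) := by
  have hmem : ∀ x, p x ∈ lowerPart P g v := fun x => hX ▸ ⟨_, rfl⟩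
  have hpos : ∀ x : {x | p x ≠ Pi.single v 1}, 0 < lowerMass g v (p x.1) :=
    fun x => lowerMass_pos hg (hmem _) x.2
  have hpU : Topology.IsEmbedding fun x : {x | p x ≠ Pi.single v 1} => p x.1 := hp.comp .subtypeVal
  have hbelow : ∀ y ∈ geo (restrict P {i | g i < g v}), ∀ i, ¬ g i < g v → y i = 0 := by
    rintro y ⟨-, σ, hσ, hy⟩ i hi
    exact hy i fun h => hi (hσ.2 i h)
  have hrange : ∀ z ∈ lowerPart P g v, 0 < lowerMass g v z →
      z ∈ Set.range fun x : {x | p x ≠ Pi.single v 1} => p x.1 := by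
    intro z hz h
    obtain ⟨x, rfl⟩ := hX ▸ hz
    exact ⟨⟨x, ne_vertex_of_lowerMass_pos h⟩, rfl⟩
  refine homotopyEquivOfSegments hpU .subtypeVal
    ⟨fun x => ⟨toLower g v (p x.1), toLower_mem_stdSimplex (hmem _).1.1 (hpos x), ?_⟩, ?_⟩
    ⟨fun y => hpU.toHomeomorph.symm ⟨y.1, hrange _ ?_ ?_⟩, ?_⟩ (fun x => ?_) (fun y => ?_)
  · obtain ⟨σ, hσ, hx⟩ := (hmem x.1).1.2
    refine ⟨σ.filter fun i => g i < g v, ⟨hP (Finset.filter_subset _ _) hσ, by simp⟩, ?_⟩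
    intro i hi
    by_cases h : i ∈ σ
    · exact toLower_eq_zero_of_le fun h' => hi (Finset.mem_filter.2 ⟨h, h'⟩)
    · exact toLower_eq_zero (hx i h)
  · exact Continuous.subtype_mk (continuousOn_toLower.comp_continuous hpU.continuous hpos) _
  · obtain ⟨h, σ, hσ, hy⟩ := y.2
    exact ⟨⟨h, σ, hσ.1, hy⟩, value_le_of_below h (hbelow y.1 y.2)⟩
  · rw [lowerMass_of_below y.2.1 (hbelow y.1 y.2)]
    exact one_pos
  · exact hpU.toHomeomorph.symm.continuous.comp (Continuous.subtype_mk continuous_subtype_val _)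
  · intro z hz
    have e : ∀ y, p (hpU.toHomeomorph.symm y).1 = y.1 := fun y =>
      congrArg Subtype.val (hpU.toHomeomorph.apply_symm_apply y)
    simp only [ContinuousMap.coe_mk, e] at hz
    obtain ⟨σ, hσ, hx⟩ := (hmem x.1).1.2
    have hL := toLower_mem_stdSimplex (hmem x.1).1.1 (hpos x)
    refine hrange z (segment_subset_lowerPart hσ hL (hmem x.1).1.1
      (fun i hi => toLower_eq_zero (hx i hi)) hx
      (value_le_of_below hL fun i hi => toLower_eq_zero_of_le hi) (hmem x.1).2 hz) ?_
    refine segment_lowerMass_pos ?_ (hpos x) hz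
    rw [lowerMass_of_below hL fun i hi => toLower_eq_zero_of_le hi]
    exact one_pos
  · have e : ∀ y, p (hpU.toHomeomorph.symm y).1 = y.1 := fun y =>
      congrArg Subtype.val (hpU.toHomeomorph.apply_symm_apply y)
    simp only [ContinuousMap.coe_mk, e, toLower_of_below y.2.1 (hbelow y.1 y.2), segment_same,
      Subtype.range_coe, Set.singleton_subset_iff]
    exact y.2

/-- The punctured star of `v` in the lower part retracts to the part of the link below `v`. -/
noncomputable def puncturedStarEquiv (hP : IsLowerSet P) (hg : ∀ i, i ≠ v → g i ≠ g v)
    (hp : Topology.IsEmbedding p) (hX : Set.range p = lowerPart P g v) :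
    ContinuousMap.HomotopyEquiv {y : {x | 0 < p x v} | y.1 ∈ {x | p x ≠ Pi.single v 1}}
      (geo (restrict (link P v) {i | g i < g v})) := by
  have hmem : ∀ x, p x ∈ lowerPart P g v := fun x => hX ▸ ⟨_, rfl⟩
  have hpos : ∀ x : {y : {x | 0 < p x v} | y.1 ∈ {x | p x ≠ Pi.single v 1}},
      0 < lowerMass g v (p x.1.1) := fun x => lowerMass_pos hg (hmem _) x.2
  have hpW : Topology.IsEmbedding
      fun x : {y : {x | 0 < p x v} | y.1 ∈ {x | p x ≠ Pi.single v 1}} => p x.1.1 :=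
    (hp.comp .subtypeVal).comp .subtypeVal
  have hbelow : ∀ y ∈ geo (restrict (link P v) {i | g i < g v}), ∀ i, ¬ g i < g v → y i = 0 := by
    rintro y ⟨-, σ, hσ, hy⟩ i hi
    exact hy i fun h => hi (hσ.2 i h)
  have hrange : ∀ z ∈ lowerPart P g v, 0 < lowerMass g v z → 0 < z v →
      z ∈ Set.range fun x : {y : {x | 0 < p x v} | y.1 ∈ {x | p x ≠ Pi.single v 1}} => p x.1.1 := by
    intro z hz h h'
    obtain ⟨x, rfl⟩ := hX ▸ hz
    exact ⟨⟨⟨x, h'⟩, ne_vertex_of_lowerMass_pos h⟩, rfl⟩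
  -- the midpoint of a point of the link and `v`
  let mid : (ι → ℝ) → ι → ℝ := fun y => (1 - 1 / 2 : ℝ) • y + (1 / 2 : ℝ) • Pi.single v 1
  have hmid : ∀ y ∈ stdSimplex ℝ ι, mid y ∈ stdSimplex ℝ ι := fun y hy =>
    convex_stdSimplex ℝ ι hy (single_mem_stdSimplex ℝ v) (by norm_num) (by norm_num) (by norm_num)
  have hmidv : ∀ y : ι → ℝ, 0 ≤ y v → 0 < mid y v := fun y hy => by
    simp only [mid, Pi.add_apply, Pi.smul_apply, smul_eq_mul, Pi.single_eq_same]
    linarith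
  have hmidM : ∀ y : ι → ℝ, lowerMass g v (mid y) = 1 / 2 * lowerMass g v y := fun y => by
    simp only [mid, lowerMass_lineMap, lowerMass_vertex]
    ring
  have hmidg : ∀ y : ι → ℝ, ∑ i, y i * g i ≤ g v → ∑ i, mid y i * g i ≤ g v := fun y hy => by
    have : ∑ i, mid y i * g i = 1 / 2 * ∑ i, y i * g i + 1 / 2 * g v := by
      simp only [mid, Pi.add_apply, Pi.smul_apply, smul_eq_mul, add_mul, Finset.sum_add_distrib,
        mul_assoc, ← Finset.mul_sum, Pi.single_apply, ite_mul, one_mul, zero_mul,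
        Finset.sum_ite_eq', Finset.mem_univ, if_true]
      norm_num
    linarith
  have hmid0 : ∀ (y : ι → ℝ) (i : ι), i ≠ v → y i = 0 → mid y i = 0 := fun y i hi h => by
    simp [mid, h, Pi.single_eq_of_ne hi]
  have hmidL : ∀ y ∈ stdSimplex ℝ ι, (∀ i, ¬ g i < g v → y i = 0) → toLower g v (mid y) = y := by
    intro y hy h
    funext i
    simp only [toLower, hmidM, lowerMass_of_below hy h]
    split_ifs with hi
    · simp [mid, Pi.single_eq_of_ne (show i ≠ v by rintro rfl; simp at hi)]
      ring
    · exact (h i hi).symm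
  refine homotopyEquivOfSegments hpW .subtypeVal
    ⟨fun x => ⟨toLower g v (p x.1.1), toLower_mem_stdSimplex (hmem _).1.1 (hpos x), ?_⟩, ?_⟩
    ⟨fun y => hpW.toHomeomorph.symm ⟨mid y.1, hrange _ ?_ ?_ (hmidv _ (y.2.1.1 v))⟩, ?_⟩
    (fun x => ?_) (fun y => ?_)
  · obtain ⟨σ, hσ, hx⟩ := (hmem x.1.1).1.2
    have hvσ : v ∈ σ := by_contra fun h => (x.1.2 : 0 < p x.1.1 v).ne' (hx v h)
    refine ⟨σ.filter fun i => g i < g v, ⟨⟨by simp, hP ?_ hσ⟩, by simp⟩, ?_⟩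
    · exact Finset.insert_subset hvσ (Finset.filter_subset _ _)
    intro i hi
    by_cases h : i ∈ σ
    · exact toLower_eq_zero_of_le fun h' => hi (Finset.mem_filter.2 ⟨h, h'⟩)
    · exact toLower_eq_zero (hx i h)
  · exact Continuous.subtype_mk (continuousOn_toLower.comp_continuous hpW.continuous hpos) _
  · obtain ⟨h, σ, hσ, hy⟩ := y.2
    exact ⟨⟨hmid _ h, insert v σ, hσ.1.2, fun i hi => hmid0 _ _ (fun e => hi (by simp [e]))
      (hy i fun h => hi (Finset.mem_insert_of_mem h))⟩,
      hmidg _ (value_le_of_below h (hbelow y.1 y.2))⟩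
  · rw [hmidM, lowerMass_of_below y.2.1 (hbelow y.1 y.2)]
    norm_num
  · refine hpW.toHomeomorph.symm.continuous.comp (Continuous.subtype_mk ?_ _)
    fun_prop
  · intro z hz
    have e : ∀ y, p (hpW.toHomeomorph.symm y).1.1 = y.1 := fun y =>
      congrArg Subtype.val (hpW.toHomeomorph.apply_symm_apply y)
    simp only [ContinuousMap.coe_mk, e] at hz
    obtain ⟨σ, hσ, hx⟩ := (hmem x.1.1).1.2
    have hxv : 0 < p x.1.1 v := x.1.2
    have hvσ : v ∈ σ := by_contra fun h => hxv.ne' (hx v h)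
    have hL := toLower_mem_stdSimplex (hmem x.1.1).1.1 (hpos x)
    have hLv := hmidv _ (hL.1 v)
    refine hrange z (segment_subset_lowerPart hσ (hmid _ hL) (hmem x.1.1).1.1
      (fun i hi => hmid0 _ _ (fun e : _ = v => hi (e ▸ hvσ)) (toLower_eq_zero (hx i hi))) hx
      (hmidg _ (value_le_of_below hL fun i hi => toLower_eq_zero_of_le hi)) (hmem x.1.1).2 hz) ?_ ?_
    · refine segment_lowerMass_pos ?_ (hpos x) hz
      rw [hmidM, lowerMass_of_below hL fun i hi => toLower_eq_zero_of_le hi]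
      norm_num
    · obtain ⟨a, b, ha, hb, hab, rfl⟩ := hz
      simp only [Pi.add_apply, Pi.smul_apply, smul_eq_mul]
      rcases ha.eq_or_lt with rfl | ha
      · rw [zero_add] at hab
        simpa [hab] using hxv
      · positivity
  · have e : ∀ y, p (hpW.toHomeomorph.symm y).1.1 = y.1 := fun y =>
      congrArg Subtype.val (hpW.toHomeomorph.apply_symm_apply y)
    simp only [ContinuousMap.coe_mk, e, hmidL y.1 y.2.1 (hbelow y.1 y.2), segment_same,
      Subtype.range_coe, Set.singleton_subset_iff]
    exact y.2

end cover

end SimplexFamily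

/-! ### Reduced Betti numbers of simplicial complexes -/

namespace SimplexFamily

open SingularChain

set_option linter.unusedSectionVars false

variable (F : Type u) [Field F] {ι : Type} [Fintype ι] [DecidableEq ι]

variable {F} in
/-- The exact sequence for a lower part, with the local homology at the top vertex `v`: this is the
reduced homology, shifted by one degree, of the part of the link of `v` that lies below `v`. -/
theorem exists_ranks_lowerPart {P : Set (Finset ι)} {g : ι → ℝ} {v : ι} {X : Type}
    [TopologicalSpace X] {p : X → ι → ℝ} (hP : IsLowerSet P) (hg : ∀ i, i ≠ v → g i ≠ g v)
    (hp : Topology.IsEmbedding p) (hX : Set.range p = lowerPart P g v) (hv : {v} ∈ P) {a w : ℕ → ℕ}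
    (ha : HasReducedBetti F (geo (restrict P {i | g i < g v})) a)
    (hw : HasReducedBetti F (geo (restrict (link P v) {i | g i < g v})) w) :
    (∀ i, Module.rank F (relativeHomology F X {x | p x ≠ Pi.single v 1} i) = w i) ∧
    ∃ x α β γ : ℕ → ℕ, HasReducedBetti F X x ∧ β 0 = 0 ∧
      ∀ j, a j = α j + γ j ∧ x j = α j + β j ∧ w j = β (j + 1) + γ j := by
  have := contractible_star hp hX hv
  refine exists_ranks_of_cover (V := {x | 0 < p x v}) ?_ ?_ ?_
    (ha.congr (lowerPartEquiv hP hg hp hX).symm) (hw.congr (puncturedStarEquiv hP hg hp hX).symm)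
  · exact isOpen_ne.preimage hp.continuous
  · exact isOpen_lt continuous_const ((continuous_apply v).comp hp.continuous)
  · refine Set.eq_univ_of_forall fun x => ?_
    by_cases h : p x = Pi.single v 1
    · exact Or.inr (by simp [h])
    · exact Or.inl h

/-- The deletion of a vertex. -/
def deletion (P : Set (Finset ι)) (v : ι) : Set (Finset ι) := restrict P {i | i ≠ v}

lemma isLowerSet_deletion {P : Set (Finset ι)} (hP : IsLowerSet P) (v : ι) :
    IsLowerSet (deletion P v) := isLowerSet_restrict hP _

lemma restrict_eq_self {P : Set (Finset ι)} {S : Set ι} (h : ∀ σ ∈ P, ∀ i ∈ σ, i ∈ S) :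
    restrict P S = P := Set.sep_eq_self_iff_mem_true.2 h

lemma restrict_link_ne (P : Set (Finset ι)) (v : ι) : restrict (link P v) {i | i ≠ v} = link P v :=
  restrict_eq_self fun σ hσ i hi => by rintro rfl; exact hσ.1 hi

variable {F} in
/-- The exact sequence for the deletion and the link of a vertex, as the case of a linear function
with its maximum at the vertex. -/
theorem exists_ranks_deletion {P : Set (Finset ι)} (hP : IsLowerSet P) {v : ι} (hv : {v} ∈ P)
    {a w : ℕ → ℕ} (ha : HasReducedBetti F (geo (deletion P v)) a)
    (hw : HasReducedBetti F (geo (link P v)) w) :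
    ∃ x α β γ : ℕ → ℕ, HasReducedBetti F (geo P) x ∧ β 0 = 0 ∧
      ∀ j, a j = α j + γ j ∧ x j = α j + β j ∧ w j = β (j + 1) + γ j := by
  -- the coordinate of `v` has its maximum at `v`, so that everything is in its lower part
  have hlt : {i | (Pi.single v 1 : ι → ℝ) i < (Pi.single v 1 : ι → ℝ) v} = {i | i ≠ v} := by
    ext i
    by_cases h : i = v
    · simp [h]
    · simp [h]
  refine (exists_ranks_lowerPart (g := Pi.single v 1) (v := v) hP (fun i hi => ?_)
    (p := (Subtype.val : geo P → ι → ℝ)) .subtypeVal ?_ hv (a := a) (w := w) ?_ ?_).2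
  · simp [Pi.single_eq_of_ne hi]
  · rw [Subtype.range_coe]
    refine (Set.sep_eq_self_iff_mem_true.2 fun x hx => ?_).symm
    simpa [Pi.single_apply] using (mem_Icc_of_mem_stdSimplex hx.1 v).2
  · rwa [hlt]
  · rwa [hlt, restrict_link_ne]

lemma isEmpty_geo {P : Set (Finset ι)} (hP : IsLowerSet P) (h : ∀ v, {v} ∉ P) :
    IsEmpty (geo P) := by
  refine ⟨fun ⟨x, hx, σ, hσ, hxσ⟩ => ?_⟩
  have h0 : ∀ i, x i = 0 := fun i => hxσ i fun hi => h i (hP (Finset.singleton_subset_iff.2 hi) hσ)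
  have := hx.2
  simp [h0] at this

open Classical in
/-- The reduced Euler characteristic of a family of finite sets (with the sign for which the empty
set counts positively). -/
noncomputable def eulerSum (P : Set (Finset ι)) : ℤ :=
  ∑ σ : Finset ι, if σ ∈ P then (-1) ^ σ.card else 0

/-- A set of the family either avoids `v` or arises from a member of the link by adding `v`. -/
lemma eulerSum_eq (P : Set (Finset ι)) (v : ι) :
    eulerSum P = eulerSum (deletion P v) - eulerSum (link P v) := by
  classical
  have huniv : (Finset.univ : Finset (Finset ι)) = (insert v (Finset.univ.erase v)).powerset := by
    rw [Finset.insert_erase (Finset.mem_univ v), Finset.powerset_univ]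
  have hv : v ∉ Finset.univ.erase v := by simp
  have hins : ∀ t ∈ (Finset.univ.erase v).powerset, v ∉ t := fun t ht h =>
    hv (Finset.mem_powerset.1 ht h)
  have hd : ∀ t : Finset ι, t ∈ deletion P v ↔ t ∈ P ∧ v ∉ t := fun t =>
    and_congr_right fun _ => ⟨fun h hv => h v hv rfl, fun h i hi => by rintro rfl; exact h hi⟩
  simp only [eulerSum]
  rw [huniv, Finset.sum_powerset_insert hv, Finset.sum_powerset_insert hv,
    Finset.sum_powerset_insert hv]
  have h1 : ∀ t ∈ (Finset.univ.erase v).powerset,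
      (if insert v t ∈ deletion P v then (-1 : ℤ) ^ (insert v t).card else 0) = 0 := fun t _ =>
    if_neg fun h => ((hd _).1 h).2 (Finset.mem_insert_self v t)
  have h2 : ∀ t ∈ (Finset.univ.erase v).powerset,
      (if insert v t ∈ link P v then (-1 : ℤ) ^ (insert v t).card else 0) = 0 := fun t _ =>
    if_neg fun h => h.1 (Finset.mem_insert_self v t)
  rw [Finset.sum_eq_zero h1, Finset.sum_eq_zero h2, add_zero, add_zero, sub_eq_add_neg,
    ← Finset.sum_neg_distrib]
  congr 1
  · refine Finset.sum_congr rfl fun t ht => if_congr ?_ rfl rfl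
    rw [hd]
    exact (and_iff_left (hins t ht)).symm
  · refine Finset.sum_congr rfl fun t ht => ?_
    have : t ∈ link P v ↔ insert v t ∈ P := and_iff_right (hins t ht)
    rw [Finset.card_insert_of_notMem (hins t ht), pow_succ, mul_neg_one]
    simp only [this]
    split_ifs <;> simp

/-- The alternating sum of ranks along a long exact sequence. -/
lemma alternating_sum_telescope {α β γ : ℕ → ℤ} (hβ : β 0 = 0) (N : ℕ) :
    ∑ j ∈ Finset.range N, (-1) ^ j * (α j + β j) =
      ∑ j ∈ Finset.range N, (-1) ^ j * (α j + γ j) -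
        ∑ j ∈ Finset.range N, (-1) ^ j * (β (j + 1) + γ j) - (-1) ^ N * β N := by
  induction N with
  | zero => simp [hβ]
  | succ N ih =>
    rw [Finset.sum_range_succ, Finset.sum_range_succ, Finset.sum_range_succ, ih]
    ring

/-- Finiteness of the Betti numbers, vanishing above the dimension and the Euler-Poincaré formula,
by induction on the number of vertices. -/
theorem exists_hasReducedBetti {P : Set (Finset ι)} (hP : IsLowerSet P) (h0 : ∅ ∈ P) :
    ∃ b, HasReducedBetti F (geo P) b ∧
      (∀ D, (∀ σ ∈ P, σ.card ≤ D) → ∀ j, D < j → b j = 0) ∧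
      ∑ j ∈ Finset.range (Fintype.card ι + 1), (-1) ^ j * (b j : ℤ) = eulerSum P := by
  classical
  induction hn : (Finset.univ.filter fun v => {v} ∈ P).card using Nat.strong_induction_on
    generalizing P with
  | _ n ih =>
    by_cases hv : ∃ v, {v} ∈ P
    · obtain ⟨v, hv⟩ := hv
      have hsub1 : ∀ w, {w} ∈ deletion P v → {w} ∈ P ∧ w ≠ v := fun w hw =>
        ⟨hw.1, hw.2 w (by simp)⟩
      have hsub2 : ∀ w, {w} ∈ link P v → {w} ∈ P ∧ w ≠ v := fun w hw =>
        ⟨hP (by simp) hw.2, fun h => hw.1 (by simp [h])⟩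
      have hcard : ∀ Q : Set (Finset ι), (∀ w, {w} ∈ Q → {w} ∈ P ∧ w ≠ v) →
          (Finset.univ.filter fun w => {w} ∈ Q).card < n := by
        intro Q hQ
        rw [← hn]
        refine Finset.card_lt_card ((Finset.ssubset_iff_of_subset fun w hw => ?_).2 ⟨v, ?_, ?_⟩)
        · simp only [Finset.mem_filter, Finset.mem_univ, true_and] at hw ⊢
          exact (hQ w hw).1
        · simpa using hv
        · simp only [Finset.mem_filter, Finset.mem_univ, true_and]
          exact fun h => (hQ v h).2 rfl
      obtain ⟨a, ha, haD, haE⟩ := ih _ (hcard _ hsub1) (isLowerSet_deletion hP v)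
        ⟨h0, by simp⟩ rfl
      obtain ⟨w, hw, hwD, hwE⟩ := ih _ (hcard _ hsub2) (isLowerSet_link hP v)
        ⟨by simp, by simpa using hv⟩ rfl
      obtain ⟨x, α, β, γ, hx, hβ, h⟩ := exists_ranks_deletion hP hv ha hw
      have hxD : ∀ D, (∀ σ ∈ P, σ.card ≤ D) → ∀ j, D < j → x j = 0 := by
        intro D hD j hj
        have hD1 : 1 ≤ D := by simpa using hD _ hv
        have h1 := haD D (fun σ hσ => hD σ hσ.1) j hj
        have h2 := hwD (D - 1) (fun σ hσ => by
          have := hD _ hσ.2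
          rw [Finset.card_insert_of_notMem hσ.1] at this
          omega) (j - 1) (by omega)
        have h3 := h j
        have h4 := (h (j - 1)).2.2
        rw [Nat.sub_add_cancel (by omega)] at h4
        omega
      refine ⟨x, hx, hxD, ?_⟩
      have hN : β (Fintype.card ι + 1) = 0 := by
        have h1 : x (Fintype.card ι + 1) = 0 :=
          hxD (Fintype.card ι) (fun σ _ => Finset.card_le_univ σ) _ (Nat.lt_succ_self _)
        have h2 := (h (Fintype.card ι + 1)).2.1
        omega
      rw [eulerSum_eq P v, ← haE, ← hwE]
      have key := alternating_sum_telescope (α := fun j => α j) (β := fun j => β j)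
        (γ := fun j => γ j) (by simp [hβ]) (Fintype.card ι + 1)
      simp only [hN, Nat.cast_zero, mul_zero, sub_zero] at key
      simpa only [(h _).1, (h _).2.1, (h _).2.2, Nat.cast_add] using key
    · push Not at hv
      have := isEmpty_geo hP hv
      have hP' : ∀ σ ∈ P, σ = ∅ := fun σ hσ => by
        by_contra hne
        obtain ⟨i, hi⟩ := Finset.nonempty_iff_ne_empty.2 hne
        exact hv i (hP (Finset.singleton_subset_iff.2 hi) hσ)
      refine ⟨_, HasReducedBetti.of_isEmpty, fun D _ j hj => if_neg (by omega), ?_⟩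
      rw [eulerSum, Finset.sum_eq_single ∅ (fun σ _ hσ => if_neg fun h => hσ (hP' σ h)) (by simp)]
      simp [h0]

open Classical in
/-- The reduced Betti numbers of a complex, shifted by one (see `HasReducedBetti`). -/
noncomputable def rb (P : Set (Finset ι)) : ℕ → ℕ :=
  if h : ∃ b, HasReducedBetti F (geo P) b then h.choose else 0

section rb

variable {P : Set (Finset ι)} (hP : IsLowerSet P) (h0 : ∅ ∈ P)

include hP h0

lemma hasReducedBetti_rb : HasReducedBetti F (geo P) (rb F P) := by
  have h : ∃ b, HasReducedBetti F (geo P) b := (exists_hasReducedBetti F hP h0).imp fun _ h => h.1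
  rw [rb, dif_pos h]
  exact h.choose_spec

lemma rb_eq_zero_of_lt {D j : ℕ} (hD : ∀ σ ∈ P, σ.card ≤ D) (hj : D < j) : rb F P j = 0 := by
  obtain ⟨b, hb, h, -⟩ := exists_hasReducedBetti F hP h0
  rw [(hasReducedBetti_rb F hP h0).unique hb]
  exact h D hD j hj

/-- The Euler-Poincaré formula. -/
lemma sum_rb_eq_eulerSum :
    ∑ j ∈ Finset.range (Fintype.card ι + 1), (-1) ^ j * (rb F P j : ℤ) = eulerSum P := by
  obtain ⟨b, hb, -, h⟩ := exists_hasReducedBetti F hP h0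
  rwa [(hasReducedBetti_rb F hP h0).unique hb]

/-- The numerical form of the exact sequence for the deletion and the link of a vertex. -/
theorem exists_ranks_rb {v : ι} (hv : {v} ∈ P) : ∃ α β γ : ℕ → ℕ, β 0 = 0 ∧
    ∀ j, rb F (deletion P v) j = α j + γ j ∧ rb F P j = α j + β j ∧
      rb F (link P v) j = β (j + 1) + γ j := by
  obtain ⟨x, α, β, γ, hx, hβ, h⟩ := exists_ranks_deletion hP hv
    (hasReducedBetti_rb F (isLowerSet_deletion hP v) ⟨h0, by simp⟩)
    (hasReducedBetti_rb F (isLowerSet_link hP v) ⟨by simp, by simpa using hv⟩)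
  rw [(hasReducedBetti_rb F hP h0).unique hx]
  exact ⟨α, β, γ, hβ, h⟩

end rb

/-- A family transported along a permutation of the vertices. -/
def relabel (e : Equiv.Perm ι) (P : Set (Finset ι)) : Set (Finset ι) := {σ | σ.image e ∈ P}

lemma isLowerSet_relabel {P : Set (Finset ι)} (hP : IsLowerSet P) (e : Equiv.Perm ι) :
    IsLowerSet (relabel e P) := fun _ _ h hσ => hP (Finset.image_subset_image h) hσ

lemma stdSimplex_comp_perm {x : ι → ℝ} (hx : x ∈ stdSimplex ℝ ι) (e : Equiv.Perm ι) :
    x ∘ e ∈ stdSimplex ℝ ι :=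
  ⟨fun _ => hx.1 _, (Equiv.sum_comp e x).trans hx.2⟩

lemma comp_perm_mem_geo {P : Set (Finset ι)} (e : Equiv.Perm ι) {x : ι → ℝ} (hx : x ∈ geo P) :
    x ∘ e ∈ geo (relabel e P) := by
  obtain ⟨hx, σ, hσ, h⟩ := hx
  refine ⟨stdSimplex_comp_perm hx e, σ.image e.symm, ?_, fun _ hi => h _ fun h' => hi ?_⟩
  · simpa [relabel, Finset.image_image] using hσ
  · exact Finset.mem_image.2 ⟨_, h', by simp⟩

lemma relabel_symm_relabel (e : Equiv.Perm ι) (P : Set (Finset ι)) :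
    relabel e.symm (relabel e P) = P := by
  ext σ
  simp [relabel, Finset.image_image]

lemma rb_relabel {P : Set (Finset ι)} (hP : IsLowerSet P) (h0 : ∅ ∈ P) (e : Equiv.Perm ι) :
    rb F (relabel e P) = rb F P := by
  let E : ContinuousMap.HomotopyEquiv (geo P) (geo (relabel e P)) := Homeomorph.toHomotopyEquiv
    { toFun := fun x => ⟨x.1 ∘ e, comp_perm_mem_geo e x.2⟩
      invFun := fun y => ⟨y.1 ∘ e.symm, by
        have := comp_perm_mem_geo e.symm y.2
        rwa [relabel_symm_relabel] at this⟩
      left_inv := fun x => Subtype.ext (by ext; simp)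
      right_inv := fun y => Subtype.ext (by ext; simp)
      continuous_toFun := by
        refine Continuous.subtype_mk (continuous_pi fun i => ?_) _
        exact (continuous_apply (e i)).comp continuous_subtype_val
      continuous_invFun := by
        refine Continuous.subtype_mk (continuous_pi fun i => ?_) _
        exact (continuous_apply (e.symm i)).comp continuous_subtype_val }
  exact (hasReducedBetti_rb F (isLowerSet_relabel hP e) (by simpa [relabel] using h0)).unique
    ((hasReducedBetti_rb F hP h0).congr E)

end SimplexFamily

/-! ### Numerical consequences of the exact sequence -/

namespace SimplexFamily

set_option linter.unusedSectionVars false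

variable (F : Type u) [Field F] {ι : Type} [Fintype ι] [DecidableEq ι] {P : Set (Finset ι)}

section

variable (hP : IsLowerSet P) (h0 : ∅ ∈ P)
include hP h0

lemma rb_zero_of_vertex {v : ι} (hv : {v} ∈ P) : rb F P 0 = 0 := by
  rw [(hasReducedBetti_rb F hP h0).zero, if_neg]
  exact not_isEmpty_iff.2 ⟨⟨Pi.single v 1, single_mem_stdSimplex ℝ v, {v}, hv, fun i hi =>
    Pi.single_eq_of_ne (by simpa using hi) 1⟩⟩

lemma rb_of_no_vertex (h : ∀ v, {v} ∉ P) : rb F P = Pi.single 0 1 := by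
  have := isEmpty_geo hP h
  rw [(hasReducedBetti_rb F hP h0).unique SingularChain.HasReducedBetti.of_isEmpty]
  funext j
  simp [Pi.single_apply]

/-- A complex is acyclic if the deletion and the link of a vertex are. -/
lemma rb_eq_zero_of_deletion_of_link {v : ι} (hv : {v} ∈ P) (hd : rb F (deletion P v) = 0)
    (hl : rb F (link P v) = 0) : rb F P = 0 := by
  obtain ⟨α, β, γ, hβ, h⟩ := exists_ranks_rb F hP h0 hv
  funext j
  have h1 := h j
  rw [hd, Pi.zero_apply] at h1
  rw [h1.2.1]
  cases j with
  | zero => simp only [Pi.zero_apply]; omega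
  | succ j =>
    have h2 := (h j).2.2
    rw [hl, Pi.zero_apply] at h2
    simp only [Pi.zero_apply]
    omega

/-- The numerical content of a homology sphere: if the deletion of a vertex is acyclic then the
Betti numbers are those of the link, shifted by one. -/
lemma rb_eq_single_of_deletion_of_link {v : ι} (hv : {v} ∈ P) (hd : rb F (deletion P v) = 0) {n : ℕ}
    (hl : rb F (link P v) = Pi.single n 1) : rb F P = Pi.single (n + 1) 1 := by
  obtain ⟨α, β, γ, hβ, h⟩ := exists_ranks_rb F hP h0 hv
  have h1 : ∀ j, α j = 0 ∧ γ j = 0 := fun j => by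
    have := (h j).1
    rw [hd, Pi.zero_apply] at this
    omega
  funext j
  rw [(h j).2.1, (h1 j).1, zero_add]
  cases j with
  | zero => simp [hβ]
  | succ j =>
    have h2 := (h j).2.2
    rw [hl, (h1 j).2, add_zero] at h2
    rw [← h2]
    simp [Pi.single_apply]

lemma rb_of_unique_vertex {v : ι} (hv : {v} ∈ P) (h : ∀ w, {w} ∈ P → w = v) : rb F P = 0 := by
  obtain ⟨α, β, γ, hβ, hr⟩ := exists_ranks_rb F hP h0 hv
  have hd := rb_of_no_vertex F (isLowerSet_deletion hP v) ⟨h0, by simp⟩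
    (fun w hw => hw.2 w (by simp) (h w hw.1))
  have hl := rb_of_no_vertex F (isLowerSet_link hP v) ⟨by simp, by simpa using hv⟩
    (fun w hw => hw.1 (by simp [h w (hP (by simp) hw.2)]))
  have h00 := rb_zero_of_vertex F hP h0 hv
  have e : ∀ j, (Pi.single 0 1 : ℕ → ℕ) j = if j = 0 then 1 else 0 := fun j => by
    simp [Pi.single_apply]
  simp only [hd, hl, e] at hr
  funext j
  rw [Pi.zero_apply]
  match j with
  | 0 => exact h00
  | 1 =>
    obtain ⟨h1, h2, h3⟩ := hr 0
    obtain ⟨h4, h5, -⟩ := hr 1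
    rw [if_pos rfl] at h1 h3
    rw [if_neg one_ne_zero] at h4
    rw [zero_add] at h3
    omega
  | j + 2 =>
    obtain ⟨-, -, h3⟩ := hr (j + 1)
    obtain ⟨h4, h5, -⟩ := hr (j + 2)
    rw [if_neg (by omega)] at h3 h4
    rw [show j + 1 + 1 = j + 2 from rfl] at h3
    omega

lemma rb_succ_le {v : ι} (hv : {v} ∈ P) (j : ℕ) :
    rb F P (j + 1) ≤ rb F (deletion P v) (j + 1) + rb F (link P v) j := by
  obtain ⟨α, β, γ, hβ, h⟩ := exists_ranks_rb F hP h0 hv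
  have h1 := h (j + 1)
  have h2 := h j
  omega

lemma rb_deletion_le {v : ι} (hv : {v} ∈ P) (j : ℕ) :
    rb F (deletion P v) j ≤ rb F P j + rb F (link P v) j := by
  obtain ⟨α, β, γ, hβ, h⟩ := exists_ranks_rb F hP h0 hv
  have h1 := h j
  omega

end

lemma mem_restrict_singleton {S : Set ι} {v : ι} : {v} ∈ restrict P S ↔ {v} ∈ P ∧ v ∈ S := by
  simp [restrict]

lemma deletion_restrict_insert {S : Finset ι} {v : ι} (hv : v ∉ S) :
    deletion (restrict P ↑(insert v S)) v = restrict P (S : Set ι) := by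
  ext σ
  constructor
  · rintro ⟨⟨h, h1⟩, h2⟩
    refine ⟨h, fun i hi => ?_⟩
    have := h1 i hi
    rw [Finset.mem_coe, Finset.mem_insert] at this
    exact this.resolve_left (h2 i hi)
  · rintro ⟨h, h1⟩
    refine ⟨⟨h, fun i hi => by simpa using Or.inr (h1 i hi)⟩, fun i hi => ?_⟩
    rintro rfl
    exact hv (h1 i hi)

lemma link_restrict_insert (S : Finset ι) (v : ι) :
    link (restrict P ↑(insert v S)) v = restrict (link P v) (S : Set ι) := by
  rw [link_restrict P (by simp)]
  ext σ
  refine and_congr_right fun hσ => forall₂_congr fun i hi => ?_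
  have : i ≠ v := by rintro rfl; exact hσ.1 hi
  simp [this]

lemma restrict_insert_of_notMem (hP : IsLowerSet P) {S : Finset ι} {v : ι} (hv : {v} ∉ P) :
    restrict P ↑(insert v S) = restrict P (S : Set ι) := by
  ext σ
  refine and_congr_right fun hσ => forall₂_congr fun i hi => ?_
  have : i ≠ v := by
    rintro rfl
    exact hv (hP (Finset.singleton_subset_iff.2 hi) hσ)
  simp [this]

/-- If the homology of the restricted links vanishes in some degree, then the homology in this
degree of the restricted complexes grows with the set of vertices, up to the deletion of `w`. -/
lemma rb_restrict_le_deletion (hP : IsLowerSet P) (h0 : ∅ ∈ P) (w : ι) (j : ℕ)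
    (h : ∀ u, u ≠ w → {u} ∈ P → ∀ S : Finset ι, u ∉ S → w ∉ S → rb F (restrict (link P u) S) j = 0)
    (S : Finset ι) (hS : w ∉ S) : rb F (restrict P S) j ≤ rb F (deletion P w) j := by
  have key : ∀ T : Finset ι, w ∉ T → rb F (restrict P S) j ≤ rb F (restrict P ↑(T ∪ S)) j := by
    intro T
    induction T using Finset.induction_on with
    | empty => simp
    | insert u T _ ih =>
      intro hw
      rw [Finset.mem_insert, not_or] at hw
      refine (ih hw.2).trans ?_
      rw [Finset.insert_union]
      by_cases hu : u ∈ T ∪ S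
      · rw [Finset.insert_eq_of_mem hu]
      by_cases huP : {u} ∈ P
      · have hle := rb_deletion_le F (P := restrict P ↑(insert u (T ∪ S))) (v := u)
          (isLowerSet_restrict hP _) ⟨h0, by simp⟩ (mem_restrict_singleton.2 ⟨huP, by simp⟩) j
        rwa [deletion_restrict_insert hu, link_restrict_insert,
          h u (Ne.symm hw.1) huP (T ∪ S) hu (by simp [hw.2, hS]), add_zero] at hle
      · rw [restrict_insert_of_notMem hP huP]
  have := key (Finset.univ.erase w) (by simp)
  have hU : ((Finset.univ.erase w ∪ S : Finset ι) : Set ι) = {i | i ≠ w} := by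
    ext i
    simp only [Finset.coe_union, Finset.coe_erase, Finset.coe_univ, Set.mem_union, Set.mem_sdiff,
      Set.mem_univ, true_and, Set.mem_singleton_iff, Finset.mem_coe, Set.mem_ofPred_eq]
    exact ⟨fun h => h.elim id fun h hi => hS (hi ▸ h), Or.inl⟩
  rwa [hU] at this

lemma relabel_deletion (e : Equiv.Perm ι) (v : ι) :
    relabel e (deletion P (e v)) = deletion (relabel e P) v := by
  ext σ
  simp [relabel, deletion, restrict]

lemma relabel_link (e : Equiv.Perm ι) (v : ι) :
    relabel e (link P (e v)) = link (relabel e P) v := by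
  ext σ
  simp [relabel, link, Finset.image_insert]

end SimplexFamily

/-! ### Complexes encoded as natural numbers -/

namespace BitMask

open SimplexFamily

/-- The binary code of a set of vertices. -/
def code (σ : Finset (Fin 16)) : ℕ := ∑ i ∈ σ, 2 ^ (i : ℕ)

/-- A natural number represents a family of subsets of `{0, …, 15}` if its nonzero binary digits
are at the codes of the members. All operations on families become operations on numbers, which
makes large computations possible. -/
def Represents (B : ℕ) (Q : Set (Finset (Fin 16))) : Prop :=
  ∀ k, B.testBit k = true ↔ ∃ τ ∈ Q, k = code τ

lemma code_injective : Function.Injective code := by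
  intro σ τ h
  have := Finset.geomSum_injective (n := 2) le_rfl
    (a₁ := σ.map Fin.valEmbedding) (a₂ := τ.map Fin.valEmbedding) (by simpa [code] using h)
  exact Finset.map_injective _ this

lemma code_insert {σ : Finset (Fin 16)} {v : Fin 16} (h : v ∉ σ) :
    code (insert v σ) = code σ + 2 ^ (v : ℕ) := by
  rw [code, Finset.sum_insert h, add_comm, code]

lemma code_singleton (v : Fin 16) : code {v} = 2 ^ (v : ℕ) := by simp [code]

lemma Represents.testBit_code {B : ℕ} {Q : Set (Finset (Fin 16))} (h : Represents B Q)
    (σ : Finset (Fin 16)) : B.testBit (code σ) = true ↔ σ ∈ Q := by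
  rw [h]
  exact ⟨fun ⟨τ, hτ, e⟩ => code_injective e ▸ hτ, fun hσ => ⟨σ, hσ, rfl⟩⟩

lemma Represents.eq {B : ℕ} {Q Q' : Set (Finset (Fin 16))} (h : Represents B Q)
    (h' : Represents B Q') : Q = Q' := by
  ext σ
  rw [← h.testBit_code, h'.testBit_code]

lemma Represents.congr {B : ℕ} {Q Q' : Set (Finset (Fin 16))} (h : Represents B Q)
    (e : ∀ σ, σ ∈ Q' ↔ σ ∈ Q) : Represents B Q' := Set.ext e ▸ h

lemma represents_one : Represents 1 {∅} := by
  intro k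
  simp [code, Nat.testBit_one_eq_true_iff_self_eq_zero]

lemma represents_zero : Represents 0 ∅ := by
  intro k
  simp

lemma Represents.lor {B B' : ℕ} {Q Q' : Set (Finset (Fin 16))} (h : Represents B Q)
    (h' : Represents B' Q') : Represents (Nat.lor B B') (Q ∪ Q') := by
  intro k
  have : Nat.lor B B' = B ||| B' := rfl
  rw [this, Nat.testBit_or, Bool.or_eq_true, h, h']
  simp only [Set.mem_union, or_and_right, exists_or]

lemma Represents.land {B B' : ℕ} {Q Q' : Set (Finset (Fin 16))} (h : Represents B Q)
    (h' : Represents B' Q') : Represents (Nat.land B B') (Q ∩ Q') := by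
  intro k
  have : Nat.land B B' = B &&& B' := rfl
  rw [this, Nat.testBit_and, Bool.and_eq_true, h, h']
  constructor
  · rintro ⟨⟨τ, hτ, rfl⟩, ⟨τ', hτ', e⟩⟩
    exact ⟨τ, ⟨hτ, code_injective e ▸ hτ'⟩, rfl⟩
  · rintro ⟨τ, ⟨h1, h2⟩, rfl⟩
    exact ⟨⟨τ, h1, rfl⟩, τ, h2, rfl⟩

/-- The cone with apex `v`. -/
def addVertex (v B : ℕ) : ℕ := Nat.lor B (Nat.shiftLeft B (2 ^ v))

/-- Adding `v` to a set adds `2 ^ v` to its code, which is a shift of the binary digits. -/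
lemma Represents.addVertex {B : ℕ} {Q : Set (Finset (Fin 16))} (h : Represents B Q) {v : Fin 16}
    (hv : ∀ σ ∈ Q, v ∉ σ) : Represents (addVertex v B) (Q ∪ insert v '' Q) := by
  refine h.lor fun k => ?_
  have : Nat.shiftLeft B (2 ^ (v : ℕ)) = B <<< (2 ^ (v : ℕ)) := rfl
  rw [this, Nat.testBit_shiftLeft, Bool.and_eq_true, decide_eq_true_eq, h]
  constructor
  · rintro ⟨hk, τ, hτ, e⟩
    exact ⟨_, ⟨τ, hτ, rfl⟩, by rw [code_insert (hv τ hτ)]; omega⟩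
  · rintro ⟨_, ⟨τ, hτ, rfl⟩, rfl⟩
    rw [code_insert (hv τ hτ)]
    exact ⟨by omega, τ, hτ, by omega⟩

/-- The full simplex on the vertices with numbers less than `n` that satisfy `p`. -/
def simplex (p : ℕ → Bool) : ℕ → ℕ
  | 0 => 1
  | n + 1 => bif p n then addVertex n (simplex p n) else simplex p n

lemma represents_simplex (p : ℕ → Bool) (n : ℕ) (hn : n ≤ 16) :
    Represents (simplex p n) {σ | ∀ i ∈ σ, (i : ℕ) < n ∧ p i = true} := by
  induction n with
  | zero =>
    have : {σ : Finset (Fin 16) | ∀ i ∈ σ, (i : ℕ) < 0 ∧ p i = true} = {∅} := by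
      ext σ
      simp [Finset.eq_empty_iff_forall_notMem]
    rw [this]
    exact represents_one
  | succ n ih =>
    have ih := ih (by omega)
    rw [simplex]
    cases hp : p n with
    | false =>
      refine ih.congr fun σ => forall₂_congr fun i _ => and_congr_left fun hi => ?_
      have : (i : ℕ) ≠ n := fun e => by simp [e, hp] at hi
      omega
    | true =>
      have key := ih.addVertex (v := ⟨n, by omega⟩) fun σ hσ h => (hσ _ h).1.ne rfl
      refine key.congr fun σ => ?_
      constructor
      · intro h
        by_cases hσ : (⟨n, by omega⟩ : Fin 16) ∈ σ
        · refine Or.inr ⟨σ.erase ⟨n, by omega⟩, fun i hi => ?_, Finset.insert_erase hσ⟩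
          have h1 := h i (Finset.mem_of_mem_erase hi)
          have h2 : (i : ℕ) ≠ n := fun e => Finset.ne_of_mem_erase hi (Fin.ext e)
          exact ⟨by omega, h1.2⟩
        · refine Or.inl fun i hi => ?_
          have h2 : (i : ℕ) ≠ n := fun e => hσ (by
            have : i = ⟨n, by omega⟩ := Fin.ext e
            rwa [← this])
          exact ⟨by have := (h i hi).1; omega, (h i hi).2⟩
      · rintro (h | ⟨τ, h, rfl⟩) i hi
        · exact ⟨(h i hi).1.trans (Nat.lt_succ_self n), (h i hi).2⟩
        · rcases Finset.mem_insert.1 hi with rfl | hi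
          · exact ⟨Nat.lt_succ_self n, hp⟩
          · exact ⟨(h i hi).1.trans (Nat.lt_succ_self n), (h i hi).2⟩

/-- The number that represents the family of all sets without the element `v`. -/
def without (v : ℕ) : ℕ := simplex (fun i => !Nat.beq i v) 16

lemma represents_without (v : Fin 16) : Represents (without v) {σ | v ∉ σ} := by
  refine (represents_simplex (fun i => !Nat.beq i v) 16 le_rfl).congr fun σ => ?_
  constructor
  · intro h i hi
    refine ⟨i.2, ?_⟩
    have : (i : ℕ) ≠ v := fun e => h (Fin.ext e ▸ hi)
    simp [← Bool.not_eq_true, this]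
  · intro h hv
    simpa using (h v hv).2

/-- The deletion of the vertex `v`. -/
def del (v B : ℕ) : ℕ := Nat.land B (without v)

/-- The link of the vertex `v`. -/
def lk (v B : ℕ) : ℕ := Nat.land (Nat.shiftRight B (2 ^ v)) (without v)

variable {B : ℕ} {Q : Set (Finset (Fin 16))}

lemma Represents.del (h : Represents B Q) (v : Fin 16) : Represents (del v B) (deletion Q v) := by
  refine (h.land (represents_without v)).congr fun σ => ?_
  exact and_congr_right fun _ => ⟨fun h hv => h v hv rfl, fun h i hi => by rintro rfl; exact h hi⟩

lemma Represents.lk (h : Represents B Q) (v : Fin 16) : Represents (lk v B) (link Q v) := by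
  intro k
  have e : BitMask.lk v B = (B >>> (2 ^ (v : ℕ))) &&& without v := rfl
  rw [e, Nat.testBit_and, Bool.and_eq_true, Nat.testBit_shiftRight, h, represents_without v]
  constructor
  · rintro ⟨⟨τ, hτ, h1⟩, ρ, hρ, rfl⟩
    rw [add_comm, ← code_insert hρ] at h1
    exact ⟨ρ, ⟨hρ, code_injective h1 ▸ hτ⟩, rfl⟩
  · rintro ⟨τ, ⟨hv, hτ⟩, rfl⟩
    exact ⟨⟨_, hτ, by rw [code_insert hv, add_comm]⟩, τ, hv, rfl⟩

lemma Represents.singleton_mem (h : Represents B Q) (v : Fin 16) :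
    {v} ∈ Q ↔ B.testBit (2 ^ (v : ℕ)) = true := by
  rw [← h.testBit_code, code_singleton]

/-- Whether a list of vertices certifies that all the given complexes are nonevasive: the first
vertex is either the whole first complex, or its link and its deletion are to be treated next. A
nonevasive complex is one that is reduced to points by passing to deletions and links of vertices. -/
def nonevasive : List ℕ → List ℕ → Bool
  | _, [] => true
  | [], _ :: _ => false
  | v :: c, B :: l => bif Nat.beq B (addVertex v 1) then nonevasive c l else
      Nat.blt v 16 && (B.testBit (2 ^ v) && nonevasive c (lk v B :: del v B :: l))

/-- The Euler sum of a complex with vertices less than `n`. -/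
def euler : ℕ → ℕ → ℤ
  | 0, _ => 1
  | n + 1, B => bif B.testBit (2 ^ n) then euler n (del n B) - euler n (lk n B) else euler n B

variable (F : Type u) [Field F]

/-- Nonevasive complexes are acyclic. -/
theorem rb_of_nonevasive (c l : List ℕ) (h : nonevasive c l = true) {B : ℕ} (hl : B ∈ l)
    {Q : Set (Finset (Fin 16))} (hQ : IsLowerSet Q) (h0 : ∅ ∈ Q) (hB : Represents B Q) :
    rb F Q = 0 := by
  induction c generalizing l B Q with
  | nil =>
    cases l with
    | nil => simp at hl
    | cons => simp [nonevasive] at h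
  | cons v c ih =>
    cases l with
    | nil => simp at hl
    | cons B' l =>
      rw [nonevasive, Bool.cond_eq_ite] at h
      split_ifs at h with hb
      · rcases List.mem_cons.1 hl with rfl | hl
        · -- a number that represents a family has no digits beyond the code of the whole vertex set
          have hv : v < 16 := by
            by_contra hv
            rw [Nat.beq_eq] at hb
            have h1 : B.testBit (2 ^ v) = true := by
              have : addVertex v 1 = 1 ||| 1 <<< 2 ^ v := rfl
              rw [hb, this]
              simp
            obtain ⟨τ, -, e⟩ := (hB _).1 h1
            have h2 : code τ < 2 ^ 16 := by
              refine lt_of_le_of_lt (b := code Finset.univ) ?_ (by decide)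
              exact Finset.sum_le_sum_of_subset (Finset.subset_univ τ)
            have h3 : 2 ^ 16 ≤ 2 ^ v := Nat.pow_le_pow_right (by norm_num) (by omega)
            omega
          lift v to Fin 16 using hv
          rw [Nat.beq_eq] at hb
          subst hb
          obtain rfl := hB.eq (represents_one.addVertex (v := v) (by simp))
          exact rb_of_unique_vertex F (v := v) hQ h0 (by simp) (by simp)
        · exact ih l h hl hQ h0 hB
      · rw [Bool.and_eq_true, Bool.and_eq_true, Nat.blt_eq] at h
        obtain ⟨hv, h1, h2⟩ := h
        lift v to Fin 16 using hv
        rcases List.mem_cons.1 hl with rfl | hl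
        · have hv := (hB.singleton_mem v).2 h1
          exact rb_eq_zero_of_deletion_of_link F (v := v) hQ h0 hv
            (ih _ h2 (B := del v B) (by simp) (isLowerSet_deletion hQ v) ⟨h0, by simp⟩ (hB.del v))
            (ih _ h2 (B := lk v B) (by simp) (isLowerSet_link hQ v) ⟨by simp, by simpa using hv⟩
              (hB.lk v))
        · exact ih _ h2 (by simp [hl]) hQ h0 hB

/-- The vertices are removed in decreasing order, see `eulerSum_eq`. -/
theorem eulerSum_eq_euler (n : ℕ) (hn : n ≤ 16) (hQ : IsLowerSet Q) (h0 : ∅ ∈ Q)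
    (hB : Represents B Q) (h : ∀ v : Fin 16, {v} ∈ Q → (v : ℕ) < n) : eulerSum Q = euler n B := by
  induction n generalizing B Q with
  | zero =>
    have : Q = {∅} := by
      ext σ
      refine ⟨fun hσ => ?_, fun hσ => hσ ▸ h0⟩
      by_contra hne
      obtain ⟨i, hi⟩ := Finset.nonempty_iff_ne_empty.2 hne
      exact absurd (h i (hQ (Finset.singleton_subset_iff.2 hi) hσ)) (by omega)
    subst this
    simp [eulerSum, euler]
  | succ n ih =>
    have hs := hB.singleton_mem ⟨n, by omega⟩
    have hlt : ∀ v : Fin 16, (v : ℕ) < n + 1 → v ≠ ⟨n, by omega⟩ → (v : ℕ) < n := fun v hv hne => by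
      have : (v : ℕ) ≠ n := fun e => hne (Fin.ext e)
      omega
    rw [euler]
    cases hb : B.testBit (2 ^ n) with
    | false =>
      refine ih (by omega) hQ h0 hB fun v hv => hlt v (h v hv) ?_
      rintro rfl
      simp [hb, hv] at hs
    | true =>
      rw [eulerSum_eq Q ⟨n, by omega⟩, cond_true]
      congr 1
      · exact ih (by omega) (isLowerSet_deletion hQ _) ⟨h0, by simp⟩ (hB.del ⟨n, by omega⟩)
          fun v hv => hlt v (h v hv.1) (hv.2 v (by simp))
      · refine ih (by omega) (isLowerSet_link hQ _) ⟨by simp, ?_⟩ (hB.lk ⟨n, by omega⟩)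
          fun v hv => hlt v (h v (hQ (by simp) hv.2)) fun e => hv.1 (by simp [e])
        simpa using hs.2 hb

end BitMask

/-! ### The facets of the K3 surface -/

namespace K3

open SimplexFamily BitMask

/-- The facets of `(K3)₁₆` as bit masks. The list runs through the orbits of `genA`, and the
first element of every orbit is one of the two base simplices or the image of an earlier element
under `genB`. -/
def facetMasks : List ℕ := [
  2183, 8364, 2504, 37160, 49488, 53762, 24595, 10758, 10401, 2156, 4576, 36952, 21264, 33299,
  25093, 8339, 10764, 2465, 32876, 20928, 36890, 25360, 35331, 24613, 2246, 12456, 2392, 37664,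
  49233, 20998, 7696, 1585, 1605, 5253, 1180, 1928, 34057, 50436, 50306, 25610, 11522, 44064,
  19552, 5218, 13392, 2354, 41568, 22593, 4150, 8912, 6665, 309, 33476, 20617, 286, 41856, 51209,
  16678, 41154, 30728, 20880, 33306, 25345, 34823, 24740, 2250, 12584, 35152, 53792, 16467,
  12806, 10385, 2604, 481, 36940, 16677, 32966, 28808, 2330, 41760, 51265, 20518, 8402, 14856,
  2353, 33380, 20673, 4126, 9104, 35337, 16585, 4366, 41360, 51720, 16675, 41030, 30848, 2106,
  9056, 38977, 20532, 722, 12809, 2325, 33444, 8717, 2437, 32940, 16840, 37130, 57616, 51714,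
  24611, 10310, 14496, 2168, 4960, 36945, 21012, 659, 1610, 13569, 35860, 18080, 1099, 13572,
  35984, 17960, 1347, 46084, 19600, 1578, 9537, 39940, 17584, 14850, 10289, 2660, 4321, 4188,
  5008, 33305, 17157, 32903, 24716, 2442, 41256, 51520, 53282, 24658, 5170, 9808, 7681, 1077,
  1732, 5257, 1308, 34688, 50185, 17670, 42114, 27656, 3362, 42080, 23616, 6560, 32888, 21312,
  36883, 25108, 2691, 8237, 2500, 37032, 16728, 37634, 57361, 18950, 8355, 10316, 16564, 714,
  12553, 35092, 49824, 16459, 12550, 43152, 18984, 355, 45124, 22672, 570, 9025, 38917, 453,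
  37004, 16792, 33546, 57601, 51206, 24738, 10314, 14624, 34928, 21088, 4179, 12820, 2705, 557,
  24652, 6530, 41016, 19264, 36899, 24660, 6786, 8249, 2884, 37025, 16476, 4994, 40985, 19204,
  32931, 9793, 7173, 1204, 1736, 5385, 34068, 50816, 17419, 9478, 44160, 19496, 1378, 46144,
  23568, 1586, 11274, 11552, 35936, 21600, 5202, 13840, 3601, 1573, 1221, 5260, 1432, 34568,
  50433, 50182, 25730, 1618, 13825, 3093, 1700, 1225, 5388, 34192, 50696, 17667, 41990, 27776,
  3114, 9568, 40000, 21552, 14594, 43056, 19040, 4195, 12372, 6800, 569, 837, 36997, 16540, 906,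
  41225, 51460, 49314, 24650, 310, 41664, 22537]

/-- The values of `genA`. -/
def tableA : List ℕ := [2, 13, 7, 8, 9, 6, 12, 3, 15, 0, 10, 5, 4, 11, 1, 14]

/-- The values of `genB`. -/
def tableB : List ℕ := [10, 9, 11, 8, 6, 5, 7, 4, 14, 13, 15, 12, 2, 1, 3, 0]

/-- The image of a set of vertices under a map given by a table. -/
def imageMask (t : List ℕ) (m : ℕ) : ℕ :=
  (List.range 16).foldl (fun s i => if m.testBit i then s ||| 2 ^ t.getD i 0 else s) 0

end K3

namespace K3

open SimplexFamily BitMask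

lemma genA_apply : ∀ i : Fin 16, (genA i : ℕ) = tableA.getD i 0 := by decide +kernel
lemma genB_apply : ∀ i : Fin 16, (genB i : ℕ) = tableB.getD i 0 := by decide +kernel

/-- Whether every member of a list is one of the base simplices or the image of an earlier member
under a generator. -/
def generated : List ℕ → List ℕ → Bool
  | _, [] => true
  | acc, m :: rest => (m == 2183 || m == 8339 ||
      acc.any fun a => imageMask tableA a == m || imageMask tableB a == m) && generated (m :: acc) rest

lemma generated_facetMasks : generated [] facetMasks = true := by decide +kernel

lemma closed_facetMasks : (facetMasks.all fun m => facetMasks.contains (imageMask tableA m) &&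
    facetMasks.contains (imageMask tableB m)) = true := by decide +kernel

/-- The number that represents the complex with given facets. -/
def ofFacets (l : List ℕ) : ℕ :=
  l.foldl (fun B m => Nat.lor B (simplex (fun i => m.testBit i) 16)) 0

/-- The number that represents the complex `(K3)₁₆`, together with the empty set. -/
def bits : ℕ := ofFacets facetMasks

/-- A certificate for the deletion of `0` from the link of `10`. -/
def linkCertificate : List ℕ :=
  [1, 3, 6, 9, 9, 5, 5, 11, 11, 13, 13, 14, 14, 5, 9, 4, 4, 12, 11, 8, 8, 6, 6, 12, 12, 4, 9, 6,
  6, 12, 12, 9, 6, 11, 8, 13, 13, 12, 6, 6, 8, 8, 13, 2, 2, 14, 14, 2, 13, 15, 14, 15, 15, 13,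
  14, 7, 7, 15, 15, 7, 14, 15, 15, 14, 15, 15, 3, 5, 9, 14, 11, 14, 14, 6, 7, 9, 9, 7, 9, 8, 8,
  4, 4, 2, 2, 12, 12, 2, 4, 8, 8, 12, 12, 4, 8, 9, 8, 15, 14, 15, 15, 11, 13, 14, 14, 12, 8, 8,
  15, 13, 14, 14, 15, 15, 6, 2, 7, 9, 9, 4, 9, 13, 12, 13, 13, 5, 8, 13, 12, 14, 13, 15, 14, 11,
  11, 15, 15, 7, 9, 8, 13, 9, 13, 11, 14, 12, 12, 15, 15, 13, 12, 15, 15, 14, 12, 12, 15, 15, 8,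
  4, 2, 15, 7, 15, 15, 5, 11, 13, 13, 7, 9, 15, 15, 9, 15, 11, 13, 12, 2, 13, 13, 13, 2, 2, 14,
  15, 15, 14, 15, 15, 9, 2, 5, 7, 7, 7, 5, 14, 14, 15, 15, 11, 4, 12, 12, 12, 4, 13, 13, 13, 4,
  4, 5, 5, 14, 14, 15, 15, 5, 2, 4, 7, 7, 4, 7, 14, 12, 14, 14, 7, 14, 12, 14, 13, 11, 15, 15,
  14, 11, 11, 15, 15, 13, 2, 12, 15, 15, 4, 12, 7, 14, 11, 11, 15, 15, 12, 15, 14, 11, 11, 15,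
  15, 12, 4, 11, 14, 14, 7, 2, 2, 11, 15, 15, 14, 11, 11, 15, 15, 2, 7, 4, 4, 11, 15, 15, 11,
  15, 14, 15, 15, 4, 7, 14, 11, 11, 15, 15, 14, 11, 11, 15, 15, 11, 14, 7, 7, 15, 15, 7, 14, 15,
  15, 14, 15, 15]

lemma nonevasive_link : nonevasive linkCertificate [del 0 (lk 10 bits)] = true := by
  decide +kernel

lemma euler_bits : euler 16 bits = -23 := by decide +kernel

/-- A certificate for the deletions of single vertices from the link of the edge `{10, 0}`. -/
def edgeCertificate : List ℕ :=
  [3, 6, 7, 7, 12, 12, 8, 8, 15, 14, 15, 15, 6, 7, 2, 2, 9, 8, 13, 9, 13, 13, 2, 7, 12, 9, 5, 5,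
  4, 4, 11, 11, 12, 12, 4, 5, 9, 9, 11, 11, 5, 9, 7, 12, 9, 11, 12, 12, 13, 13, 11, 12, 12, 8,
  13, 13, 13, 8, 8, 14, 15, 15, 14, 15, 15, 4, 5, 9, 9, 11, 11, 5, 9, 6, 7, 3, 3, 1, 1, 8, 8,
  13, 9, 13, 13, 1, 3, 14, 8, 14, 14, 3, 7, 12, 12, 8, 8, 15, 14, 15, 15, 7, 12, 9, 11, 12, 12,
  13, 13, 11, 12, 12, 8, 13, 13, 13, 8, 8, 14, 15, 15, 14, 15, 15, 1, 6, 8, 8, 14, 14, 6, 7, 2,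
  2, 9, 8, 13, 9, 13, 13, 2, 7, 12, 9, 5, 5, 4, 4, 11, 11, 12, 12, 4, 5, 9, 9, 11, 11, 5, 9, 7,
  12, 9, 11, 12, 12, 13, 13, 11, 12, 12, 8, 13, 13, 13, 8, 8, 14, 15, 15, 14, 15, 15, 2, 5, 9,
  9, 6, 6, 7, 7, 12, 11, 12, 12, 5, 9, 6, 7, 3, 3, 1, 1, 8, 8, 13, 9, 13, 13, 1, 3, 14, 8, 14,
  14, 3, 7, 12, 12, 8, 8, 15, 14, 15, 15, 7, 12, 9, 11, 12, 12, 13, 13, 11, 12, 12, 8, 13, 13,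
  13, 8, 8, 14, 15, 15, 14, 15, 15, 2, 4, 11, 9, 6, 6, 7, 7, 12, 11, 12, 12, 4, 9, 11, 11, 6, 7,
  3, 3, 1, 1, 8, 8, 13, 9, 13, 13, 1, 3, 14, 8, 14, 14, 3, 7, 12, 12, 8, 8, 15, 14, 15, 15, 7,
  12, 9, 11, 12, 12, 13, 13, 11, 12, 12, 8, 13, 13, 13, 8, 8, 14, 15, 15, 14, 15, 15, 1, 3, 14,
  8, 14, 14, 2, 7, 12, 9, 5, 5, 4, 4, 11, 11, 12, 12, 3, 7, 12, 12, 8, 8, 15, 14, 15, 15, 4, 5,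
  9, 9, 11, 11, 5, 9, 7, 12, 9, 11, 12, 12, 13, 13, 11, 12, 12, 8, 13, 13, 13, 8, 8, 14, 15, 15,
  14, 15, 15, 2, 6, 9, 9, 5, 5, 4, 4, 11, 11, 12, 12, 3, 6, 1, 1, 14, 12, 8, 8, 15, 14, 15, 15,
  1, 6, 8, 8, 14, 14, 4, 5, 9, 9, 11, 11, 5, 9, 6, 8, 13, 9, 13, 13, 9, 11, 12, 12, 13, 13, 11,
  12, 12, 8, 13, 13, 13, 8, 8, 14, 15, 15, 14, 15, 15, 1, 6, 3, 3, 14, 14, 6, 3, 7, 7, 2, 2, 9,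
  9, 13, 13, 2, 7, 12, 9, 5, 5, 4, 4, 11, 11, 12, 12, 4, 5, 9, 9, 11, 11, 5, 9, 7, 3, 12, 12, 9,
  11, 12, 12, 13, 13, 11, 12, 13, 12, 12, 3, 3, 14, 15, 15, 14, 15, 15, 2, 5, 4, 4, 11, 6, 7, 7,
  12, 11, 12, 12, 5, 4, 4, 11, 6, 7, 3, 3, 1, 1, 8, 8, 13, 13, 1, 3, 14, 8, 14, 14, 3, 7, 12,
  12, 8, 8, 15, 14, 15, 15, 7, 12, 11, 12, 12, 8, 13, 13, 13, 8, 8, 14, 15, 15, 14, 15, 15, 2,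
  4, 5, 5, 9, 9, 6, 6, 7, 7, 12, 12, 4, 5, 9, 9, 5, 9, 6, 7, 3, 3, 1, 1, 8, 8, 13, 9, 13, 13, 1,
  3, 14, 8, 14, 14, 3, 7, 12, 12, 8, 8, 15, 14, 15, 15, 7, 12, 9, 12, 13, 13, 12, 8, 13, 13, 13,
  8, 8, 14, 15, 15, 14, 15, 15, 2, 7, 6, 6, 9, 9, 5, 5, 4, 4, 11, 11, 3, 7, 6, 6, 1, 1, 14, 8,
  15, 14, 15, 15, 1, 6, 8, 8, 14, 14, 4, 5, 9, 9, 11, 11, 5, 9, 7, 6, 6, 8, 13, 9, 13, 13, 11,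
  9, 9, 13, 13, 8, 8, 14, 15, 15, 14, 15, 15, 6, 8, 1, 1, 3, 3, 7, 7, 2, 2, 9, 9, 1, 3, 14, 8,
  14, 14, 2, 7, 12, 9, 5, 5, 4, 4, 11, 11, 12, 12, 3, 7, 12, 12, 8, 8, 15, 14, 15, 15, 4, 5, 9,
  9, 11, 11, 5, 9, 7, 12, 9, 11, 12, 12, 11, 12, 12, 8, 8, 14, 15, 15, 14, 15, 15, 1, 3, 6, 6,
  8, 8, 3, 6, 7, 7, 12, 12, 8, 8, 15, 15, 6, 7, 2, 2, 9, 8, 13, 9, 13, 13, 2, 7, 12, 9, 5, 5, 4,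
  4, 11, 11, 12, 12, 4, 5, 9, 9, 11, 11, 5, 9, 7, 12, 9, 11, 12, 12, 13, 13, 11, 12, 12, 8, 13,
  13, 13, 8, 8, 15, 15, 3, 8, 12, 12, 7, 7, 6, 6, 1, 1, 14, 14, 1, 6, 8, 8, 14, 14, 6, 7, 2, 2,
  9, 8, 13, 9, 13, 13, 2, 7, 12, 9, 5, 5, 4, 4, 11, 11, 12, 12, 4, 5, 9, 9, 11, 11, 5, 9, 7, 12,
  9, 11, 12, 12, 13, 13, 11, 12, 12, 8, 13, 13, 13, 8, 8, 14, 14]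

lemma nonevasive_edge : nonevasive edgeCertificate
    ([1, 2, 3, 4, 5, 6, 7, 8, 9, 11, 12, 13, 14, 15].map fun u => del u (lk 0 (lk 10 bits))) =
      true := by
  decide +kernel

lemma neighborly_bits : ([1, 2, 3, 4, 5, 6, 7, 8, 9, 11, 12, 13, 14, 15].all fun u =>
    (lk 0 (lk 10 bits)).testBit (2 ^ u)) = true := by decide +kernel

/-- A certificate for two simplicial arcs in the links of `{10, 0, 1}` and `{10, 0, 1, 3}`. -/
def arcCertificate : List ℕ := [6, 8, 8, 14, 14, 14]

lemma nonevasive_arc : nonevasive arcCertificate [del 3 (lk 1 (lk 0 (lk 10 bits))),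
    del 6 (lk 3 (lk 1 (lk 0 (lk 10 bits))))] = true := by decide +kernel

lemma link_bits : (lk 0 (lk 10 bits)).testBit (2 ^ 1) = true ∧
    (lk 1 (lk 0 (lk 10 bits))).testBit (2 ^ 3) = true ∧
    (lk 3 (lk 1 (lk 0 (lk 10 bits)))).testBit (2 ^ 6) = true ∧
    lk 6 (lk 3 (lk 1 (lk 0 (lk 10 bits)))) = 1 := by decide +kernel

end K3

/-! ### The complex `(K3)₁₆` and its encoding -/

namespace K3

open SimplexFamily BitMask

/-- The simplices of `(K3)₁₆`, including the empty one. -/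
def faces : Set (Finset (Fin 16)) := {σ | ∃ φ ∈ facets, σ ⊆ φ}

/-- The set of vertices encoded by a bit mask. -/
def ofMask (m : ℕ) : Finset (Fin 16) := {i | m.testBit i = true}

lemma mem_ofMask {m : ℕ} {i : Fin 16} : i ∈ ofMask m ↔ m.testBit i = true := by simp [ofMask]

lemma testBit_imageMask (t : List ℕ) (m j : ℕ) : (imageMask t m).testBit j = true ↔
    ∃ i < 16, m.testBit i = true ∧ t.getD i 0 = j := by
  have key : ∀ (l : List ℕ) (s : ℕ),
      (l.foldl (fun s i => if m.testBit i then s ||| 2 ^ t.getD i 0 else s) s).testBit j = true ↔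
        s.testBit j = true ∨ ∃ i ∈ l, m.testBit i = true ∧ t.getD i 0 = j := by
    intro l
    induction l with
    | nil => simp
    | cons a l ih =>
      intro s
      rw [List.foldl_cons, ih]
      by_cases ha : m.testBit a = true
      · rw [if_pos ha, Nat.testBit_or, Bool.or_eq_true, Nat.testBit_two_pow, decide_eq_true_eq]
        simp only [List.mem_cons, exists_eq_or_imp, ha, true_and, or_assoc]
      · simp [ha]
  rw [imageMask, key]
  simp

lemma ofMask_imageMask {t : List ℕ} {g : Equiv.Perm (Fin 16)}
    (h : ∀ i : Fin 16, (g i : ℕ) = t.getD i 0) (m : ℕ) :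
    ofMask (imageMask t m) = (ofMask m).image g := by
  ext j
  rw [mem_ofMask, testBit_imageMask, Finset.mem_image]
  constructor
  · rintro ⟨i, hi, hm, e⟩
    exact ⟨⟨i, hi⟩, mem_ofMask.2 hm, Fin.ext ((h ⟨i, hi⟩).trans e)⟩
  · rintro ⟨i, hi, rfl⟩
    exact ⟨i, i.2, mem_ofMask.1 hi, (h i).symm⟩

lemma ofMask_base₁ : ofMask 2183 = {0, 1, 2, 7, 11} := by decide +kernel
lemma ofMask_base₂ : ofMask 8339 = {0, 1, 4, 7, 13} := by decide +kernel

lemma genA_mem : genA ∈ symmetryGroup := Subgroup.subset_closure (by simp)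
lemma genB_mem : genB ∈ symmetryGroup := Subgroup.subset_closure (by simp)

lemma image_mem_facets {g : Equiv.Perm (Fin 16)} (hg : g ∈ symmetryGroup) {φ : Finset (Fin 16)}
    (hφ : φ ∈ facets) : φ.image g ∈ facets := by
  obtain ⟨h, hh, e⟩ := hφ
  refine ⟨g * h, mul_mem hg hh, ?_⟩
  rcases e with rfl | rfl
  · exact Or.inl (by rw [Finset.image_image]; rfl)
  · exact Or.inr (by rw [Finset.image_image]; rfl)

lemma ofMask_mem_facets_of_generated (acc l : List ℕ) (hacc : ∀ a ∈ acc, ofMask a ∈ facets)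
    (h : generated acc l = true) : ∀ m ∈ l, ofMask m ∈ facets := by
  induction l generalizing acc with
  | nil => simp
  | cons m l ih =>
    rw [generated, Bool.and_eq_true, Bool.or_eq_true, Bool.or_eq_true] at h
    obtain ⟨h1, h2⟩ := h
    have hm : ofMask m ∈ facets := by
      rcases h1 with (h1 | h1) | h1
      · rw [beq_iff_eq] at h1
        exact ⟨1, one_mem _, Or.inl (by rw [h1, ofMask_base₁]; simp)⟩
      · rw [beq_iff_eq] at h1
        exact ⟨1, one_mem _, Or.inr (by rw [h1, ofMask_base₂]; simp)⟩
      · obtain ⟨a, ha, h1⟩ := List.any_eq_true.1 h1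
        rw [Bool.or_eq_true, beq_iff_eq, beq_iff_eq] at h1
        rcases h1 with rfl | rfl
        · rw [ofMask_imageMask genA_apply]
          exact image_mem_facets genA_mem (hacc a ha)
        · rw [ofMask_imageMask genB_apply]
          exact image_mem_facets genB_mem (hacc a ha)
    rintro k (_ | ⟨_, hk⟩)
    · exact hm
    · exact ih (m :: acc) (fun a ha => (List.mem_cons.1 ha).elim (fun e => e ▸ hm) (hacc a)) h2 k hk

/-- The list `facetMasks` is closed under the generators, hence under the finite group that they
generate as a monoid, and all of its elements arise from the base simplices. -/
lemma mem_facets_iff {φ : Finset (Fin 16)} : φ ∈ facets ↔ ∃ m ∈ facetMasks, φ = ofMask m := by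
  constructor
  · have key : ∀ g ∈ symmetryGroup, ∀ m ∈ facetMasks, ∃ m' ∈ facetMasks,
        (ofMask m).image g = ofMask m' := by
      intro g hg
      replace hg : g ∈ Submonoid.closure {genA, genB} := by
        rwa [← Subgroup.closure_toSubmonoid_of_finite]
      have hc := List.all_eq_true.1 closed_facetMasks
      induction hg using Submonoid.closure_induction with
      | mem g hg =>
        intro m hm
        have h := hc m hm
        rw [Bool.and_eq_true, List.contains_iff_mem, List.contains_iff_mem] at h
        rcases hg with rfl | rfl
        · exact ⟨_, h.1, (ofMask_imageMask genA_apply m).symm⟩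
        · exact ⟨_, h.2, (ofMask_imageMask genB_apply m).symm⟩
      | one => exact fun m hm => ⟨m, hm, by simp⟩
      | mul g h _ _ ihg ihh =>
        intro m hm
        obtain ⟨m', hm', e⟩ := ihh m hm
        obtain ⟨n, hn, e'⟩ := ihg m' hm'
        exact ⟨n, hn, by rw [← e', ← e, Finset.image_image]; rfl⟩
    rintro ⟨g, hg, rfl | rfl⟩
    · rw [← ofMask_base₁]
      exact key g hg _ (by decide)
    · rw [← ofMask_base₂]
      exact key g hg _ (by decide +kernel)
  · rintro ⟨m, hm, rfl⟩
    exact ofMask_mem_facets_of_generated [] _ (by simp) generated_facetMasks m hm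

lemma represents_ofFacets (l : List ℕ) :
    Represents (ofFacets l) {σ | ∃ m ∈ l, σ ⊆ ofMask m} := by
  have key : ∀ (l : List ℕ) (B : ℕ) (Q : Set (Finset (Fin 16))), Represents B Q →
      Represents (l.foldl (fun B m => Nat.lor B (simplex (fun i => m.testBit i) 16)) B)
        {σ | σ ∈ Q ∨ ∃ m ∈ l, σ ⊆ ofMask m} := by
    intro l
    induction l with
    | nil => exact fun B Q h => h.congr (by simp)
    | cons m l ih =>
      intro B Q h
      refine (ih _ _ (h.lor (represents_simplex (fun i => m.testBit i) 16 le_rfl))).congr fun σ => ?_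
      have : σ ⊆ ofMask m ↔ ∀ i ∈ σ, (i : ℕ) < 16 ∧ m.testBit i = true := by
        simp [Finset.subset_iff, mem_ofMask]
      simp only [Set.mem_ofPred_eq, List.mem_cons, exists_eq_or_imp, Set.mem_union, this, or_assoc]
  exact (key l 0 ∅ represents_zero).congr (by simp)

lemma represents_bits : Represents bits faces :=
  (represents_ofFacets facetMasks).congr fun σ => by simp [faces, mem_facets_iff]

lemma isLowerSet_faces : IsLowerSet faces := fun _ _ h ⟨φ, hφ, hs⟩ => ⟨φ, hφ, h.trans hs⟩

lemma empty_mem_faces : ∅ ∈ faces := (exists_facet 0).imp fun _ h => ⟨h.1, Finset.empty_subset _⟩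

/-- The empty simplex does not contribute to the realization. -/
lemma geo_faces : geo faces = complex.realization := by
  ext x
  refine and_congr_right fun hx => ⟨?_, ?_⟩
  · rintro ⟨σ, hσ, h⟩
    refine ⟨σ, ⟨?_, hσ⟩, h⟩
    rw [Finset.nonempty_iff_ne_empty]
    rintro rfl
    have := hx.2
    simp [h] at this
  · rintro ⟨σ, hσ, h⟩
    exact ⟨σ, hσ.2, h⟩

lemma card_le_of_mem_faces {σ : Finset (Fin 16)} (hσ : σ ∈ faces) : σ.card ≤ 5 := by
  obtain ⟨φ, ⟨g, -, rfl | rfl⟩, hs⟩ := hσ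
  · exact (Finset.card_le_card hs).trans (Finset.card_image_le.trans (by decide))
  · exact (Finset.card_le_card hs).trans (Finset.card_image_le.trans (by decide))

/-! ### The symmetry group is doubly transitive -/

lemma relabel_faces {g : Equiv.Perm (Fin 16)} (hg : g ∈ symmetryGroup) :
    relabel g faces = faces := by
  ext σ
  constructor
  · rintro ⟨φ, hφ, hs⟩
    refine ⟨_, image_mem_facets (inv_mem hg) hφ, ?_⟩
    simpa [Finset.image_image] using Finset.image_subset_image (f := (g⁻¹ : Equiv.Perm (Fin 16))) hs
  · rintro ⟨φ, hφ, hs⟩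
    exact ⟨_, image_mem_facets hg hφ, Finset.image_subset_image hs⟩

/-- `genA` fixes `10` and permutes the other vertices cyclically, and `genB` moves `10`. -/
lemma exists_mem_symmetryGroup {v w : Fin 16} (h : v ≠ w) :
    ∃ g ∈ symmetryGroup, g 10 = v ∧ g 0 = w := by
  have h1 : ∀ v : Fin 16, v ≠ 10 → ∃ k : Fin 15, (genA ^ k.1) 15 = v := by decide +kernel
  have h2 : ∀ w : Fin 16, w ≠ 10 → ∃ k : Fin 15, (genA ^ k.1) 0 = w ∧ (genA ^ k.1) 10 = 10 := by
    decide +kernel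
  have h3 : genB 10 = 15 := by decide +kernel
  obtain ⟨a, ha, rfl⟩ : ∃ a ∈ symmetryGroup, a 10 = v := by
    by_cases hv : v = 10
    · exact ⟨1, one_mem _, hv.symm⟩
    · obtain ⟨k, rfl⟩ := h1 v hv
      exact ⟨_, mul_mem (pow_mem genA_mem k.1) genB_mem, by rw [Equiv.Perm.mul_apply, h3]⟩
  obtain ⟨k, hk, hk'⟩ := h2 (a⁻¹ w) fun e => h (by rw [← e]; simp)
  exact ⟨_, mul_mem ha (pow_mem genA_mem k.1), by rw [Equiv.Perm.mul_apply, hk'],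
    by rw [Equiv.Perm.mul_apply, hk]; simp⟩

lemma relabel_link_faces {g : Equiv.Perm (Fin 16)} (hg : g ∈ symmetryGroup) (v : Fin 16) :
    relabel g (link faces (g v)) = link faces v := by
  rw [relabel_link, relabel_faces hg]

lemma isLowerSet_link_faces (v : Fin 16) : IsLowerSet (link faces v) :=
  isLowerSet_link isLowerSet_faces v

lemma isLowerSet_link_link_faces (v w : Fin 16) : IsLowerSet (link (link faces v) w) :=
  isLowerSet_link (isLowerSet_link_faces v) w

lemma mem_range_of_ne : ∀ u : Fin 16, u ≠ 10 → u ≠ 0 →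
    (u : ℕ) ∈ [1, 2, 3, 4, 5, 6, 7, 8, 9, 11, 12, 13, 14, 15] := by decide

/-- `(K3)₁₆` is 3-neighborly. -/
lemma mem_faces_of_card_le {σ : Finset (Fin 16)} (hσ : σ.card ≤ 3) : σ ∈ faces := by
  obtain ⟨τ, hs, hτ⟩ := Finset.exists_superset_card_eq hσ (by simp)
  refine isLowerSet_faces hs ?_
  obtain ⟨v, w, u, hvw, hvu, hwu, rfl⟩ := Finset.card_eq_three.1 hτ
  obtain ⟨g, hg, rfl, rfl⟩ := exists_mem_symmetryGroup hvw
  obtain ⟨u, rfl⟩ := g.surjective u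
  have h10 : u ≠ 10 := fun e => hvu (by rw [e])
  have h0 : u ≠ 0 := fun e => hwu (by rw [e])
  have hu := mem_range_of_ne u h10 h0
  have h := List.all_eq_true.1 neighborly_bits u hu
  have := (((represents_bits.lk 10).lk 0).singleton_mem u).2 h
  have h2 : insert 10 (insert 0 {u}) ∈ relabel g faces := by
    rw [relabel_faces hg]
    exact this.2.2
  simpa [relabel, Finset.image_insert] using h2

lemma empty_mem_link_faces (v : Fin 16) : ∅ ∈ link faces v :=
  ⟨by simp, mem_faces_of_card_le (by simp)⟩

lemma singleton_mem_link_faces {v w : Fin 16} (h : v ≠ w) : {w} ∈ link faces v :=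
  ⟨by simpa using h, mem_faces_of_card_le (Finset.card_le_two.trans (by norm_num))⟩

lemma singleton_mem_link_link_faces {v w u : Fin 16} (h : v ≠ w) (h' : v ≠ u) (h'' : w ≠ u) :
    {u} ∈ link (link faces v) w :=
  ⟨by simpa using h'', by simp [h, h'], mem_faces_of_card_le Finset.card_le_three⟩

lemma empty_mem_link_link_faces {v w : Fin 16} (h : v ≠ w) : ∅ ∈ link (link faces v) w :=
  ⟨by simp, by simpa using singleton_mem_link_faces h⟩

variable (F : Type u) [Field F]

/-- The link of a vertex minus a vertex is acyclic, like a ball. -/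
lemma rb_deletion_link {v w : Fin 16} (h : v ≠ w) : rb F (deletion (link faces v) w) = 0 := by
  obtain ⟨g, hg, rfl, rfl⟩ := exists_mem_symmetryGroup h
  rw [← rb_relabel F (isLowerSet_deletion (isLowerSet_link_faces _) _)
    ⟨empty_mem_link_faces _, by simp⟩ g, relabel_deletion, relabel_link_faces hg]
  exact rb_of_nonevasive F _ _ nonevasive_link (by simp)
    (isLowerSet_deletion (isLowerSet_link_faces _) _) ⟨empty_mem_link_faces _, by simp⟩
    ((represents_bits.lk 10).del 0)

/-- The link of an edge minus a vertex is acyclic, like a disk. -/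
lemma rb_deletion_link_link {v w u : Fin 16} (h : v ≠ w) (h' : v ≠ u) (h'' : w ≠ u) :
    rb F (deletion (link (link faces v) w) u) = 0 := by
  obtain ⟨g, hg, rfl, rfl⟩ := exists_mem_symmetryGroup h
  obtain ⟨u, rfl⟩ := g.surjective u
  have h10 : u ≠ 10 := fun e => h' (by rw [e])
  have h0 : u ≠ 0 := fun e => h'' (by rw [e])
  have hu := mem_range_of_ne u h10 h0
  rw [← rb_relabel F (isLowerSet_deletion (isLowerSet_link_link_faces _ _) _)
    ⟨empty_mem_link_link_faces h, by simp⟩ g, relabel_deletion, relabel_link,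
    relabel_link_faces hg]
  exact rb_of_nonevasive F _ _ nonevasive_edge (List.mem_map_of_mem hu)
    (isLowerSet_deletion (isLowerSet_link_link_faces _ _) _)
    ⟨empty_mem_link_link_faces (by decide), by simp⟩ (((represents_bits.lk 10).lk 0).del u)

/-- The links of edges have the homology of the 2-sphere. -/
lemma rb_link_link {v w : Fin 16} (h : v ≠ w) :
    rb F (link (link faces v) w) = Pi.single 3 1 := by
  obtain ⟨g, hg, rfl, rfl⟩ := exists_mem_symmetryGroup h
  rw [← rb_relabel F (isLowerSet_link_link_faces _ _) (empty_mem_link_link_faces h) g,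
    relabel_link, relabel_link_faces hg]
  have r2 := (represents_bits.lk 10).lk 0
  have r1 := r2.lk 1
  have r0 := r1.lk 3
  obtain ⟨b2, b1, b0, e⟩ := link_bits
  have v2 := (r2.singleton_mem 1).2 b2
  have v1 := (r1.singleton_mem 3).2 b1
  have v0 := (r0.singleton_mem 6).2 b0
  have l2 := isLowerSet_link_link_faces 10 0
  have l1 := isLowerSet_link l2 1
  have l0 := isLowerSet_link l1 3
  have z2 : ∅ ∈ link (link faces 10) 0 := empty_mem_link_link_faces (by decide)
  have z1 : ∅ ∈ link (link (link faces 10) 0) 1 := ⟨by simp, by simpa using v2⟩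
  have z0 : ∅ ∈ link (link (link (link faces 10) 0) 1) 3 := ⟨by simp, by simpa using v1⟩
  have hl : link (link (link (link (link faces 10) 0) 1) 3) 6 = {∅} :=
    (r0.lk 6).eq ((congrArg (Represents · {∅}) e).mpr represents_one)
  have s := rb_of_no_vertex F (P := ({∅} : Set (Finset (Fin 16)))) (fun σ τ h hσ => by
    rw [Set.mem_singleton_iff] at hσ ⊢
    subst hσ
    exact Finset.subset_empty.1 h) rfl (by simp)
  have s0 := rb_eq_single_of_deletion_of_link F l0 z0 v0 (rb_of_nonevasive F _ _ nonevasive_arc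
    (by simp) (isLowerSet_deletion l0 _) ⟨z0, by simp⟩ (r0.del 6)) (hl ▸ s)
  have s1 := rb_eq_single_of_deletion_of_link F l1 z1 v1 (rb_of_nonevasive F _ _ nonevasive_arc
    (by simp) (isLowerSet_deletion l1 _) ⟨z1, by simp⟩ (r1.del 3)) s0
  exact rb_eq_single_of_deletion_of_link F l2 z2 v2
    (rb_deletion_link_link F (by decide) (by decide) (by decide)) s1

/-- The links of vertices have the homology of the 3-sphere. -/
lemma rb_link (v : Fin 16) : rb F (link faces v) = Pi.single 4 1 := by
  obtain ⟨w, h⟩ := exists_ne v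
  exact rb_eq_single_of_deletion_of_link F (isLowerSet_link_faces v) (empty_mem_link_faces v)
    (singleton_mem_link_faces h.symm) (rb_deletion_link F h.symm) (rb_link_link F h.symm)

lemma eulerSum_faces : eulerSum faces = -23 :=
  (eulerSum_eq_euler 16 le_rfl isLowerSet_faces empty_mem_faces represents_bits
    fun v _ => v.2).trans euler_bits

end K3

namespace SimplexFamily

variable {ι : Type} [Fintype ι] [DecidableEq ι] {P : Set (Finset ι)} (F : Type u) [Field F]

/-- If the neighbouring terms of the exact sequence vanish, the reduced Betti number is the sum of
those of the deletion and of the link. -/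
lemma rb_succ_eq (hP : IsLowerSet P) (h0 : ∅ ∈ P) {v : ι} (hv : {v} ∈ P) {j : ℕ}
    (hd : rb F (deletion P v) j = 0) (hl : rb F (link P v) (j + 1) = 0) :
    rb F P (j + 1) = rb F (deletion P v) (j + 1) + rb F (link P v) j := by
  obtain ⟨α, β, γ, hβ, h⟩ := exists_ranks_rb F hP h0 hv
  have h1 := h (j + 1)
  have h2 := h j
  omega

lemma rb_restrict_insert_le (hP : IsLowerSet P) (h0 : ∅ ∈ P) {v : ι} (hv : {v} ∈ P) {S : Finset ι}
    (hS : v ∉ S) (j : ℕ) : rb F (restrict P ↑(insert v S)) (j + 1) ≤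
      rb F (restrict P S) (j + 1) + rb F (restrict (link P v) S) j := by
  have := rb_succ_le F (isLowerSet_restrict hP ↑(insert v S)) ⟨h0, by simp⟩
    (mem_restrict_singleton.2 ⟨hv, by simp⟩) j
  rwa [deletion_restrict_insert hS, link_restrict_insert] at this

lemma rb_restrict_insert_eq (hP : IsLowerSet P) (h0 : ∅ ∈ P) {v : ι} (hv : {v} ∈ P) {S : Finset ι}
    (hS : v ∉ S) {j : ℕ} (hd : rb F (restrict P S) j = 0)
    (hl : rb F (restrict (link P v) S) (j + 1) = 0) : rb F (restrict P ↑(insert v S)) (j + 1) =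
      rb F (restrict P S) (j + 1) + rb F (restrict (link P v) S) j := by
  have := rb_succ_eq F (isLowerSet_restrict hP ↑(insert v S)) ⟨h0, by simp⟩
    (mem_restrict_singleton.2 ⟨hv, by simp⟩) (j := j)
  rw [deletion_restrict_insert hS, link_restrict_insert] at this
  exact this hd hl

lemma rb_restrict_empty (hP : IsLowerSet P) (h0 : ∅ ∈ P) :
    rb F (restrict P ↑(∅ : Finset ι)) = Pi.single 0 1 :=
  rb_of_no_vertex F (isLowerSet_restrict hP _) ⟨h0, by simp⟩ fun v hv => by
    simpa using (mem_restrict_singleton.1 hv).2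

lemma rb_restrict_singleton (hP : IsLowerSet P) (h0 : ∅ ∈ P) {v : ι} (hv : {v} ∈ P) :
    rb F (restrict P ↑({v} : Finset ι)) = 0 :=
  rb_of_unique_vertex F (isLowerSet_restrict hP _) ⟨h0, by simp⟩
    (mem_restrict_singleton.2 ⟨hv, by simp⟩) fun w hw => by
      simpa using (mem_restrict_singleton.1 hw).2

lemma rb_restrict_zero (hP : IsLowerSet P) (h0 : ∅ ∈ P) {v : ι} (hv : {v} ∈ P) {S : Finset ι}
    (hS : v ∈ S) : rb F (restrict P (S : Set ι)) 0 = 0 :=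
  rb_zero_of_vertex F (isLowerSet_restrict hP _) ⟨h0, by simp⟩
    (mem_restrict_singleton.2 ⟨hv, hS⟩)

lemma rb_restrict_eq_zero_of_lt (hP : IsLowerSet P) (h0 : ∅ ∈ P) {D j : ℕ}
    (hD : ∀ σ ∈ P, σ.card ≤ D) (hj : D < j) (S : Set ι) : rb F (restrict P S) j = 0 :=
  rb_eq_zero_of_lt F (isLowerSet_restrict hP _) ⟨h0, by simp⟩ (fun σ hσ => hD σ hσ.1) hj

end SimplexFamily

/-! ### Induced subcomplexes of `(K3)₁₆` and of its links -/

namespace K3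

open SimplexFamily

variable (F : Type u) [Field F]

lemma singleton_mem_faces (v : Fin 16) : {v} ∈ faces := mem_faces_of_card_le (by simp)

lemma card_le_of_mem_link {P : Set (Finset (Fin 16))} {D : ℕ} (hD : ∀ σ ∈ P, σ.card ≤ D + 1)
    {v : Fin 16} {σ : Finset (Fin 16)} (hσ : σ ∈ link P v) : σ.card ≤ D := by
  have := hD _ hσ.2
  rw [Finset.card_insert_of_notMem hσ.1] at this
  omega

lemma card_le_of_mem_link_faces {v : Fin 16} {σ : Finset (Fin 16)} (hσ : σ ∈ link faces v) :
    σ.card ≤ 4 := card_le_of_mem_link (fun _ => card_le_of_mem_faces) hσ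

lemma card_le_of_mem_link_link_faces {v w : Fin 16} {σ : Finset (Fin 16)}
    (hσ : σ ∈ link (link faces v) w) : σ.card ≤ 3 :=
  card_le_of_mem_link (fun _ => card_le_of_mem_link_faces) hσ

lemma ne_of_singleton_mem_link {P : Set (Finset (Fin 16))} {v w : Fin 16} (h : {w} ∈ link P v) :
    v ≠ w := fun e => h.1 (by simp [e])

/-- Induced subcomplexes of links of vertices are connected, since `(K3)₁₆` is 3-neighborly. -/
lemma rb_restrict_link_one {v : Fin 16} (S : Finset (Fin 16)) (hS : v ∉ S) :
    rb F (restrict (link faces v) S) 1 = 0 := by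
  have hL := isLowerSet_link_faces v
  have h0 := empty_mem_link_faces v
  induction S using Finset.induction_on with
  | empty =>
    rw [rb_restrict_empty F hL h0]
    rfl
  | insert u T hu ih =>
    rw [Finset.mem_insert, not_or] at hS
    have hs := singleton_mem_link_faces hS.1
    rcases T.eq_empty_or_nonempty with rfl | ⟨w, hw⟩
    · rw [insert_empty_eq, rb_restrict_singleton F hL h0 hs]
      rfl
    · have h := rb_restrict_insert_le F hL h0 hs hu 0
      have hvw : v ≠ w := fun e => hS.2 (e ▸ hw)
      have huw : u ≠ w := fun e => hu (e ▸ hw)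
      rw [zero_add, ih hS.2, rb_restrict_zero F (isLowerSet_link_link_faces v u)
        (empty_mem_link_link_faces hS.1) (singleton_mem_link_link_faces hS.1 hvw huw) hw] at h
      omega

/-- A proper induced subcomplex of the link of an edge, which is a 2-sphere, has no homology in
degree `2`: this homology grows with the set of vertices. -/
lemma rb_restrict_link_link_three {v u w : Fin 16} (hvu : v ≠ u) (hvw : v ≠ w) (huw : u ≠ w)
    (S : Finset (Fin 16)) (hS : w ∉ S) : rb F (restrict (link (link faces v) u) S) 3 = 0 := by
  have hL := isLowerSet_link_link_faces v u
  have h0 := empty_mem_link_link_faces hvu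
  have h := rb_restrict_le_deletion F hL h0 w 3 (fun x _ hx T _ _ =>
    rb_restrict_eq_zero_of_lt F (isLowerSet_link hL x) ⟨by simp, by simpa using hx⟩ (D := 2)
      (fun _ => card_le_of_mem_link (fun _ => card_le_of_mem_link_link_faces)) (by norm_num) _) S hS
  rw [rb_deletion_link_link F hvu hvw huw] at h
  simpa using h

/-- A proper induced subcomplex of the link of a vertex, which is a 3-sphere, has no homology in
degrees `2` and `3`. -/
lemma rb_restrict_link_of_notMem {v w : Fin 16} (hvw : v ≠ w) {j : ℕ} (hj : 3 ≤ j)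
    (S : Finset (Fin 16)) (hS : w ∉ S) : rb F (restrict (link faces v) S) j = 0 := by
  have h := rb_restrict_le_deletion F (isLowerSet_link_faces v) (empty_mem_link_faces v) w j
    (fun u huw hu T _ hT => ?_) S hS
  · rw [rb_deletion_link F hvw] at h
    simpa using h
  · have hvu := ne_of_singleton_mem_link hu
    obtain rfl | hj := hj.eq_or_lt
    · exact rb_restrict_link_link_three F hvu hvw huw T hT
    · exact rb_restrict_eq_zero_of_lt F (isLowerSet_link_link_faces v u)
        (empty_mem_link_link_faces hvu) (fun _ => card_le_of_mem_link_link_faces) hj _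

lemma restrict_link_eq_self {v : Fin 16} {S : Finset (Fin 16)} (h : ∀ w, v ≠ w → w ∈ S) :
    restrict (link faces v) S = link faces v :=
  restrict_eq_self fun _ hσ _ hi => h _ fun e => hσ.1 (e ▸ hi)

lemma rb_restrict_link_three {v : Fin 16} (S : Finset (Fin 16)) :
    rb F (restrict (link faces v) S) 3 = 0 := by
  by_cases h : ∀ w, v ≠ w → w ∈ S
  · rw [restrict_link_eq_self h, rb_link]
    rfl
  · push Not at h
    obtain ⟨w, hvw, hw⟩ := h
    exact rb_restrict_link_of_notMem F hvw le_rfl S hw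

/-- An induced subcomplex of the link of a vertex on at most two or on at least thirteen of the
fifteen vertices has no homology in degree `1`. This is why only the middle vertices can be critical
of index `2`. The complements of at most two vertices in the 3-sphere are treated by the acyclicity
of deletions. -/
lemma rb_restrict_link_two {v : Fin 16} (S : Finset (Fin 16)) (hS : v ∉ S)
    (hc : S.card ≤ 2 ∨ 13 ≤ S.card) : rb F (restrict (link faces v) S) 2 = 0 := by
  have hL := isLowerSet_link_faces v
  have h0 := empty_mem_link_faces v
  rcases hc with hc | hc
  · obtain hc | hc | hc : S.card = 0 ∨ S.card = 1 ∨ S.card = 2 := by omega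
    · rw [Finset.card_eq_zero.1 hc, rb_restrict_empty F hL h0]
      rfl
    · obtain ⟨u, rfl⟩ := Finset.card_eq_one.1 hc
      rw [rb_restrict_singleton F hL h0 (singleton_mem_link_faces (by simpa using hS))]
      rfl
    · obtain ⟨u, w, huw, rfl⟩ := Finset.card_eq_two.1 hc
      simp only [Finset.mem_insert, Finset.mem_singleton, not_or] at hS
      have h := rb_restrict_insert_le F hL h0 (singleton_mem_link_faces hS.1)
        (S := {w}) (by simpa using huw) 1
      rw [rb_restrict_singleton F hL h0 (singleton_mem_link_faces hS.2),
        rb_restrict_singleton F (isLowerSet_link_link_faces v u)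
          (empty_mem_link_link_faces hS.1) (singleton_mem_link_link_faces hS.1 hS.2 huw)] at h
      simpa using h
  · have hT : ((insert v S)ᶜ).card = 15 - S.card := by
      rw [Finset.card_compl, Finset.card_insert_of_notMem hS, Fintype.card_fin]
      omega
    have hmem : ∀ w, w ∉ (insert v S)ᶜ → v ≠ w → w ∈ S := fun w hw hvw => by
      simpa [hvw.symm] using hw
    obtain hc | hc | hc : ((insert v S)ᶜ).card = 0 ∨ ((insert v S)ᶜ).card = 1 ∨
      ((insert v S)ᶜ).card = 2 := by omega
    · rw [restrict_link_eq_self fun w => hmem w (by simp [Finset.card_eq_zero.1 hc]), rb_link]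
      rfl
    · obtain ⟨a, ha⟩ := Finset.card_eq_one.1 hc
      have haS : a ∉ insert v S := by
        rw [← Finset.mem_compl, ha]
        simp
      rw [Finset.mem_insert, not_or] at haS
      have h := deletion_restrict_insert (P := link faces v) haS.2
      rw [restrict_link_eq_self fun w hw => ?_] at h
      · rw [← h, rb_deletion_link F (Ne.symm haS.1)]
        rfl
      · by_cases hwa : w = a
        · simp [hwa]
        · exact Finset.mem_insert_of_mem (hmem w (by simp [ha, hwa]) hw)
    · obtain ⟨a, b, hab, ha⟩ := Finset.card_eq_two.1 hc
      have haS : a ∉ insert v S := by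
        rw [← Finset.mem_compl, ha]
        simp
      have hbS : b ∉ insert v S := by
        rw [← Finset.mem_compl, ha]
        simp
      rw [Finset.mem_insert, not_or] at haS hbS
      have hva := Ne.symm haS.1
      have hvb := Ne.symm hbS.1
      have hsub : ∀ w, v ≠ w → w ≠ a → w ∈ insert b S := fun w hw hwa => by
        by_cases hwb : w = b
        · simp [hwb]
        · exact Finset.mem_insert_of_mem (hmem w (by simp [ha, hwa, hwb]) hw)
      have h := rb_deletion_le F (isLowerSet_restrict hL ↑(insert b S)) ⟨h0, by simp⟩
        (v := b) (mem_restrict_singleton.2 ⟨singleton_mem_link_faces hvb, by simp⟩) 2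
      have h1 : restrict (link faces v) ↑(insert b S) = deletion (link faces v) a := by
        have h := deletion_restrict_insert (P := link faces v) (S := insert b S) (v := a)
          (by simp [hab, haS.2])
        rw [← h, restrict_link_eq_self fun w hw => ?_]
        by_cases hwa : w = a
        · simp [hwa]
        · exact Finset.mem_insert_of_mem (hsub w hw hwa)
      have h2 : restrict (link (link faces v) b) S = deletion (link (link faces v) b) a := by
        ext σ
        refine and_congr_right fun hσ => forall₂_congr fun i hi => ⟨?_, fun hia => ?_⟩
        · rintro hi rfl
          exact haS.2 hi
        · have hib : i ≠ b := fun e => hσ.1 (e ▸ hi)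
          have hiv : v ≠ i := fun e => hσ.2.1 (by simp [e, hi])
          have := hsub i hiv hia
          rw [Finset.mem_insert] at this
          exact this.resolve_left hib
      rw [deletion_restrict_insert hbS.2, link_restrict_insert, h1, h2, rb_deletion_link F hva,
        rb_deletion_link_link F hvb hva hab.symm] at h
      simpa using h

lemma rb_restrict_one (S : Finset (Fin 16)) : rb F (restrict faces S) 1 = 0 := by
  induction S using Finset.induction_on with
  | empty =>
    rw [rb_restrict_empty F isLowerSet_faces empty_mem_faces]
    rfl
  | insert v T hv ih =>
    rcases T.eq_empty_or_nonempty with rfl | ⟨w, hw⟩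
    · rw [insert_empty_eq,
        rb_restrict_singleton F isLowerSet_faces empty_mem_faces (singleton_mem_faces v)]
      rfl
    · have h := rb_restrict_insert_le F isLowerSet_faces empty_mem_faces (singleton_mem_faces v)
        hv 0
      rw [zero_add, ih, rb_restrict_zero F (isLowerSet_link_faces v) (empty_mem_link_faces v)
        (singleton_mem_link_faces fun e => hv (e ▸ hw)) hw] at h
      omega

lemma rb_restrict_two (S : Finset (Fin 16)) : rb F (restrict faces S) 2 = 0 := by
  induction S using Finset.induction_on with
  | empty =>
    rw [rb_restrict_empty F isLowerSet_faces empty_mem_faces]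
    rfl
  | insert v T hv ih =>
    have h := rb_restrict_insert_le F isLowerSet_faces empty_mem_faces (singleton_mem_faces v) hv 1
    rw [ih, rb_restrict_link_one F T hv] at h
    exact Nat.le_zero.1 h

lemma rb_restrict_four (S : Finset (Fin 16)) : rb F (restrict faces S) 4 = 0 := by
  induction S using Finset.induction_on with
  | empty =>
    rw [rb_restrict_empty F isLowerSet_faces empty_mem_faces]
    rfl
  | insert v T hv ih =>
    have h := rb_restrict_insert_le F isLowerSet_faces empty_mem_faces (singleton_mem_faces v) hv 3
    rw [ih, rb_restrict_link_three F T] at h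
    exact Nat.le_zero.1 h

lemma rb_restrict_five (S : Finset (Fin 16)) {w : Fin 16} (hS : w ∉ S) :
    rb F (restrict faces S) 5 = 0 := by
  induction S using Finset.induction_on with
  | empty =>
    rw [rb_restrict_empty F isLowerSet_faces empty_mem_faces]
    rfl
  | insert v T hv ih =>
    rw [Finset.mem_insert, not_or] at hS
    have h := rb_restrict_insert_le F isLowerSet_faces empty_mem_faces (singleton_mem_faces v) hv 4
    rw [ih hS.2, rb_restrict_link_of_notMem F (Ne.symm hS.1) (by norm_num) T hS.2] at h
    exact Nat.le_zero.1 h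

lemma restrict_faces_univ : restrict faces ↑(Finset.univ : Finset (Fin 16)) = faces :=
  restrict_eq_self (by simp)

/-- Adding the last vertex closes the fundamental cycle. -/
lemma rb_faces_five : rb F faces 5 = 1 := by
  have e : (Finset.univ : Finset (Fin 16)) = insert 0 {0}ᶜ := by decide
  have hl : restrict (link faces 0) ↑({0}ᶜ : Finset (Fin 16)) = link faces 0 :=
    restrict_link_eq_self fun w hw => by simpa using hw.symm
  have h := rb_restrict_insert_eq F isLowerSet_faces empty_mem_faces (singleton_mem_faces 0)
    (S := {0}ᶜ) (by simp) (rb_restrict_four F _) (by rw [hl, rb_link]; rfl)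
  rw [← e, restrict_faces_univ, hl, rb_link, rb_restrict_five F _ (w := 0) (by simp)] at h
  simpa using h

/-- The second Betti number of `(K3)₁₆`, from its Euler characteristic `24`: the other Betti numbers
are `1`, `0`, `0` and `1`. The reduced Euler sum is `1 - 24`. -/
theorem rb_faces_three : rb F faces 3 = 22 := by
  have h := sum_rb_eq_eulerSum F isLowerSet_faces empty_mem_faces
  have hbig : ∀ j, 5 < j → rb F faces j = 0 := fun j =>
    rb_eq_zero_of_lt F isLowerSet_faces empty_mem_faces fun _ => card_le_of_mem_faces
  have h0 := rb_zero_of_vertex F isLowerSet_faces empty_mem_faces (singleton_mem_faces 0)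
  have h1 := rb_restrict_one F Finset.univ
  have h2 := rb_restrict_two F Finset.univ
  have h4 := rb_restrict_four F Finset.univ
  rw [restrict_faces_univ] at h1 h2 h4
  rw [eulerSum_faces, Fintype.card_fin, ← Finset.sum_subset (s₁ := Finset.range 6) (by decide)
    fun j _ hj => by rw [hbig j (by rw [Finset.mem_range] at hj; omega)]; simp] at h
  simp only [Finset.sum_range_succ, Finset.sum_range_zero, h0, h1, h2, h4, rb_faces_five F] at h
  norm_num at h
  omega

/-- Adding the vertices in the order of the values of a function `g`, the links in the part already
present build up the second Betti number: the neighbouring terms in all the exact sequences vanish. -/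
lemma sum_rb_restrict_link {g : Fin 16 → ℝ} (hg : Function.Injective g) (S : Finset (Fin 16)) :
    ∑ v ∈ S, rb F (restrict (link faces v)
      ((S.filter fun w => g w < g v : Finset (Fin 16)) : Set (Fin 16))) 2 =
      rb F (restrict faces S) 3 := by
  induction S using Finset.induction_on_max_value g with
  | empty =>
    rw [rb_restrict_empty F isLowerSet_faces empty_mem_faces]
    rfl
  | insert v T hv hmax ih =>
    have hlt : ∀ u ∈ T, g u < g v := fun u hu =>
      (hmax u hu).lt_of_ne fun e => hv (hg e ▸ hu)
    rw [Finset.sum_insert hv, rb_restrict_insert_eq F isLowerSet_faces empty_mem_faces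
      (singleton_mem_faces v) hv (rb_restrict_two F T) (rb_restrict_link_three F T), add_comm, ← ih]
    congr 1
    · refine Finset.sum_congr rfl fun u hu => ?_
      rw [Finset.filter_insert, if_neg (hlt u hu).not_gt]
    · rw [Finset.filter_insert, if_neg (lt_irrefl _), Finset.filter_true_of_mem hlt]

end K3

/-! ### Critical points -/

namespace K3

open SimplexFamily AbstractSimplicialComplex

variable {f : complex.realization → ℝ}

lemma apply_eq_sum (hf : IsRSL complex f) (x : complex.realization) :
    f x = ∑ i, x.1 i * f (complex.vertex i) := by
  obtain ⟨σ, hσ, h⟩ := x.2.2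
  rw [hf.linear_on_simplex σ hσ x h]
  exact Finset.sum_subset (Finset.subset_univ σ) fun i _ hi => by rw [h i hi, zero_mul]

variable (F : Type u) [Field F]

/-- The multiplicity of a vertex is read off from the part of its link that lies below it. -/
theorem multiplicity_eq (hf : IsRSL complex f) (v : Fin 16) (i : ℕ) :
    multiplicity F f (complex.vertex v) i = rb F (restrict (link faces v)
      ((Finset.univ.filter fun w => f (complex.vertex w) < f (complex.vertex v) :
        Finset (Fin 16)) : Set (Fin 16))) i := by
  have hS : ((Finset.univ.filter fun w => f (complex.vertex w) < f (complex.vertex v) :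
      Finset (Fin 16)) : Set (Fin 16)) = {w | f (complex.vertex w) < f (complex.vertex v)} := by
    ext w
    simp
  rw [hS]
  have h := (exists_ranks_lowerPart (F := F) (P := faces) (g := fun w => f (complex.vertex w))
    (v := v) (X := sublevel f (complex.vertex v)) (p := fun x => x.1.1) isLowerSet_faces
    (fun w hw e => hw (hf.injective_vertex e)) (.comp .subtypeVal .subtypeVal) ?_
    (singleton_mem_faces v)
    (hasReducedBetti_rb F (isLowerSet_restrict isLowerSet_faces _) ⟨empty_mem_faces, by simp⟩)
    (hasReducedBetti_rb F (isLowerSet_restrict (isLowerSet_link_faces v) _)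
      ⟨empty_mem_link_faces v, by simp⟩)).1 i
  · have e : {y : sublevel f (complex.vertex v) | y.1 ≠ complex.vertex v} =
        {x | x.1.1 ≠ Pi.single v 1} := Set.ext fun x => not_congr Subtype.ext_iff
    rw [← h, AbstractSimplicialComplex.multiplicity, e]
  · ext x
    constructor
    · rintro ⟨y, rfl⟩
      refine ⟨by rw [geo_faces]; exact y.1.2, ?_⟩
      rw [← apply_eq_sum hf]
      exact y.2
    · rintro ⟨h1, h2⟩
      rw [geo_faces] at h1
      refine ⟨⟨⟨x, h1⟩, ?_⟩, rfl⟩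
      rw [← apply_eq_sum hf ⟨x, h1⟩] at h2
      exact h2

theorem bettiNumber_two : bettiNumber F complex.realization 2 = 22 := by
  rw [← geo_faces, (hasReducedBetti_rb F isLowerSet_faces empty_mem_faces).succ 1, rb_faces_three]
  rfl

lemma card_filter_lt_add (hf : IsRSL complex f) (v : Fin 16) :
    (Finset.univ.filter fun w => f (complex.vertex w) < f (complex.vertex v)).card +
      (Finset.univ.filter fun w => f (complex.vertex v) < f (complex.vertex w)).card = 15 := by
  rw [← Finset.card_union_of_disjoint (Finset.disjoint_filter.2 fun w _ h => h.not_gt)]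
  have : (Finset.univ.filter fun w => f (complex.vertex w) < f (complex.vertex v)) ∪
      (Finset.univ.filter fun w => f (complex.vertex v) < f (complex.vertex w)) = {v}ᶜ := by
    ext w
    simpa using (hf.injective_vertex.ne_iff (x := w) (y := v)).symm.trans ne_iff_lt_or_gt |>.symm
  rw [this, Finset.card_compl, Fintype.card_fin, Finset.card_singleton]

/-- A vertex that is not a middle vertex has at most two vertices below or at most two above it. -/
lemma multiplicity_two_eq_zero (hf : IsRSL complex f) {v : Fin 16} (hv : v ∉ middleVertices f) :
    multiplicity F f (complex.vertex v) 2 = 0 := by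
  rw [multiplicity_eq F hf, rb_restrict_link_two F _ (by simp), Nat.cast_zero]
  have h := card_filter_lt_add hf v
  have hv : ¬ (3 ≤ (Finset.univ.filter fun w => f (complex.vertex w) < f (complex.vertex v)).card ∧
      3 ≤ (Finset.univ.filter fun w => f (complex.vertex v) < f (complex.vertex w)).card) :=
    fun h => hv (Finset.mem_filter.2 ⟨Finset.mem_univ v, h⟩)
  omega

lemma card_middleVertices (hf : IsRSL complex f) : (middleVertices f).card = 10 := by
  -- the number of lower vertices is a bijection from the vertices to `{0, …, 15}`
  let r : Fin 16 → ℕ := fun v =>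
    (Finset.univ.filter fun w => f (complex.vertex w) < f (complex.vertex v)).card
  have hr : ∀ v, r v < 16 := fun v => by
    have := card_filter_lt_add hf v
    change r v + _ = 15 at this
    omega
  have hmono : ∀ v w, f (complex.vertex v) < f (complex.vertex w) → r v < r w := fun v w h => by
    refine Finset.card_lt_card ⟨fun u hu => ?_, fun hsub => ?_⟩
    · simp only [Finset.mem_filter, Finset.mem_univ, true_and] at hu ⊢
      exact hu.trans h
    · simpa using hsub (Finset.mem_filter.2 ⟨Finset.mem_univ v, h⟩)
  have hinj : Function.Injective fun v => (⟨r v, hr v⟩ : Fin 16) := fun v w e => by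
    have e : r v = r w := congrArg Fin.val e
    by_contra hne
    rcases (hf.injective_vertex.ne hne).lt_or_gt with h | h
    · exact (hmono _ _ h).ne e
    · exact (hmono _ _ h).ne' e
  let e := Equiv.ofBijective _ (Finite.injective_iff_bijective.1 hinj)
  have h : (middleVertices f).map e.toEmbedding =
      (Finset.univ.filter fun i : Fin 16 => 3 ≤ (i : ℕ) ∧ (i : ℕ) ≤ 12) := by
    ext i
    obtain ⟨v, rfl⟩ := e.surjective i
    have h1 : r v + _ = 15 := card_filter_lt_add hf v
    have h2 : ((e v : Fin 16) : ℕ) = r v := rfl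
    simp only [Finset.mem_map_equiv, Equiv.symm_apply_apply, middleVertices, Finset.mem_filter,
      Finset.mem_univ, true_and, h2]
    change 3 ≤ r v ∧ _ ↔ _
    omega
  rw [← Finset.card_map e.toEmbedding, h]
  decide

theorem sum_multiplicity (hf : IsRSL complex f) :
    ∃ m : Fin 16 → ℕ, (∀ v, multiplicity F f (complex.vertex v) 2 = m v) ∧ ∑ v, m v = 22 := by
  refine ⟨_, fun v => multiplicity_eq F hf v 2, ?_⟩
  rw [sum_rb_restrict_link F hf.injective_vertex, restrict_faces_univ, rb_faces_three]

theorem critical_points (hf : IsRSL complex f) :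
    (∃ v : Fin 16, ∃ m : ℕ, 2 < m ∧ IsCritical F f (complex.vertex v) 2 m) ∧
    (middleVertices f).card = 10 ∧
    (∀ v : Fin 16, v ∉ middleVertices f → multiplicity F f (complex.vertex v) 2 = 0) ∧
    ∑ v ∈ middleVertices f, multiplicity F f (complex.vertex v) 2 = 22 ∧
    criticalCount F f 2 = 22 ∧
    bettiNumber F complex.realization 2 = 22 := by
  obtain ⟨m, hm, hsum⟩ := sum_multiplicity F hf
  have hz : ∀ v, v ∉ middleVertices f → m v = 0 := fun v hv => by
    have := multiplicity_two_eq_zero F hf hv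
    rwa [hm, Nat.cast_eq_zero] at this
  have hmid : ∑ v ∈ middleVertices f, m v = 22 := by
    rw [← hsum]
    exact Finset.sum_subset (Finset.subset_univ _) fun v _ hv => hz v hv
  refine ⟨?_, card_middleVertices hf, fun v => multiplicity_two_eq_zero F hf, ?_, ?_,
    bettiNumber_two F⟩
  · -- otherwise the ten middle vertices carry at most twenty critical points
    by_contra! h
    have hle : ∀ v ∈ middleVertices f, m v ≤ 2 := fun v _ => by
      by_contra! hv
      exact h v (m v) hv ⟨hm v, by omega⟩
    have := Finset.sum_le_card_nsmul _ _ _ hle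
    rw [hmid, card_middleVertices hf] at this
    norm_num at this
  · simp_rw [hm, ← Nat.cast_sum, hmid]
    rfl
  · simp_rw [criticalCount, hm, ← Nat.cast_sum, hsum]
    rfl

end K3

/-! ### Complete simplicial fans -/

namespace SimplicialFan

variable {ι J K E : Type*} [Fintype K] [DecidableEq K] [NormedAddCommGroup E] [NormedSpace ℝ E]

/-- The data of a simplicial polytope with the origin in its interior: the vertices `p`, the facets
`tri`, and for every facet the coordinates `c` with respect to the basis given by its vertices.
The sum of these coordinates is the linear function that is `1` on the facet; it is less than `1` at
the other vertices. Every ridge lies in a second facet. -/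
structure IsPolytope (tri : J → K → ι) (c : J → K → E →L[ℝ] ℝ) (p : ι → E) : Prop where
  sum_smul : ∀ j t, ∑ k, c j k t • p (tri j k) = t
  coord : ∀ j k k', c j k (p (tri j k')) = if k = k' then 1 else 0
  le_one : ∀ j j' k, ∑ k', c j k' (p (tri j' k)) ≤ 1
  mem_of_eq_one : ∀ j j' k, ∑ k', c j k' (p (tri j' k)) = 1 → tri j' k ∈ Set.range (tri j)
  exists_adjacent : ∀ j k, ∃ j', (∀ k', k' ≠ k → tri j k' ∈ Set.range (tri j')) ∧
    tri j k ∉ Set.range (tri j')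

namespace IsPolytope

variable {tri : J → K → ι} {c : J → K → E →L[ℝ] ℝ} {p : ι → E} (h : IsPolytope tri c p)
include h

lemma tri_injective (j : J) : Function.Injective (tri j) := fun k k' e => by
  have h1 := h.coord j k k'
  rw [← e, h.coord, if_pos rfl] at h1
  by_contra hne
  simp [hne] at h1

/-- Every point of the space lies in the cone over some facet, namely over one whose linear function
is maximal at the point. -/
lemma exists_nonneg [Fintype J] [Nonempty J] (t : E) : ∃ j, ∀ k, 0 ≤ c j k t := by
  obtain ⟨j, -, hj⟩ := Finset.exists_max_image Finset.univ (fun j => ∑ k, c j k t)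
    Finset.univ_nonempty
  refine ⟨j, fun k => ?_⟩
  obtain ⟨j', h1, h2⟩ := h.exists_adjacent j k
  have hone : ∀ k', k' ≠ k → ∑ l, c j' l (p (tri j k')) = 1 := fun k' hk' => by
    obtain ⟨l, hl⟩ := h1 k' hk'
    rw [← hl]
    simp [h.coord]
  have hlt : ∑ l, c j' l (p (tri j k)) < 1 :=
    (h.le_one j' j k).lt_of_ne fun e => h2 (h.mem_of_eq_one j' j k e)
  have e : ∑ l, c j' l t = ∑ k', c j k' t * ∑ l, c j' l (p (tri j k')) := by
    conv_lhs => rw [← h.sum_smul j t]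
    simp only [map_sum, map_smul, smul_eq_mul, Finset.mul_sum]
    exact Finset.sum_comm
  have hle := hj j' (Finset.mem_univ j')
  have e' : ∑ k', c j k' t - ∑ k', c j k' t * ∑ l, c j' l (p (tri j k')) =
      c j k t * (1 - ∑ l, c j' l (p (tri j k))) := by
    rw [← Finset.sum_sub_distrib, Finset.sum_eq_single k]
    · ring
    · intro k' _ hk'
      rw [hone k' hk', mul_one, sub_self]
    · simp
  have : 0 ≤ c j k t * (1 - ∑ l, c j' l (p (tri j k))) := by linarith
  exact nonneg_of_mul_nonneg_left this (by linarith)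

variable [Fintype ι] [DecidableEq ι]

lemma sum_eq {j : J} {z : ι → ℝ} (hz : ∀ i, i ∉ Set.range (tri j) → z i = 0) {M : Type*}
    [AddCommMonoid M] [Module ℝ M] (q : ι → M) :
    ∑ i, z i • q i = ∑ k, z (tri j k) • q (tri j k) := by
  rw [← Finset.sum_image (f := fun i => z i • q i) (s := Finset.univ) (g := tri j)
    (h.tri_injective j).injOn]
  refine (Finset.sum_subset (Finset.subset_univ _) fun i _ hi => ?_).symm
  rw [hz i (by simpa using hi), zero_smul]

lemma coord_sum {j : J} {z : ι → ℝ} (hz : ∀ i, i ∉ Set.range (tri j) → z i = 0) (k : K) :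
    c j k (∑ i, z i • p i) = z (tri j k) := by
  rw [h.sum_eq hz, map_sum]
  simp [h.coord]

/-- The linear function of the facet `j` is at most the sum of the coordinates at a point of the
cone over `j'`, with equality only for points of the common face. -/
lemma sum_coord_le {j j' : J} {z : ι → ℝ} (h0 : 0 ≤ z) (hz : ∀ i, i ∉ Set.range (tri j') → z i = 0) :
    ∑ k, c j k (∑ i, z i • p i) ≤ ∑ i, z i ∧
      (∑ k, c j k (∑ i, z i • p i) = ∑ i, z i → ∀ i, i ∉ Set.range (tri j) → z i = 0) := by
  have e1 : ∑ k, c j k (∑ i, z i • p i) =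
      ∑ k', z (tri j' k') * ∑ k, c j k (p (tri j' k')) := by
    rw [h.sum_eq hz]
    simp only [map_sum, map_smul, smul_eq_mul, Finset.mul_sum]
    exact Finset.sum_comm
  have e2 : ∑ i, z i = ∑ k', z (tri j' k') := by
    simpa using h.sum_eq hz (fun _ => (1 : ℝ))
  have hle : ∀ k' ∈ Finset.univ, z (tri j' k') * ∑ k, c j k (p (tri j' k')) ≤ z (tri j' k') :=
    fun k' _ => mul_le_of_le_one_right (h0 _) (h.le_one j j' k')
  rw [e1, e2]
  refine ⟨Finset.sum_le_sum hle, fun e i hi => ?_⟩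
  by_cases hi' : i ∈ Set.range (tri j')
  · obtain ⟨k', rfl⟩ := hi'
    have := (Finset.sum_eq_sum_iff_of_le hle).1 e k' (Finset.mem_univ k')
    by_contra hne
    exact hi (h.mem_of_eq_one j j' k' (mul_left_cancel₀ hne (this.trans (mul_one _).symm)))
  · exact hz i hi'

/-- A point has at most one representation as a nonnegative combination of the vertices of a facet. -/
lemma unique {j j' : J} {z z' : ι → ℝ} (h0 : 0 ≤ z) (hz : ∀ i, i ∉ Set.range (tri j) → z i = 0)
    (h0' : 0 ≤ z') (hz' : ∀ i, i ∉ Set.range (tri j') → z' i = 0)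
    (e : ∑ i, z i • p i = ∑ i, z' i • p i) : z = z' := by
  have hs : ∀ {j : J} {z : ι → ℝ}, (∀ i, i ∉ Set.range (tri j) → z i = 0) →
      ∑ k, c j k (∑ i, z i • p i) = ∑ i, z i := fun {j z} hz => by
    simp only [h.coord_sum hz]
    simpa using (h.sum_eq hz (fun _ => (1 : ℝ))).symm
  have h1 := h.sum_coord_le (j := j) h0' hz'
  have h2 := (h.sum_coord_le (j := j') h0 hz).1
  rw [← e, hs hz] at h1
  rw [e, hs hz'] at h2
  have hz'' := h1.2 (h1.1.antisymm h2)
  funext i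
  by_cases hi : i ∈ Set.range (tri j)
  · obtain ⟨k, rfl⟩ := hi
    rw [← h.coord_sum hz, e, h.coord_sum hz'']
  · rw [hz i hi, hz'' i hi]

/-- The cones over the facets of a polytope with the origin in its interior form a complete fan:
the space is homeomorphic to the abstract cone over the boundary complex. -/
theorem exists_homeomorph [Fintype J] [Nonempty J] : ∃ ψ : E → ι → ℝ, Continuous ψ ∧
    (∀ t, 0 ≤ ψ t ∧ (∃ j, ∀ i, i ∉ Set.range (tri j) → ψ t i = 0) ∧ ∑ i, ψ t i • p i = t) ∧
    ∀ z : ι → ℝ, 0 ≤ z → (∃ j, ∀ i, i ∉ Set.range (tri j) → z i = 0) →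
      ψ (∑ i, z i • p i) = z := by
  let ψ₀ : J → E → ι → ℝ := fun j t => ∑ k, c j k t • Pi.single (tri j k) 1
  have hcont : ∀ j, Continuous (ψ₀ j) := fun j =>
    continuous_finsetSum _ fun k _ => (c j k).continuous.smul continuous_const
  have happ : ∀ j t k, ψ₀ j t (tri j k) = c j k t := fun j t k => by
    simp only [ψ₀, Finset.sum_apply, Pi.smul_apply, smul_eq_mul, Pi.single_apply,
      (h.tri_injective j).eq_iff]
    simp
  have hsupp : ∀ j t i, i ∉ Set.range (tri j) → ψ₀ j t i = 0 := fun j t i hi => by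
    simp only [ψ₀, Finset.sum_apply, Pi.smul_apply, smul_eq_mul]
    refine Finset.sum_eq_zero fun k _ => ?_
    rw [Pi.single_eq_of_ne (fun e => hi ⟨k, e.symm⟩), mul_zero]
  have hpos : ∀ j t, (∀ k, 0 ≤ c j k t) → 0 ≤ ψ₀ j t := fun j t ht =>
    Finset.sum_nonneg fun k _ => smul_nonneg (ht k) (Pi.single_nonneg.2 zero_le_one)
  have hsum : ∀ j t, ∑ i, ψ₀ j t i • p i = t := fun j t => by
    rw [h.sum_eq (hsupp j t)]
    simp only [happ, h.sum_smul]
  choose J₀ hJ₀ using h.exists_nonneg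
  have heq : ∀ j t, (∀ k, 0 ≤ c j k t) → ψ₀ (J₀ t) t = ψ₀ j t := fun j t ht =>
    h.unique (hpos _ t (hJ₀ t)) (hsupp _ t) (hpos j t ht) (hsupp j t) ((hsum _ t).trans (hsum j t).symm)
  refine ⟨fun t => ψ₀ (J₀ t) t, ?_, fun t => ⟨hpos _ t (hJ₀ t), ⟨_, hsupp _ t⟩, hsum _ t⟩, ?_⟩
  · -- `ψ` is linear on each of the finitely many closed cones
    refine (locallyFinite_of_finite fun j : J => {t | ∀ k, 0 ≤ c j k t}).continuous
      (Set.eq_univ_of_forall fun t => Set.mem_iUnion.2 ⟨J₀ t, hJ₀ t⟩) (fun j => ?_) fun j => ?_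
    · simp only [Set.ofPred_forall]
      exact isClosed_iInter fun k => isClosed_le continuous_const (c j k).continuous
    · exact (hcont j).continuousOn.congr fun t ht => heq j t ht
  · rintro z hz ⟨j, hj⟩
    exact h.unique (hpos _ _ (hJ₀ _)) (hsupp _ _) hz hj (hsum _ _)

end IsPolytope

end SimplicialFan

/-! ### A convex polytope whose boundary complex is the link of an edge -/

namespace K3

open SimplexFamily BitMask SimplicialFan

/-- The triangles of the link of the edge `{10, 0}`, with their orientations. -/
def triangles : Fin 24 → Fin 3 → Fin 16 := ![![1, 3, 6], ![3, 1, 14], ![6, 3, 7], ![1, 6, 8], ![8, 6, 13], ![1, 8, 14],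
  ![14, 8, 15], ![15, 8, 3], ![14, 15, 3], ![3, 8, 12], ![12, 8, 13], ![3, 12, 7],
  ![7, 12, 2], ![2, 12, 11], ![7, 2, 6], ![6, 2, 9], ![9, 2, 5], ![6, 9, 13],
  ![13, 9, 12], ![12, 9, 11], ![11, 9, 4], ![4, 9, 5], ![11, 4, 2], ![2, 4, 5]]

/-- Vertices in `ℤ³` of a convex polytope with boundary complex given by `triangles`. The
vertices `0` and `10`, which are not in the link, are placed at the origin. -/
def points : Fin 16 → Fin 3 → ℤ := ![![0, 0, 0], ![-3, 12, -5], ![21, -7, 29], ![-5, 2, -5],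
  ![9, -8, 11], ![11, -7, 13], ![8, 17, 10], ![12, 0, 18],
  ![-3, 6, -7], ![6, -2, 4], ![0, 0, 0], ![5, -7, 7],
  ![-1, -3, 0], ![1, 3, -3], ![-5, 8, -7], ![-5, 5, -7]]

/-- An inner normal of the side of the cone over the triangle `j` that is opposite to its vertex
`k`. -/
def normals (j : Fin 24) (k : Fin 3) : Fin 3 → ℤ :=
  crossProduct (points (triangles j (k + 1))) (points (triangles j (k + 2)))

/-- Six times the volume of the simplex spanned by a triangle and the origin. -/
def volumes (j : Fin 24) : ℤ := normals j 0 ⬝ᵥ points (triangles j 0)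

lemma volumes_pos : ∀ j, 0 < volumes j := by decide +kernel

lemma normals_dotProduct : ∀ j k k', normals j k ⬝ᵥ points (triangles j k') =
    if k = k' then volumes j else 0 := by decide +kernel

lemma sum_normals_mul : ∀ j l m, ∑ k, normals j k l * points (triangles j k) m =
    if l = m then volumes j else 0 := by decide +kernel

lemma sum_normals_le : ∀ j j' k, ∑ k', normals j k' ⬝ᵥ points (triangles j' k) ≤ volumes j ∧
    (∑ k', normals j k' ⬝ᵥ points (triangles j' k) = volumes j →
      ∃ k'', triangles j k'' = triangles j' k) := by decide +kernel

lemma exists_adjacent_triangle : ∀ j k, ∃ j', (∀ k', k' ≠ k → ∃ k'', triangles j' k'' =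
    triangles j k') ∧ ¬ ∃ k'', triangles j' k'' = triangles j k := by decide +kernel

lemma contains_triangles : ∀ j, ∃ m ∈ facetMasks, ofMask m =
    {10, 0, triangles j 0, triangles j 1, triangles j 2} := by decide +kernel

lemma exists_triangle : ∀ m ∈ facetMasks, 10 ∈ ofMask m → 0 ∈ ofMask m → ∃ j, ofMask m =
    {10, 0, triangles j 0, triangles j 1, triangles j 2} := by decide +kernel

lemma triangles_ne : ∀ j k, triangles j k ≠ 10 ∧ triangles j k ≠ 0 := by decide +kernel

end K3

namespace K3

open SimplexFamily BitMask SimplicialFan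

/-- The vertices of the polytope as points of Euclidean space. -/
noncomputable def realPoints (i : Fin 16) : EuclideanSpace ℝ (Fin 3) :=
  WithLp.toLp 2 fun m => (points i m : ℝ)

/-- The coordinates with respect to the basis given by the vertices of a triangle. -/
noncomputable def coordinates (j : Fin 24) (k : Fin 3) : EuclideanSpace ℝ (Fin 3) →L[ℝ] ℝ :=
  (volumes j : ℝ)⁻¹ • ∑ m, (normals j k m : ℝ) • EuclideanSpace.proj m

lemma coordinates_apply (j : Fin 24) (k : Fin 3) (t : EuclideanSpace ℝ (Fin 3)) :
    coordinates j k t = (volumes j : ℝ)⁻¹ * ∑ m, normals j k m * t m := by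
  simp [coordinates]

lemma coordinates_realPoints (j : Fin 24) (k : Fin 3) (i : Fin 16) :
    coordinates j k (realPoints i) = (volumes j : ℝ)⁻¹ * (normals j k ⬝ᵥ points i : ℤ) := by
  rw [coordinates_apply, dotProduct]
  push_cast
  rfl

lemma isPolytope : IsPolytope triangles coordinates realPoints := by
  have hv : ∀ j, (0 : ℝ) < volumes j := fun j => by exact_mod_cast volumes_pos j
  refine ⟨fun j t => ?_, fun j k k' => ?_, fun j j' k => ?_, fun j j' k h => ?_,
    exists_adjacent_triangle⟩
  · ext m
    have e : ∀ l, ∑ k, (normals j k l * points (triangles j k) m : ℝ) =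
        if l = m then (volumes j : ℝ) else 0 := fun l => by
      exact_mod_cast congrArg (Int.cast (R := ℝ)) (sum_normals_mul j l m)
    have e' : ∑ k, (∑ l, normals j k l * t l) * (points (triangles j k) m : ℝ) =
        volumes j * t m := by
      simp only [Finset.sum_mul]
      rw [Finset.sum_comm]
      simp only [mul_right_comm _ (t _) _, ← Finset.sum_mul, e]
      simp
    have e'' : (∑ k, coordinates j k t • realPoints (triangles j k)) m =
        ∑ k, coordinates j k t * (points (triangles j k) m : ℝ) := by
      simp [realPoints]
    rw [e'']
    simp only [coordinates_apply, mul_assoc]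
    rw [← Finset.mul_sum, e', inv_mul_cancel_left₀ (hv j).ne']
  · rw [coordinates_realPoints, normals_dotProduct]
    split_ifs
    · exact inv_mul_cancel₀ (hv j).ne'
    · simp
  · simp only [coordinates_realPoints]
    rw [← Finset.mul_sum, ← Int.cast_sum, inv_mul_le_one₀ (hv j)]
    exact_mod_cast (sum_normals_le j j' k).1
  · simp only [coordinates_realPoints] at h
    rw [← Finset.mul_sum, ← Int.cast_sum, inv_mul_eq_one₀ (hv j).ne'] at h
    exact (sum_normals_le j j' k).2 (by exact_mod_cast h.symm)

/-- A function that vanishes on the edge `{10, 0}` is supported in the star of the edge if and only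
if it is supported in a triangle of the link. -/
lemma exists_triangle_iff {z : Fin 16 → ℝ} (h10 : z 10 = 0) (h0 : z 0 = 0) :
    (∃ σ ∈ faces, 10 ∈ σ ∧ 0 ∈ σ ∧ ∀ i, i ∉ σ → z i = 0) ↔
      ∃ j, ∀ i, i ∉ Set.range (triangles j) → z i = 0 := by
  constructor
  · rintro ⟨σ, ⟨φ, hφ, hs⟩, h1, h2, hz⟩
    obtain ⟨m, hm, rfl⟩ := mem_facets_iff.1 hφ
    obtain ⟨j, hj⟩ := exists_triangle m hm (hs h1) (hs h2)
    refine ⟨j, fun i hi => ?_⟩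
    by_cases hi' : i ∈ σ
    · have := hs hi'
      simp only [hj, Finset.mem_insert, Finset.mem_singleton] at this
      rcases this with rfl | rfl | h | h | h
      · exact h10
      · exact h0
      all_goals exact absurd ⟨_, h.symm⟩ hi
    · exact hz i hi'
  · rintro ⟨j, hj⟩
    obtain ⟨m, hm, e⟩ := contains_triangles j
    refine ⟨ofMask m, ⟨_, mem_facets_iff.2 ⟨m, hm, rfl⟩, subset_rfl⟩, by simp [e], by simp [e],
      fun i hi => hj i ?_⟩
    rintro ⟨k, rfl⟩
    refine hi ?_
    rw [e]
    fin_cases k <;> simp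

/-- The link of an edge `{a, b}` spans a complete fan in three-space: `p` gives the generators of the
rays, and `ψ` the coordinates of a point in the cone that contains it. By double transitivity it
suffices to consider one edge. -/
theorem exists_fan {a b : Fin 16} (hab : a ≠ b) :
    ∃ (p : Fin 16 → EuclideanSpace ℝ (Fin 3)) (ψ : EuclideanSpace ℝ (Fin 3) → Fin 16 → ℝ),
      p a = 0 ∧ p b = 0 ∧ Continuous ψ ∧
      (∀ t, 0 ≤ ψ t ∧ ψ t a = 0 ∧ ψ t b = 0 ∧
        (∃ σ ∈ faces, a ∈ σ ∧ b ∈ σ ∧ ∀ i, i ∉ σ → ψ t i = 0) ∧ ∑ i, ψ t i • p i = t) ∧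
      ∀ z : Fin 16 → ℝ, 0 ≤ z → z a = 0 → z b = 0 →
        (∃ σ ∈ faces, a ∈ σ ∧ b ∈ σ ∧ ∀ i, i ∉ σ → z i = 0) → ψ (∑ i, z i • p i) = z := by
  obtain ⟨g, hg, rfl, rfl⟩ := exists_mem_symmetryGroup hab
  obtain ⟨ψ, hψ, h1, h2⟩ := isPolytope.exists_homeomorph
  have hz0 : ∀ t, ψ t 10 = 0 ∧ ψ t 0 = 0 := fun t => by
    obtain ⟨-, ⟨j, hj⟩, -⟩ := h1 t
    exact ⟨hj _ fun ⟨k, hk⟩ => (triangles_ne j k).1 hk, hj _ fun ⟨k, hk⟩ => (triangles_ne j k).2 hk⟩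
  have hp : realPoints 10 = 0 ∧ realPoints 0 = 0 := by
    constructor <;> ext m <;> fin_cases m <;> simp [realPoints, points]
  refine ⟨fun i => realPoints (g.symm i), fun t i => ψ t (g.symm i), by simp [hp], by simp [hp],
    continuous_pi fun i => (continuous_apply _).comp hψ,
    fun t => ⟨fun i => (h1 t).1 (g.symm i), by simp [hz0], by simp [hz0], ?_, ?_⟩, fun z hz ha hb hσ => ?_⟩
  · obtain ⟨σ, hσ, h10, h0, h⟩ := (exists_triangle_iff (hz0 t).1 (hz0 t).2).2 (h1 t).2.1
    refine ⟨σ.image g, ?_, Finset.mem_image_of_mem g h10, Finset.mem_image_of_mem g h0,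
      fun i hi => h _ fun h' => hi (Finset.mem_image.2 ⟨_, h', by simp⟩)⟩
    rw [← relabel_faces hg] at hσ
    exact hσ
  · exact (Equiv.sum_comp g.symm fun i => ψ t i • realPoints i).trans (h1 t).2.2
  · have e : ∑ i, z i • realPoints (g.symm i) = ∑ i, z (g i) • realPoints i := by
      rw [← Equiv.sum_comp g]
      simp
    have := h2 (fun i => z (g i)) (fun i => hz (g i)) ((exists_triangle_iff ha hb).1 ?_)
    · funext i
      rw [e]
      exact (congrFun this (g.symm i)).trans (by simp)
    · obtain ⟨σ, hσ, h10, h0, h⟩ := hσ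
      refine ⟨σ.image g.symm, ?_, Finset.mem_image.2 ⟨_, h10, by simp⟩,
        Finset.mem_image.2 ⟨_, h0, by simp⟩, fun i hi => h _ fun h' =>
          hi (Finset.mem_image.2 ⟨_, h', by simp⟩)⟩
      rw [← relabel_faces hg]
      simpa [relabel, Finset.image_image] using hσ

end K3

/-! ### Level sets -/

namespace K3

open SimplexFamily AbstractSimplicialComplex

/-- The level of the linear function with vertex values `h`. -/
def levelSet (h : Fin 16 → ℝ) (α : ℝ) : Set (Fin 16 → ℝ) := {x ∈ geo faces | ∑ i, x i * h i = α}

/-- The intersection of the level with the closed simplex spanned by `σ`. -/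
def cell (h : Fin 16 → ℝ) (α : ℝ) (σ : Finset (Fin 16)) : Set (Fin 16 → ℝ) :=
  {x ∈ stdSimplex ℝ (Fin 16) | (∀ i, i ∉ σ → x i = 0) ∧ ∑ i, x i * h i = α}

/-- The point where the line through two vertices meets the level. -/
noncomputable def crossing (h : Fin 16 → ℝ) (α : ℝ) (i j : Fin 16) : Fin 16 → ℝ :=
  (h j - h i)⁻¹ • (Pi.single i (h j - α) + Pi.single j (α - h i))

variable {h : Fin 16 → ℝ} {α : ℝ} {σ : Finset (Fin 16)}

lemma level_eq {f : complex.realization → ℝ} (hf : IsRSL complex f) (α : ℝ) :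
    level f α = levelSet (fun v => f (complex.vertex v)) α := by
  ext x
  constructor
  · rintro ⟨y, hy, rfl⟩
    refine ⟨by rw [geo_faces]; exact y.2, ?_⟩
    rw [← apply_eq_sum hf]
    exact hy
  · rintro ⟨hx, e⟩
    rw [geo_faces] at hx
    exact ⟨⟨x, hx⟩, (apply_eq_sum hf ⟨x, hx⟩).trans e, rfl⟩

lemma cell_subset_levelSet (hσ : σ ∈ faces) : cell h α σ ⊆ levelSet h α :=
  fun _ hx => ⟨⟨hx.1, σ, hσ, hx.2.1⟩, hx.2.2⟩

lemma exists_mem_cell {x : Fin 16 → ℝ} (hx : x ∈ levelSet h α) : ∃ σ ∈ faces, x ∈ cell h α σ := by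
  obtain ⟨⟨h1, σ, hσ, h2⟩, h3⟩ := hx
  exact ⟨σ, hσ, h1, h2, h3⟩

lemma convex_cell : Convex ℝ (cell h α σ) := by
  intro x hx y hy s t hs ht hst
  refine ⟨convex_stdSimplex ℝ _ hx.1 hy.1 hs ht hst, fun i hi => ?_, ?_⟩
  · simp [hx.2.1 i hi, hy.2.1 i hi]
  · simp only [Pi.add_apply, Pi.smul_apply, smul_eq_mul, add_mul, Finset.sum_add_distrib, mul_assoc,
      ← Finset.mul_sum, hx.2.2, hy.2.2]
    rw [← add_mul, hst, one_mul]

lemma sum_single_mul (i : Fin 16) (c : ℝ) (h : Fin 16 → ℝ) :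
    ∑ k, (Pi.single i c : Fin 16 → ℝ) k * h k = c * h i := by
  rw [Finset.sum_eq_single i (fun k _ hk => by rw [Pi.single_eq_of_ne hk, zero_mul]) (by simp),
    Pi.single_eq_same]

lemma crossing_mem_cell {i j : Fin 16} (hi : i ∈ σ) (hj : j ∈ σ) (h1 : h i < α) (h2 : α < h j) :
    crossing h α i j ∈ cell h α σ := by
  have hpos : 0 < h j - h i := by linarith
  refine ⟨⟨fun k => ?_, ?_⟩, fun k hk => ?_, ?_⟩
  · have n1 : 0 ≤ (Pi.single i (h j - α) : Fin 16 → ℝ) := Pi.single_nonneg.2 (by linarith)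
    have n2 : 0 ≤ (Pi.single j (α - h i) : Fin 16 → ℝ) := Pi.single_nonneg.2 (by linarith)
    exact mul_nonneg (inv_nonneg.2 hpos.le) (add_nonneg (n1 k) (n2 k))
  · simp only [crossing, Pi.smul_apply, Pi.add_apply, smul_eq_mul, ← Finset.mul_sum,
      Finset.sum_add_distrib, Finset.sum_pi_single', Finset.mem_univ, if_true]
    rw [sub_add_sub_cancel, inv_mul_cancel₀ hpos.ne']
  · have hki : k ≠ i := fun e => hk (e ▸ hi)
    have hkj : k ≠ j := fun e => hk (e ▸ hj)
    simp [crossing, hki, hkj]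
  · simp only [crossing, Pi.smul_apply, Pi.add_apply, smul_eq_mul, mul_assoc, ← Finset.mul_sum,
      add_mul, Finset.sum_add_distrib, sum_single_mul]
    field_simp
    ring

/-- The points of a cell have weight on both sides of the level, and the two moments agree. -/
lemma sum_low_eq_sum_high (hα : ∀ i, h i ≠ α) {x : Fin 16 → ℝ} (hx : x ∈ cell h α σ) :
    (∑ i ∈ σ.filter (h · < α), x i * (α - h i) = ∑ j ∈ σ.filter (α < h ·), x j * (h j - α)) ∧
    0 < ∑ i ∈ σ.filter (h · < α), x i * (α - h i) ∧
    ∀ {M : Type} [AddCommMonoid M] [Module ℝ M] (q : Fin 16 → M), ∑ i, x i • q i =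
      ∑ i ∈ σ.filter (h · < α), x i • q i + ∑ j ∈ σ.filter (α < h ·), x j • q j := by
  have split : ∀ {M : Type} [AddCommMonoid M] [Module ℝ M] (q : Fin 16 → M), ∑ i, x i • q i =
      ∑ i ∈ σ.filter (h · < α), x i • q i + ∑ j ∈ σ.filter (α < h ·), x j • q j := by
    intro M _ _ q
    rw [← Finset.sum_subset (Finset.subset_univ σ)
      fun i _ hi => by rw [hx.2.1 i hi, zero_smul], ← Finset.sum_filter_add_sum_filter_not σ (h · < α)]
    congr 2
    ext i
    simp only [Finset.mem_filter, not_lt]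
    exact and_congr_right fun _ => ⟨fun hi => hi.lt_of_ne (hα i).symm, le_of_lt⟩
  have e0 : ∑ i, x i • (h i - α) = 0 := by
    simp only [smul_eq_mul, mul_sub, Finset.sum_sub_distrib, hx.2.2, ← Finset.sum_mul, hx.1.2]
    ring
  have e1 : ∑ i ∈ σ.filter (h · < α), x i * (α - h i) =
      ∑ j ∈ σ.filter (α < h ·), x j * (h j - α) := by
    rw [split] at e0
    simp only [smul_eq_mul] at e0
    rw [← neg_eq_iff_add_eq_zero, ← Finset.sum_neg_distrib] at e0
    rw [← e0]
    exact Finset.sum_congr rfl fun i _ => by ring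
  have n1 : ∀ i ∈ σ.filter (h · < α), 0 ≤ x i * (α - h i) := fun i hi =>
    mul_nonneg (hx.1.1 i) (sub_nonneg.2 (Finset.mem_filter.1 hi).2.le)
  have n2 : ∀ i ∈ σ.filter (α < h ·), 0 ≤ x i * (h i - α) := fun i hi =>
    mul_nonneg (hx.1.1 i) (sub_nonneg.2 (Finset.mem_filter.1 hi).2.le)
  refine ⟨e1, (Finset.sum_nonneg n1).lt_of_ne' fun e => ?_, split⟩
  have z1 := (Finset.sum_eq_zero_iff_of_nonneg n1).1 e
  have z2 := (Finset.sum_eq_zero_iff_of_nonneg n2).1 (e1.symm.trans e)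
  have hone := hx.1.2
  have := split (fun _ => (1 : ℝ))
  simp only [smul_eq_mul, mul_one] at this
  rw [this, Finset.sum_eq_zero fun i hi => (mul_eq_zero.1 (z1 i hi)).resolve_right
      (sub_ne_zero.2 (hα i).symm), Finset.sum_eq_zero fun i hi =>
      (mul_eq_zero.1 (z2 i hi)).resolve_right (sub_ne_zero.2 (hα i))] at hone
  norm_num at hone

lemma exists_low_high (hα : ∀ i, h i ≠ α) {x : Fin 16 → ℝ} (hx : x ∈ cell h α σ) :
    ∃ i ∈ σ, ∃ j ∈ σ, h i < α ∧ α < h j ∧ 0 < x i ∧ 0 < x j := by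
  obtain ⟨e, hpos, -⟩ := sum_low_eq_sum_high hα hx
  obtain ⟨i, hi, hi'⟩ := Finset.exists_ne_zero_of_sum_ne_zero hpos.ne'
  obtain ⟨j, hj, hj'⟩ := Finset.exists_ne_zero_of_sum_ne_zero (e ▸ hpos).ne'
  rw [Finset.mem_filter] at hi hj
  exact ⟨i, hi.1, j, hj.1, hi.2, hj.2, (hx.1.1 i).lt_of_ne' (left_ne_zero_of_mul hi'),
    (hx.1.1 j).lt_of_ne' (left_ne_zero_of_mul hj')⟩

/-- The vertices of a cell. -/
noncomputable def cellVertices (h : Fin 16 → ℝ) (α : ℝ) (σ : Finset (Fin 16)) :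
    Finset (Fin 16 → ℝ) :=
  open Classical in
  (σ.filter (h · < α) ×ˢ σ.filter (α < h ·)).image fun q => crossing h α q.1 q.2

/-- A cell is a polytope. The weights are those of the transport plan from the part of the mass
below the level to the part above it that is a product measure. -/
lemma cell_subset_convexHull (hα : ∀ i, h i ≠ α) :
    cell h α σ ⊆ convexHull ℝ (cellVertices h α σ : Set (Fin 16 → ℝ)) := by
  intro x hx
  obtain ⟨e, hpos, split⟩ := sum_low_eq_sum_high hα hx
  set A := ∑ i ∈ σ.filter (h · < α), x i * (α - h i) with hA
  have key : ∀ {M : Type} [AddCommMonoid M] [Module ℝ M] (q : Fin 16 → M),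
      ∑ r ∈ σ.filter (h · < α) ×ˢ σ.filter (α < h ·),
        ((A⁻¹ * (x r.1 * (x r.2 * (h r.2 - α)))) • q r.1 +
          (A⁻¹ * (x r.2 * (x r.1 * (α - h r.1)))) • q r.2) = ∑ i, x i • q i := by
    intro M _ _ q
    rw [split, Finset.sum_add_distrib, Finset.sum_product, Finset.sum_product_right]
    congr 1
    · refine Finset.sum_congr rfl fun i _ => ?_
      simp only
      rw [← Finset.sum_smul, ← Finset.mul_sum, ← Finset.mul_sum, ← e, mul_comm (x i),
        inv_mul_cancel_left₀ hpos.ne']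
    · refine Finset.sum_congr rfl fun j _ => ?_
      simp only
      rw [← Finset.sum_smul, ← Finset.mul_sum, ← Finset.mul_sum, ← hA, mul_comm (x j),
        inv_mul_cancel_left₀ hpos.ne']
  have hsum : ∑ r ∈ σ.filter (h · < α) ×ˢ σ.filter (α < h ·),
      A⁻¹ * (x r.1 * x r.2 * (h r.2 - h r.1)) = 1 := by
    have := key (fun _ => (1 : ℝ))
    simp only [smul_eq_mul, mul_one, hx.1.2] at this
    rw [← this]
    exact Finset.sum_congr rfl fun r _ => by ring
  have hx' : ∑ r ∈ σ.filter (h · < α) ×ˢ σ.filter (α < h ·),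
      (A⁻¹ * (x r.1 * x r.2 * (h r.2 - h r.1))) • crossing h α r.1 r.2 = x := by
    have e1 : ∑ i, x i • (Pi.single i 1 : Fin 16 → ℝ) = x := by
      ext k
      simp [Finset.sum_apply, Pi.single_apply]
    conv_rhs => rw [← e1, ← key]
    refine Finset.sum_congr rfl fun r hr => ?_
    rw [Finset.mem_product, Finset.mem_filter, Finset.mem_filter] at hr
    have hne : h r.2 - h r.1 ≠ 0 := by linarith [hr.1.2, hr.2.2]
    ext k
    simp only [crossing, Pi.smul_apply, Pi.add_apply, smul_eq_mul, Pi.single_apply]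
    split_ifs <;> field_simp <;> ring
  rw [← hx']
  refine (convex_convexHull ℝ _).sum_mem (fun r hr => ?_) hsum fun r hr => subset_convexHull ℝ _ ?_
  · rw [Finset.mem_product, Finset.mem_filter, Finset.mem_filter] at hr
    exact mul_nonneg (inv_nonneg.2 hpos.le) (mul_nonneg (mul_nonneg (hx.1.1 _) (hx.1.1 _))
      (by linarith [hr.1.2, hr.2.2]))
  · simp only [cellVertices, Finset.coe_image]
    exact ⟨r, hr, rfl⟩

lemma cellVertices_subset_cell : (cellVertices h α σ : Set (Fin 16 → ℝ)) ⊆ cell h α σ := by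
  intro x hx
  simp only [cellVertices, Finset.coe_image] at hx
  obtain ⟨r, hr, rfl⟩ := hx
  rw [Finset.mem_coe, Finset.mem_product, Finset.mem_filter, Finset.mem_filter] at hr
  exact crossing_mem_cell hr.1.1 hr.2.1 hr.1.2 hr.2.2

/-- The slicings are connected: every point can be joined to a crossing point of an edge within a
simplex, and two such crossing points can be joined along two triangles. -/
theorem isConnected_levelSet (hα : ∀ i, h i ≠ α) (hne : (levelSet h α).Nonempty) :
    IsConnected (levelSet h α) := by
  have hseg : ∀ {σ}, σ ∈ faces → ∀ {x y}, x ∈ cell h α σ → y ∈ cell h α σ →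
      JoinedIn (levelSet h α) x y := fun hσ x y hx hy =>
    JoinedIn.of_segment_subset ((convex_cell.segment_subset hx hy).trans (cell_subset_levelSet hσ))
  have hcross : ∀ {x}, x ∈ levelSet h α → ∃ i j, h i < α ∧ α < h j ∧
      JoinedIn (levelSet h α) x (crossing h α i j) := fun {x} hx => by
    obtain ⟨σ, hσ, hxσ⟩ := exists_mem_cell hx
    obtain ⟨i, hi, j, hj, h1, h2, -, -⟩ := exists_low_high hα hxσ
    exact ⟨i, j, h1, h2, hseg hσ hxσ (crossing_mem_cell hi hj h1 h2)⟩
  obtain ⟨x, hx⟩ := hne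
  refine IsPathConnected.isConnected ⟨x, hx, fun {y} hy => ?_⟩
  obtain ⟨i, j, h1, h2, hj⟩ := hcross hx
  obtain ⟨i', j', h1', h2', hj'⟩ := hcross hy
  refine hj.trans (JoinedIn.trans (y := crossing h α i j') ?_ (JoinedIn.trans ?_ hj'.symm))
  · exact hseg (σ := {i, j, j'}) (mem_faces_of_card_le Finset.card_le_three)
      (crossing_mem_cell (by simp) (by simp) h1 h2) (crossing_mem_cell (by simp) (by simp) h1 h2')
  · exact hseg (σ := {i, i', j'}) (mem_faces_of_card_le Finset.card_le_three)
      (crossing_mem_cell (by simp) (by simp) h1 h2') (crossing_mem_cell (by simp) (by simp) h1' h2')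

/-- A polyhedral neighbourhood of a point `z` of a slicing, obtained by shrinking the cells around it
towards `z` by the factor `1 / 2`. -/
lemma exists_polyhedral_nhds (hα : ∀ i, h i ≠ α) {z : Fin 16 → ℝ} (hz : z ∈ levelSet h α) :
    ∃ P : Finset (Finset (Fin 16 → ℝ)),
      (⋃ s ∈ P, convexHull ℝ (s : Set (Fin 16 → ℝ))) ⊆ {x ∈ levelSet h α | ∀ i, z i / 2 ≤ x i} ∧
      (⋃ s ∈ P, convexHull ℝ (s : Set (Fin 16 → ℝ))) ∈ nhdsWithin z (levelSet h α) := by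
  classical
  let H : (Fin 16 → ℝ) →ᵃ[ℝ] (Fin 16 → ℝ) := AffineMap.homothety z (2⁻¹ : ℝ)
  have hH : ∀ y i, H y i = 2⁻¹ * (y i + z i) := fun y i => by
    simp only [H, AffineMap.homothety_apply, vsub_eq_sub, vadd_eq_add, Pi.add_apply, Pi.smul_apply,
      Pi.sub_apply, smul_eq_mul]
    ring
  let P := (Finset.univ.filter fun σ : Finset (Fin 16) => σ ∈ faces ∧ z ∈ cell h α σ).image
    fun σ => (cellVertices h α σ).image H
  have hc : ∀ σ, convexHull ℝ (((cellVertices h α σ).image H : Finset (Fin 16 → ℝ)) :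
      Set (Fin 16 → ℝ)) = H '' cell h α σ := fun σ => by
    rw [Finset.coe_image, ← AffineMap.image_convexHull,
      (convexHull_min cellVertices_subset_cell convex_cell).antisymm (cell_subset_convexHull hα)]
  have hmem : ∀ x, x ∈ (⋃ s ∈ P, convexHull ℝ (s : Set (Fin 16 → ℝ))) ↔
      ∃ σ ∈ faces, z ∈ cell h α σ ∧ ∃ y ∈ cell h α σ, H y = x := by
    intro x
    simp only [P, Set.mem_iUnion, exists_prop, Finset.exists_mem_image, hc, Finset.mem_filter,
      Finset.mem_univ, true_and, and_assoc]
    rfl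
  refine ⟨P, fun x hx => ?_, ?_⟩
  · obtain ⟨σ, hσ, hzσ, y, hy, rfl⟩ := (hmem x).1 hx
    refine ⟨cell_subset_levelSet hσ ?_, fun i => ?_⟩
    · have : H y = (2⁻¹ : ℝ) • y + (2⁻¹ : ℝ) • z := by
        ext i
        rw [hH]
        simp [mul_add]
      rw [this]
      exact convex_cell hy hzσ (by norm_num) (by norm_num) (by norm_num)
    · rw [hH]
      have := hy.1.1 i
      linarith
  · rw [mem_nhdsWithin]
    refine ⟨⋂ i, {x | z i ≤ 0 ∨ z i / 2 < x i}, isOpen_iInter_of_finite fun i => ?_,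
      Set.mem_iInter.2 fun i => ?_, ?_⟩
    · exact isOpen_const.union (isOpen_lt continuous_const (continuous_apply i))
    · rcases le_or_gt (z i) 0 with hi | hi
      · exact Or.inl hi
      · exact Or.inr (by linarith)
    · rintro x ⟨hx, hxL⟩
      rw [Set.mem_iInter] at hx
      obtain ⟨σ, hσ, hxσ⟩ := exists_mem_cell hxL
      have hzσ : z ∈ cell h α σ := ⟨hz.1.1, fun i hi => by
        rcases hx i with h | h
        · exact h.antisymm (hz.1.1.1 i)
        · rw [hxσ.2.1 i hi] at h
          linarith [hz.1.1.1 i], hz.2⟩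
      refine (hmem x).2 ⟨σ, hσ, hzσ, fun i => 2 * x i - z i, ⟨⟨fun i => ?_, ?_⟩, fun i hi => ?_, ?_⟩,
        ?_⟩
      · have := hxσ.1.1 i
        rcases hx i with h | h
        all_goals
          simp only
          linarith
      · rw [Finset.sum_sub_distrib, ← Finset.mul_sum, hxσ.1.2, hz.1.1.2]
        norm_num
      · simp [hxσ.2.1 i hi, hzσ.2.1 i hi]
      · simp only [sub_mul, mul_assoc, Finset.sum_sub_distrib, ← Finset.mul_sum, hxσ.2.2, hz.2]
        ring
      · ext i
        rw [hH]
        ring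

end K3

namespace K3

open SimplexFamily AbstractSimplicialComplex

variable {h : Fin 16 → ℝ} {α : ℝ}

/-- Around an edge that crosses the level, the fan of the link of the edge is a chart: a point of
the level is determined by its coordinates at the vertices different from `a` and `b`. -/
theorem exists_chart {a b : Fin 16} (hab : h a ≠ h b) (hL : (levelSet h α).Nonempty) :
    ∃ (e : OpenPartialHomeomorph (levelSet h α) (EuclideanSpace ℝ (Fin 3)))
      (A : (Fin 16 → ℝ) →ₗ[ℝ] EuclideanSpace ℝ (Fin 3)),
      e.source = {x | 0 < x.1 a ∧ 0 < x.1 b} ∧ ∀ x, e x = A x.1 := by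
  have hne : a ≠ b := fun e => hab (by rw [e])
  have hd : h b - h a ≠ 0 := sub_ne_zero.2 hab.symm
  obtain ⟨p, ψ, hpa, hpb, hψ, h1, h2⟩ := exists_fan hne
  -- the coordinates at `a` and `b` are found from the two linear equations
  let s : EuclideanSpace ℝ (Fin 3) → ℝ := fun t => ∑ i, ψ t i
  let r : EuclideanSpace ℝ (Fin 3) → ℝ := fun t => ∑ i, ψ t i * h i
  let ca : EuclideanSpace ℝ (Fin 3) → ℝ := fun t =>
    ((1 - s t) * h b - (α - r t)) / (h b - h a)
  let cb : EuclideanSpace ℝ (Fin 3) → ℝ := fun t =>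
    ((α - r t) - (1 - s t) * h a) / (h b - h a)
  have hs : Continuous s := continuous_finsetSum _ fun i _ => (continuous_apply i).comp hψ
  have hr : Continuous r :=
    continuous_finsetSum _ fun i _ => ((continuous_apply i).comp hψ).mul continuous_const
  have hca : Continuous ca := by fun_prop
  have hcb : Continuous cb := by fun_prop
  let inv : EuclideanSpace ℝ (Fin 3) → Fin 16 → ℝ := fun t =>
    ψ t + Pi.single a (ca t) + Pi.single b (cb t)
  have hinv : Continuous inv :=
    (hψ.add ((continuous_single a).comp hca)).add ((continuous_single b).comp hcb)
  have hinva : ∀ t, inv t a = ca t := fun t => by simp [inv, (h1 t).2.1, hne]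
  have hinvb : ∀ t, inv t b = cb t := fun t => by simp [inv, (h1 t).2.2.1, hne.symm]
  have hmem : ∀ t, 0 < ca t → 0 < cb t → inv t ∈ levelSet h α := fun t hat hbt => by
    obtain ⟨h0, -, -, ⟨σ, hσ, ha, hb, hz⟩, -⟩ := h1 t
    have n1 : 0 ≤ (Pi.single a (ca t) : Fin 16 → ℝ) := Pi.single_nonneg.2 hat.le
    have n2 : 0 ≤ (Pi.single b (cb t) : Fin 16 → ℝ) := Pi.single_nonneg.2 hbt.le
    refine ⟨⟨⟨fun i => add_nonneg (add_nonneg (h0 i) (n1 i)) (n2 i), ?_⟩, σ, hσ, fun i hi => ?_⟩, ?_⟩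
    · simp only [inv, Pi.add_apply, Finset.sum_add_distrib, Finset.sum_pi_single', Finset.mem_univ,
        if_true]
      change s t + ca t + cb t = 1
      simp only [ca, cb]
      field_simp
      ring
    · have hia : i ≠ a := fun e => hi (e ▸ ha)
      have hib : i ≠ b := fun e => hi (e ▸ hb)
      simp [inv, hz i hi, hia, hib]
    · simp only [inv, Pi.add_apply, add_mul, Finset.sum_add_distrib, sum_single_mul]
      change r t + ca t * h a + cb t * h b = α
      simp only [ca, cb]
      field_simp
      ring
  let A : (Fin 16 → ℝ) →ₗ[ℝ] EuclideanSpace ℝ (Fin 3) := Fintype.linearCombination ℝ p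
  have hA : ∀ x, A x = ∑ i, x i • p i := fun x => Fintype.linearCombination_apply ℝ p x
  have hAsingle : ∀ c d, A (Pi.single a c) = 0 ∧ A (Pi.single b d) = 0 := fun c d => by
    simp [A, hpa, hpb]
  have hAc : Continuous A := A.continuous_of_finiteDimensional
  have hAinv : ∀ t, A (inv t) = t := fun t => by
    simp only [inv, map_add, (hAsingle _ (cb t)).1, (hAsingle (ca t) _).2, add_zero]
    rw [hA, (h1 t).2.2.2.2]
  have hleft : ∀ x ∈ levelSet h α, 0 < x a → 0 < x b → inv (A x) = x ∧ ca (A x) = x a ∧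
      cb (A x) = x b := by
    rintro x ⟨⟨⟨hx0, hx1⟩, σ, hσ, hxσ⟩, hxα⟩ hxa hxb
    let z : Fin 16 → ℝ := x - Pi.single a (x a) - Pi.single b (x b)
    have hza : z a = 0 := by simp [z, hne]
    have hzb : z b = 0 := by simp [z, hne.symm]
    have hzi : ∀ i, i ≠ a → i ≠ b → z i = x i := fun i hia hib => by simp [z, hia, hib]
    have ha : a ∈ σ := by
      by_contra ha
      exact hxa.ne' (hxσ a ha)
    have hb : b ∈ σ := by
      by_contra hb
      exact hxb.ne' (hxσ b hb)
    have hψz : ψ (A x) = z := by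
      have : A x = ∑ i, z i • p i := by
        rw [← hA]
        simp only [z, map_sub, (hAsingle (x a) (x b)).1, (hAsingle (x a) (x b)).2, sub_zero]
      rw [this]
      refine h2 z (fun i => ?_) hza hzb ⟨σ, hσ, ha, hb, fun i hi => ?_⟩
      · by_cases hia : i = a
        · rw [hia, hza, Pi.zero_apply]
        by_cases hib : i = b
        · rw [hib, hzb, Pi.zero_apply]
        rw [hzi i hia hib]
        exact hx0 i
      · rw [hzi i (fun e => hi (e ▸ ha)) (fun e => hi (e ▸ hb)), hxσ i hi]
    have hsz : s (A x) = 1 - x a - x b := by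
      simp only [s, hψz, z, Pi.sub_apply, Finset.sum_sub_distrib, hx1, Finset.sum_pi_single',
        Finset.mem_univ, if_true]
    have hrz : r (A x) = α - x a * h a - x b * h b := by
      simp only [r, hψz, z, Pi.sub_apply, sub_mul, Finset.sum_sub_distrib, hxα, sum_single_mul]
    have hcax : ca (A x) = x a := by
      simp only [ca, hsz, hrz]
      field_simp
      ring
    have hcbx : cb (A x) = x b := by
      simp only [cb, hsz, hrz]
      field_simp
      ring
    refine ⟨?_, hcax, hcbx⟩
    simp only [inv, hψz, hcax, hcbx, z]
    abel
  -- outside of its target the inverse of the chart has an arbitrary value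
  obtain ⟨x₀, hx₀⟩ := hL
  classical
  refine ⟨{
    toFun := fun x => A x.1
    invFun := fun t => if ht : 0 < ca t ∧ 0 < cb t then ⟨inv t, hmem t ht.1 ht.2⟩ else ⟨x₀, hx₀⟩
    source := {x | 0 < x.1 a ∧ 0 < x.1 b}
    target := {t | 0 < ca t ∧ 0 < cb t}
    map_source' := fun x hx => by
      obtain ⟨-, ea, eb⟩ := hleft x.1 x.2 hx.1 hx.2
      exact ⟨ea ▸ hx.1, eb ▸ hx.2⟩
    map_target' := fun t ht => by
      rw [dif_pos (show 0 < ca t ∧ 0 < cb t from ht)]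
      exact ⟨ht.1.trans_eq (hinva t).symm, ht.2.trans_eq (hinvb t).symm⟩
    left_inv' := fun x hx => by
      obtain ⟨e, ea, eb⟩ := hleft x.1 x.2 hx.1 hx.2
      rw [dif_pos ⟨ea ▸ hx.1, eb ▸ hx.2⟩]
      exact Subtype.ext e
    right_inv' := fun t ht => by
      rw [dif_pos (show 0 < ca t ∧ 0 < cb t from ht)]
      exact hAinv t
    open_source :=
      (isOpen_lt continuous_const ((continuous_apply a).comp continuous_subtype_val)).inter
        (isOpen_lt continuous_const ((continuous_apply b).comp continuous_subtype_val))
    open_target := (isOpen_lt continuous_const hca).inter (isOpen_lt continuous_const hcb)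
    continuousOn_toFun := (hAc.comp continuous_subtype_val).continuousOn
    continuousOn_invFun := by
      rw [Topology.IsInducing.subtypeVal.continuousOn_iff]
      exact hinv.continuousOn.congr fun t ht => by
        rw [Function.comp_apply, dif_pos (show 0 < ca t ∧ 0 < cb t from ht)] }, A, rfl, fun x => rfl⟩

/-- The slicings are PL manifolds. -/
theorem isPLManifold_levelSet (hα : ∀ i, h i ≠ α) : IsPLManifold 3 (levelSet h α) := by
  intro y
  obtain ⟨σ, -, hy⟩ := exists_mem_cell y.2
  obtain ⟨a, -, b, -, ha, hb, hya, hyb⟩ := exists_low_high hα hy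
  obtain ⟨e, A, hs, hA⟩ := exists_chart (ha.trans hb).ne ⟨y.1, y.2⟩
  refine ⟨e, by rw [hs]; exact ⟨hya, hyb⟩, fun z hz => ?_⟩
  rw [hs] at hz
  obtain ⟨P, hP, hP'⟩ := exists_polyhedral_nhds hα z.2
  refine ⟨P, fun x hx => ?_, hP', fun s _ => ⟨A.toAffineMap, fun w _ => hA w⟩⟩
  obtain ⟨hx, hx'⟩ := hP hx
  refine ⟨⟨x, hx⟩, ?_, rfl⟩
  rw [hs]
  exact ⟨(half_pos hz.1).trans_le (hx' a), (half_pos hz.2).trans_le (hx' b)⟩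

end K3

theorem mainTheorem6 (f : K3.complex.realization → ℝ)
    (hf : AbstractSimplicialComplex.IsRSL K3.complex f) :
    (∀ (F : Type u) [Field F],
      -- some vertex is critical of index 2 with multiplicity higher than 2
      (∃ v : Fin 16, ∃ m : ℕ, 2 < m ∧
        AbstractSimplicialComplex.IsCritical F f (K3.complex.vertex v) 2 m) ∧
      -- there are 10 middle vertices, and no other vertex is critical of index 2
      (AbstractSimplicialComplex.middleVertices f).card = 10 ∧
      (∀ v : Fin 16, v ∉ AbstractSimplicialComplex.middleVertices f →
        AbstractSimplicialComplex.multiplicity F f (K3.complex.vertex v) 2 = 0) ∧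
      -- the middle vertices carry all critical points of index 2, and build up `b_2 = 22`
      ∑ v ∈ AbstractSimplicialComplex.middleVertices f,
        AbstractSimplicialComplex.multiplicity F f (K3.complex.vertex v) 2 = 22 ∧
      AbstractSimplicialComplex.criticalCount F f 2 = 22 ∧
      bettiNumber F K3.complex.realization 2 = 22) ∧
    -- every (nonempty) slicing is a connected 3-manifold
    (∀ α : ℝ, (∀ v : Fin 16, f (K3.complex.vertex v) ≠ α) →
      (AbstractSimplicialComplex.level f α).Nonempty →
        IsConnected (AbstractSimplicialComplex.level f α) ∧
        IsPLManifold 3 (AbstractSimplicialComplex.level f α)) := by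
  refine ⟨fun F _ => K3.critical_points F hf, fun α hα hne => ?_⟩
  rw [K3.level_eq hf] at hne ⊢
  exact ⟨K3.isConnected_levelSet hα hne, K3.isPLManifold_levelSet hα⟩
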